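/- Let $\mathbb N=\{0,1,2,\dots\}$, $\mathbb N^*=\{1,2,\dots\}$, $m\in\mathbb N^*$, $I_m=\{(j,\alpha)\in\mathbb N^2 : j+\alpha\le m,\ j<m\}$, $N=\#I_m$, and let $F(t,x,z)$, $z=(z_{j,\alpha})_{(j,\alpha)\in I_m}$, be a function on an open polydisk $\Delta$ centered at the origin of $\mathbb C_t\times\mathbb C_x\times\mathbb C_z^N$ such that A$_1$) $F$ is holomorphic in $\Delta$; A$_2$) $F(0,x,0)\equiv0$ on $\Delta\cap\{t=0,z=0\}$. Write $F(t,x,z)=a(x)t+\sum_{(j,\alpha)\in I_m}b_{j,\alpha}(x)z_{j,\alpha}+R_2(t,x,z)$, where $R_2$ contains exactly the terms of order at least $2$ in $(t,z)$ of the Taylor expansion of $F$. Assume moreover A$_3$) $b_{j,\alpha}(x)=O(x^\alpha)$ as $x\to0$ for all $(j,\alpha)\in I_m$ with $\alpha>0$, and put $b_{j,\alpha}(x)=x^\alpha c_{j,\alpha}(x)$ for $(j,\alpha)\in I_m$, $c_{m,0}(x)=-1$, and $$L(\lambda,\rho)=\lambda^m-\sum_{(j,\alpha)\in I_m}c_{j,\alpha}(0)\lambda^j\rho(\rho-1)\cdots(\rho-\alpha+1).$$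 Let $\Lambda_0=\{(m,0)\}\cup\{(j,\alpha)\in I_m : c_{j,\alpha}(0)\ne0\}$, and let the Newton polygon $\mathcal N_0$ be the convex hull of $\bigcup_{(j,\alpha)\in\Lambda_0}\{(x,y)\in\mathbb R^2 : x\le j,\ y\le\alpha\}$, with vertices $(m_1,n_1)=(m,0),\dots,(m_p,n_p)$ listed by decreasing first coordinate. For $1\le i\le p-1$ let $\Gamma_i$ be the segment from $(m_i,n_i)$ to $(m_{i+1},n_{i+1})$, let $\Gamma_p=\{(x,n_p) : x\le m_p\}$, and set $P_i(X)=\sum_{(j,\alpha)\in\Lambda_0\cap\Gamma_i}c_{j,\alpha}(0)X^{j-m_{i+1}}$ for $1\le i\le p-1$, $P_p(X)=1$ if $m_p=0$, and $P_p(X)=\sum_{(j,\alpha)\in\Lambda_0\cap\Gamma_p}c_{j,\alpha}(0)X^{j}$ if $m_p\ge1$. Assume (N) $L(k,l)\ne0$ for all $(k,l)\in\mathbb N^*\times\mathbb N$; (GP) for $1\le i\le p-1$ no root of $P_i$ lies in $[0,\infty)$, and no root of $P_p$ lies in $\mathbb N^*$. Let $\Lambda_1=\{(j,\alpha)\in I_m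 : c_{j,\alpha}(0)=0,\ c_{j,\alpha}\not\equiv0\}$; for $(j,\alpha)\in\Lambda_1$ let $p_{j,\alpha}$ be the order of the zero of $c_{j,\alpha}$ at $x=0$ and $d_{j,\alpha}=\min\{y\in\mathbb R : (j,\alpha-y)\in\mathcal N_0\}$. The irregularity at $x=0$ is $$\sigma_0=\max\Bigl[1,\ \max_{(j,\alpha)\in\Lambda_1}\frac{p_{j,\alpha}+d_{j,\alpha}}{p_{j,\alpha}}\Bigr].$$ For $\mu\in\mathbb N$ and $(j,\alpha)\in I_m$ let $L_{\mu,j,\alpha}\in\mathbb N\cup\{\infty\}$ be the valuation (lowest total degree in $(t,z)$ of a nonzero Taylor term, $\infty$ for the zero series) of $(\partial_{z_{j,\alpha}}\partial_x^\mu R_2)(t,0,z)$, and let $$s_0=1+\max\Bigl[0,\ \max_{0\le\mu<m}\ \max_{(j,\alpha)\in I_m}\frac{j+\mu+\sigma_0(\alpha-\mu)-m}{L_{\mu,j,\alpha}}\Bigr],$$ where a quotient with denominator $\infty$ is $0$. For real $s,\sigma\ge1$ let $G\{t,x\}_{(s,\sigma)}$ be the set of all $\sum_{k,l\ge0}a_{k,l}t^kx^l\in\mathbb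 C[[t,x]]$ such that $\sum_{k,l\ge0}\frac{a_{k,l}}{k!^{s-1}l!^{\sigma-1}}t^kx^l$ converges in a neighborhood of $(0,0)\in\mathbb C_t\times\mathbb C_x$. Then the equation $$(t\partial_t)^mu=F\bigl(t,x,\{(t\partial_t)^j\partial_x^\alpha u\}_{(j,\alpha)\in I_m}\bigr)$$ has a unique formal solution $u(t,x)\in\mathbb C[[t,x]]$ with $u(0,x)\equiv0$, and: (i) if $\sigma_0=1$, then $u(t,x)$ converges in a neighborhood of $(0,0)\in\mathbb C_t\times\mathbb C_x$; (ii) if $\sigma_0>1$, then $u(t,x)\in G\{t,x\}_{(s,\sigma)}$ for all $s\ge s_0$ and $\sigma\ge\sigma_0$. -/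

import Mathlib

open scoped Nat Topology

noncomputable section

namespace Maillet

/-- The index set `I_m = {(j, α) : j + α ≤ m, j < m}`. -/
def idxSet (m : ℕ) : Finset (ℕ × ℕ) :=
  (Finset.range m ×ˢ Finset.range (m + 1)).filter fun q => q.1 + q.2 ≤ m ∧ q.1 < m

/-- `I_m` as a type. -/
abbrev Idx (m : ℕ) : Type := ↥(idxSet m)

/-- The variables `t`, `x` and `z_{j,α}`, `(j, α) ∈ I_m`, of `F(t, x, z)`. -/
abbrev Var (m : ℕ) : Type := Fin 2 ⊕ Idx m

/-- The variable `t`. -/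
abbrev vt (m : ℕ) : Var m := Sum.inl 0

/-- The variable `x`. -/
abbrev vx (m : ℕ) : Var m := Sum.inl 1

/-- The variable `z_{j,α}`. -/
abbrev vz {m : ℕ} (q : Idx m) : Var m := Sum.inr q

/-- The open polydisk of polyradius `r` centered at the origin. -/
def polydisk (m : ℕ) (r : Var m → ℝ) : Set (Var m → ℂ) := {w | ∀ v, ‖w v‖ < r v}

/-- The Taylor coefficient `(∂^d F)(0) / d!` of `F` at the origin. The mixed derivative `∂^d F` is
the iterated Fréchet derivative evaluated at the list of basis vectors in which the one of the
variable `v` occurs `d v` times. -/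
def taylorCoeff {m : ℕ} (F : (Var m → ℂ) → ℂ) (d : Var m →₀ ℕ) : ℂ :=
  iteratedFDeriv ℂ (Finsupp.toMultiset d).toList.length F 0
      (fun i => Pi.single ((Finsupp.toMultiset d).toList.get i) 1)
    / ∏ v, ((d v)! : ℂ)

/-- The Taylor series of `F` at the origin, in `ℂ[[t, x, z]]`. -/
def taylor {m : ℕ} (F : (Var m → ℂ) → ℂ) : MvPowerSeries (Var m) ℂ := fun d => taylorCoeff F d

/-! ### Formal solutions and Gevrey classes -/

/-- `ℂ[[t, x]]`; the variable `0` is `t` and the variable `1` is `x`. -/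
abbrev FPS : Type := MvPowerSeries (Fin 2) ℂ

/-- The operator `t ∂_t`. -/
def tDt (u : FPS) : FPS := MvPowerSeries.X 0 * MvPowerSeries.pderiv ℂ 0 u

/-- The operator `∂_x`. -/
def Dx (u : FPS) : FPS := MvPowerSeries.pderiv ℂ 1 u

/-- What is substituted for the variables of `F`: `t`, `x` and `(t ∂_t)^j ∂_x^α u`. -/
def jet (m : ℕ) (u : FPS) : Var m → FPS
  | Sum.inl i => MvPowerSeries.X i
  | Sum.inr q => tDt^[q.1.1] (Dx^[q.1.2] u)

/-- `u ∈ ℂ[[t, x]]` satisfies `u(0, x) ≡ 0` and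
`(t ∂_t)^m u = F(t, x, {(t ∂_t)^j ∂_x^α u})`. As `u(0, x) ≡ 0`, all components of `jet m u` have
constant coefficient zero, so that the Taylor series of `F` can be composed with them. -/
def IsFormalSolution {m : ℕ} (F : (Var m → ℂ) → ℂ) (u : FPS) : Prop :=
  (∀ l : ℕ, MvPowerSeries.coeff (Finsupp.single 1 l) u = 0) ∧
    tDt^[m] u = MvPowerSeries.subst (jet m u) (taylor F)

/-- Convergence of a power series in a neighborhood of `(0, 0) ∈ ℂ × ℂ`. -/
def IsConvergent (f : FPS) : Prop :=
  ∀ᶠ w : ℂ × ℂ in 𝓝 0,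
    Summable fun d : Fin 2 →₀ ℕ => MvPowerSeries.coeff d f * w.1 ^ d 0 * w.2 ^ d 1

/-- The series `∑ a_{k,l} / (k!^{s-1} l!^{σ-1}) t^k x^l`. -/
def borel (s σ : ℝ) (f : FPS) : FPS := fun d =>
  MvPowerSeries.coeff d f / ((((d 0)! : ℝ) ^ (s - 1) * ((d 1)! : ℝ) ^ (σ - 1) : ℝ) : ℂ)

/-- The formal Gevrey class `G{t, x}_{(s, σ)}`. -/
def Gevrey (s σ : ℝ) : Set FPS := {f | IsConvergent (borel s σ f)}

/-! ### The linear part of the equation -/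

/-- The exponent of the monomial `x^l z_q`. -/
def linExp {m : ℕ} (q : Idx m) (l : ℕ) : Var m →₀ ℕ :=
  Finsupp.single (vx m) l + Finsupp.single (vz q) 1

/-- The expansion at `x = 0` of `b_{j,α}(x) = (∂F/∂z_{j,α})(0, x, 0)`. -/
def b {m : ℕ} (F : (Var m → ℂ) → ℂ) (q : Idx m) : PowerSeries ℂ :=
  PowerSeries.mk fun l => MvPowerSeries.coeff (linExp q l) (taylor F)

/-- The expansion at `x = 0` of `c_{j,α}(x) = x^{-α} b_{j,α}(x)` for `(j, α) ∈ I_m`; moreover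
`c_{m,0} = -1`, and `c_{j,α} = 0` for all other pairs. -/
def c {m : ℕ} (F : (Var m → ℂ) → ℂ) (q : ℕ × ℕ) : PowerSeries ℂ :=
  if q = (m, 0) then -1
  else if h : q ∈ idxSet m then
    PowerSeries.mk fun l => PowerSeries.coeff (l + q.2) (b F ⟨q, h⟩)
  else 0

/-- The value `c_{j,α}(0)`. -/
def c0 {m : ℕ} (F : (Var m → ℂ) → ℂ) (q : ℕ × ℕ) : ℂ := PowerSeries.constantCoeff (c F q)

/-- `L(λ, ρ) = λ^m - ∑_{(j,α) ∈ I_m} c_{j,α}(0) λ^j ρ (ρ - 1) ⋯ (ρ - α + 1)`. -/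
def L {m : ℕ} (F : (Var m → ℂ) → ℂ) (lam ρ : ℂ) : ℂ :=
  lam ^ m - ∑ q ∈ idxSet m, c0 F q * lam ^ q.1 * ∏ i ∈ Finset.range q.2, (ρ - (i : ℂ))

/-- `A₁)` for the polydisk of polyradius `r`: `F` is holomorphic. -/
def A1 {m : ℕ} (F : (Var m → ℂ) → ℂ) (r : Var m → ℝ) : Prop :=
  AnalyticOnNhd ℂ F (polydisk m r)

/-- `A₂)` for the polydisk of polyradius `r`: `F(0, x, 0) ≡ 0`. -/
def A2 {m : ℕ} (F : (Var m → ℂ) → ℂ) (r : Var m → ℝ) : Prop :=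
  ∀ w ∈ polydisk m r, (∀ v, v ≠ vx m → w v = 0) → F w = 0

/-- `A₃)`: `b_{j,α}(x) = O(x^α)` for all `(j, α) ∈ I_m` with `α > 0`. -/
def A3 {m : ℕ} (F : (Var m → ℂ) → ℂ) : Prop :=
  ∀ q : Idx m, 0 < q.1.2 → (PowerSeries.X : PowerSeries ℂ) ^ q.1.2 ∣ b F q

/-- The non-resonance condition (N). -/
def NonResonance {m : ℕ} (F : (Var m → ℂ) → ℂ) : Prop :=
  ∀ k l : ℕ, 1 ≤ k → L F k l ≠ 0

/-! ### The Newton polygon and the generalized Poincaré condition -/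

open scoped Classical in
/-- `Λ₀ = {(m, 0)} ∪ {(j, α) ∈ I_m : c_{j,α}(0) ≠ 0}`. -/
def Λ₀ {m : ℕ} (F : (Var m → ℂ) → ℂ) : Finset (ℕ × ℕ) :=
  insert (m, 0) ((idxSet m).filter fun q => c0 F q ≠ 0)

/-- A pair of natural numbers as a point of the plane. -/
def pt (q : ℕ × ℕ) : ℝ × ℝ := ((q.1 : ℝ), (q.2 : ℝ))

/-- The Newton polygon: the convex hull of the union of the quadrants
`{(x, y) : x ≤ j, y ≤ α}`, `(j, α) ∈ Λ₀`. -/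
def newtonPolygon {m : ℕ} (F : (Var m → ℂ) → ℂ) : Set (ℝ × ℝ) :=
  convexHull ℝ (⋃ q ∈ Λ₀ F, {y : ℝ × ℝ | y.1 ≤ (pt q).1 ∧ y.2 ≤ (pt q).2})

/-- The vertices of the Newton polygon. -/
def IsVertex {m : ℕ} (F : (Var m → ℂ) → ℂ) (v : ℕ × ℕ) : Prop :=
  pt v ∈ (newtonPolygon F).extremePoints ℝ

/-- `v = (m_i, n_i)` and `w = (m_{i+1}, n_{i+1})` are consecutive vertices, listed by decreasing
first coordinate; the corresponding bounded edge `Γ_i` is the segment from `v` to `w`. -/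
def IsEdge {m : ℕ} (F : (Var m → ℂ) → ℂ) (v w : ℕ × ℕ) : Prop :=
  IsVertex F v ∧ IsVertex F w ∧ w.1 < v.1 ∧ ∀ y, IsVertex F y → ¬ (w.1 < y.1 ∧ y.1 < v.1)

/-- `v` is the last vertex `(m_p, n_p)`, the one with the least first coordinate. -/
def IsLastVertex {m : ℕ} (F : (Var m → ℂ) → ℂ) (v : ℕ × ℕ) : Prop :=
  IsVertex F v ∧ ∀ y, IsVertex F y → v.1 ≤ y.1

open scoped Classical in
/-- The characteristic polynomial `∑_{(j,α) ∈ Λ₀ ∩ Γ_i} c_{j,α}(0) X^{j - m_{i+1}}` of the edge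
`Γ_i` from `v` to `w = (m_{i+1}, n_{i+1})`. -/
def edgePoly {m : ℕ} (F : (Var m → ℂ) → ℂ) (v w : ℕ × ℕ) : Polynomial ℂ :=
  ∑ q ∈ (Λ₀ F).filter (fun q => pt q ∈ segment ℝ (pt v) (pt w)),
    Polynomial.C (c0 F q) * Polynomial.X ^ (q.1 - w.1)

open scoped Classical in
/-- The characteristic polynomial of the horizontal half line `Γ_p` ending in the last vertex
`v = (m_p, n_p)`: it is `1` if `m_p = 0` and `∑_{(j,α) ∈ Λ₀ ∩ Γ_p} c_{j,α}(0) X^j` otherwise. -/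
def lastPoly {m : ℕ} (F : (Var m → ℂ) → ℂ) (v : ℕ × ℕ) : Polynomial ℂ :=
  if v.1 = 0 then 1
  else ∑ q ∈ (Λ₀ F).filter (fun q => q.1 ≤ v.1 ∧ q.2 = v.2),
    Polynomial.C (c0 F q) * Polynomial.X ^ q.1

/-- The generalized Poincaré condition (GP): no characteristic root on a bounded edge lies in
`[0, ∞)`, and no characteristic root on the horizontal half line is a positive integer. -/
def GenPoincare {m : ℕ} (F : (Var m → ℂ) → ℂ) : Prop :=
  (∀ v w, IsEdge F v w → ∀ lam : ℂ, (edgePoly F v w).IsRoot lam →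
      ∀ y : ℝ, 0 ≤ y → lam ≠ (y : ℂ)) ∧
    (∀ v, IsLastVertex F v → ∀ lam : ℂ, (lastPoly F v).IsRoot lam →
      ∀ n : ℕ, 1 ≤ n → lam ≠ (n : ℂ))

/-! ### The indices `σ₀` and `s₀` -/

open scoped Classical in
/-- `Λ₁ = {(j, α) ∈ I_m : c_{j,α}(0) = 0, c_{j,α} ≢ 0}`. -/
def Λ₁ {m : ℕ} (F : (Var m → ℂ) → ℂ) : Finset (ℕ × ℕ) :=
  (idxSet m).filter fun q => c0 F q = 0 ∧ c F q ≠ 0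

/-- The order `p_{j,α}` of the zero of `c_{j,α}` at `x = 0` (used for `c_{j,α} ≢ 0` only). -/
def p {m : ℕ} (F : (Var m → ℂ) → ℂ) (q : ℕ × ℕ) : ℕ := (c F q).order.toNat

/-- `d_{j,α} = min {y ∈ ℝ : (j, α - y) ∈ N₀}`; the minimum exists for `0 ≤ j ≤ m`. -/
def d {m : ℕ} (F : (Var m → ℂ) → ℂ) (q : ℕ × ℕ) : ℝ :=
  sInf {y : ℝ | ((q.1 : ℝ), (q.2 : ℝ) - y) ∈ newtonPolygon F}

/-- The irregularity `σ₀ = max [1, max_{(j,α) ∈ Λ₁} (p_{j,α} + d_{j,α}) / p_{j,α}]`. -/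
def σ₀ {m : ℕ} (F : (Var m → ℂ) → ℂ) : ℝ :=
  (Λ₁ F).fold max 1 fun q => ((p F q : ℝ) + d F q) / (p F q : ℝ)

/-- `R₂(t, x, z)`: the part of `F` of order at least two in `(t, z)`. -/
def R₂ {m : ℕ} (F : (Var m → ℂ) → ℂ) : MvPowerSeries (Var m) ℂ := fun e =>
  if 2 ≤ e (vt m) + ∑ q : Idx m, e (vz q) then MvPowerSeries.coeff e (taylor F) else 0

/-- `f(t, 0, z)`, as a power series that does not involve `x`. -/
def atXZero {m : ℕ} (f : MvPowerSeries (Var m) ℂ) : MvPowerSeries (Var m) ℂ := fun e =>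
  if e (vx m) = 0 then MvPowerSeries.coeff e f else 0

/-- `L_{μ,j,α}`: the valuation (order) of `(∂_{z_{j,α}} ∂_x^μ R₂)(t, 0, z)`, which is `⊤` if this
series is zero. -/
def Lval {m : ℕ} (F : (Var m → ℂ) → ℂ) (μ : ℕ) (q : Idx m) : ℕ∞ :=
  (atXZero (MvPowerSeries.pderiv ℂ (vz q)
    ((MvPowerSeries.pderiv ℂ (vx m))^[μ] (R₂ F)))).order

/-- The quotient `(j + μ + σ₀ (α - μ) - m) / L_{μ,j,α}`, which is zero if `L_{μ,j,α} = ∞`. -/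
def s₀Quot {m : ℕ} (F : (Var m → ℂ) → ℂ) (μ : ℕ) (q : Idx m) : ℝ :=
  if Lval F μ q = ⊤ then 0
  else ((q.1.1 : ℝ) + μ + σ₀ F * ((q.1.2 : ℝ) - μ) - m) / ((Lval F μ q).toNat : ℝ)

/-- `s₀ = 1 + max [0, max_{0 ≤ μ < m} max_{(j,α) ∈ I_m}
(j + μ + σ₀ (α - μ) - m) / L_{μ,j,α}]`. -/
def s₀ {m : ℕ} (F : (Var m → ℂ) → ℂ) : ℝ :=
  1 + (Finset.range m ×ˢ (Finset.univ : Finset (Idx m))).fold max 0 fun y => s₀Quot F y.1 y.2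

end Maillet

end

/-! Comparing coefficients of `t^k x^l` turns the equation into L(k,l) u_{k,l} = `recRhs`. By A₃,
x^{i+α}∂_x^α sends x^{l-i} to a multiple of x^l, so the linear part involves only u_{k,l'} with l' ≤
l, and the terms with l' = l make up L(k,l). The part R₂ has degree at least two in (t,z), and u
starts at order t, so its coefficient of t^k involves only u_{k',·} with k' < k. By (N) the system
is solved uniquely along the lexicographic order of (k,l).

The growth estimate rests on `exists_lower_bound`: |L(k,l)| ≥ δ·`polySize`, the sum of all k^j
(l+1)^α with (j,α) in Λ₀. If this failed, the normalized monomials along a bad sequence would have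
limits, and the limiting relation would contradict (N), produce a positive root of an edge
polynomial or a positive integer root of the last one, or leave a single monomial with nonzero
coefficient.

With τ = σ₀ - 1 and ς = s₀ - 1 the solution is majorized by `solWeight` by induction on (k,l). A
linear term whose coefficient carries x^i exceeds the Newton polygon by at most (l-i+1)^{τi},
because d ≤ τp ≤ τi; this factor is absorbed by the Gevrey factor when l-i grows to l, and B^{-i}
makes the sum small. In the nonlinear part a product of n ≥ 2 jet components gains A^{-(n-1)} and,
from the factorials, k^{-ς(n-1)}; a factor x^μ gains k^{-τμ}. The definition of s₀ says exactly that
these powers of k pay for the derivatives up to k^m, and k^m ≤ `polySize`.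

The weight is built to survive multiplication. The `multichoose` factors are the coefficients of
(1-x)^{-a}, whose exponents add, and the powers k^{-γ} with γ ≥ 2 are closed under convolution up to
a constant. The argument is carried by `isFormalSolution_iff`, `exists_lower_bound`,
`norm_linear_le`, `norm_co_subst_R₂_le` and `exists_solWeight_bound`. If σ₀ = 1, the choice τ = ς =
0 gives convergence. -/

noncomputable section

namespace Maillet

/-! ### Coefficients of double power series -/

/-- The exponent of the monomial `t^k x^l`. -/
def expo (k l : ℕ) : Fin 2 →₀ ℕ := Finsupp.single 0 k + Finsupp.single 1 l

@[simp] lemma expo_apply_zero (k l : ℕ) : expo k l 0 = k := by simp [expo]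

@[simp] lemma expo_apply_one (k l : ℕ) : expo k l 1 = l := by simp [expo]

lemma expo_eta (d : Fin 2 →₀ ℕ) : expo (d 0) (d 1) = d := by
  ext i; fin_cases i <;> simp

lemma expo_add (k l k' l' : ℕ) : expo k l + expo k' l' = expo (k + k') (l + l') := by
  ext i; fin_cases i <;> simp

lemma expo_inj {k l k' l' : ℕ} : expo k l = expo k' l' ↔ k = k' ∧ l = l' := by
  refine ⟨fun h => ⟨?_, ?_⟩, by rintro ⟨rfl, rfl⟩; rfl⟩
  · simpa using DFunLike.congr_fun h 0
  · simpa using DFunLike.congr_fun h 1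

/-- Exponents in two variables are pairs of natural numbers. -/
def expoEquiv : ℕ × ℕ ≃ (Fin 2 →₀ ℕ) where
  toFun y := expo y.1 y.2
  invFun d := (d 0, d 1)
  left_inv y := by simp
  right_inv d := expo_eta d

/-- The coefficient of `t^k x^l`. -/
def co (f : FPS) (k l : ℕ) : ℂ := MvPowerSeries.coeff (expo k l) f

lemma co_ext {f g : FPS} (h : ∀ k l, co f k l = co g k l) : f = g := by
  ext d
  have := h (d 0) (d 1)
  rwa [co, co, expo_eta] at this

/-- The double power series with prescribed coefficients. -/
def ofCo (a : ℕ → ℕ → ℂ) : FPS := fun d => a (d 0) (d 1)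

@[simp] lemma co_ofCo (a : ℕ → ℕ → ℂ) (k l : ℕ) : co (ofCo a) k l = a k l := by
  change a (expo k l 0) (expo k l 1) = a k l
  simp

lemma co_sub (f g : FPS) (k l : ℕ) : co (f - g) k l = co f k l - co g k l := by simp [co]

lemma co_mul (f g : FPS) (k l : ℕ) :
    co (f * g) k l = ∑ y ∈ Finset.HasAntidiagonal.antidiagonal k, ∑ w ∈ Finset.HasAntidiagonal.antidiagonal l,
      co f y.1 w.1 * co g y.2 w.2 := by
  classical
  rw [co, MvPowerSeries.coeff_mul, ← Finset.sum_product']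
  symm
  refine Finset.sum_bij' (fun y _ => (expo y.1.1 y.2.1, expo y.1.2 y.2.2))
    (fun y _ => ((y.1 0, y.2 0), (y.1 1, y.2 1))) ?_ ?_ ?_ ?_ ?_
  · rintro ⟨⟨a, b⟩, ⟨a', b'⟩⟩ h
    simp only [Finset.mem_product, Finset.HasAntidiagonal.mem_antidiagonal] at h ⊢
    rw [expo_add, h.1, h.2]
  · rintro ⟨a, b⟩ h
    simp only [Finset.mem_product, Finset.HasAntidiagonal.mem_antidiagonal] at h ⊢
    constructor
    · simpa using DFunLike.congr_fun h 0
    · simpa using DFunLike.congr_fun h 1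
  · rintro ⟨⟨a, b⟩, ⟨a', b'⟩⟩ h
    simp
  · rintro ⟨a, b⟩ h
    simp [expo_eta]
  · rintro ⟨⟨a, b⟩, ⟨a', b'⟩⟩ h
    rfl

lemma co_X_zero (k l : ℕ) :
    co (MvPowerSeries.X 0) k l = if k = 1 ∧ l = 0 then 1 else 0 := by
  classical
  rw [co, MvPowerSeries.coeff_X]
  have : expo k l = Finsupp.single 0 1 ↔ k = 1 ∧ l = 0 := by
    rw [show (Finsupp.single 0 1 : Fin 2 →₀ ℕ) = expo 1 0 by simp [expo], expo_inj]
  simp [this]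

lemma co_X_one_pow_mul (μ : ℕ) (f : FPS) (k l : ℕ) :
    co (MvPowerSeries.X 1 ^ μ * f) k l = if μ ≤ l then co f k (l - μ) else 0 := by
  classical
  rw [co, MvPowerSeries.X_pow_eq, MvPowerSeries.coeff_monomial_mul]
  have h1 : Finsupp.single 1 μ ≤ expo k l ↔ μ ≤ l := by
    constructor
    · intro h; simpa using h 1
    · intro h i; fin_cases i <;> simp [h]
  have h2 : expo k l - Finsupp.single 1 μ = expo k (l - μ) := by
    ext i; fin_cases i <;> simp
  simp [h1, h2, co]

lemma X_zero_pow_dvd_iff (n : ℕ) (f : FPS) :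
    MvPowerSeries.X 0 ^ n ∣ f ↔ ∀ k l, k < n → co f k l = 0 := by
  rw [MvPowerSeries.X_pow_dvd_iff]
  constructor
  · intro h k l hk
    exact h _ (by simpa using hk)
  · intro h d hd
    have := h (d 0) (d 1) hd
    rwa [co, expo_eta] at this

lemma co_tDt (f : FPS) (k l : ℕ) : co (tDt f) k l = k * co f k l := by
  classical
  rw [co, tDt, MvPowerSeries.X_def, MvPowerSeries.coeff_monomial_mul]
  have h1 : Finsupp.single 0 1 ≤ expo k l ↔ 1 ≤ k := by
    constructor
    · intro h; simpa using h 0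
    · intro h i; fin_cases i <;> simp [h]
  rcases Nat.eq_zero_or_pos k with rfl | hk
  · simp [h1]
  · rw [if_pos (h1.2 hk), MvPowerSeries.coeff_pderiv, tsub_add_cancel_of_le (h1.2 hk), co]
    have : (((expo k l - Finsupp.single 0 1 : Fin 2 →₀ ℕ) 0 : ℕ) : ℂ) + 1 = k := by
      simp only [Finsupp.coe_tsub, Pi.sub_apply, expo_apply_zero, Finsupp.single_eq_same]
      exact_mod_cast Nat.sub_add_cancel hk
    rw [this]; ring

lemma co_Dx (f : FPS) (k l : ℕ) : co (Dx f) k l = (l + 1) * co f k (l + 1) := by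
  rw [co, Dx, MvPowerSeries.coeff_pderiv, co, mul_comm]
  congr 2
  · simp
  · congr 1
    ext i; fin_cases i <;> simp

lemma co_tDt_iterate (j : ℕ) (f : FPS) (k l : ℕ) :
    co (tDt^[j] f) k l = (k : ℂ) ^ j * co f k l := by
  induction j with
  | zero => simp
  | succ j ih => rw [Function.iterate_succ_apply', co_tDt, ih]; ring

lemma co_Dx_iterate (α : ℕ) (f : FPS) (k l : ℕ) :
    co (Dx^[α] f) k l = ((l + 1).ascFactorial α : ℂ) * co f k (l + α) := by
  induction α generalizing l with
  | zero => simp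
  | succ α ih =>
    rw [Function.iterate_succ_apply', co_Dx, ih, show l + 1 + α = l + (α + 1) by ring,
      ← Nat.succ_eq_add_one (l + 1), Nat.ascFactorial, ← Nat.succ_ascFactorial]
    push_cast
    ring

lemma co_jet {m : ℕ} (u : FPS) (q : Idx m) (k l : ℕ) :
    co (jet m u (vz q)) k l
      = (k : ℂ) ^ q.1.1 * (((l + 1).ascFactorial q.1.2 : ℂ) * co u k (l + q.1.2)) := by
  simp only [jet, co_tDt_iterate, co_Dx_iterate]

/-! ### Taylor coefficients of a holomorphic function -/

/-- The multinomial coefficient is one of the summands in the expansion of (1 + ⋯ + 1)^n. -/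
lemma multinomial_le_pow {ι : Type*} [Fintype ι] [DecidableEq ι] (d : ι → ℕ) :
    ((∑ v, d v)! : ℝ) / ∏ v, ((d v)! : ℝ) ≤ (Fintype.card ι : ℝ) ^ (∑ v, d v) := by
  have h1 : Nat.multinomial Finset.univ d ≤ (Fintype.card ι) ^ (∑ v, d v) := by
    have h2 := Finset.sum_pow_eq_sum_piAntidiag (Finset.univ : Finset ι) (fun _ => (1 : ℕ))
      (∑ v, d v)
    simp only [Finset.sum_const, smul_eq_mul, mul_one, one_pow, Finset.prod_const_one,
      Finset.card_univ, Nat.cast_id] at h2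
    rw [h2]
    exact Finset.single_le_sum (f := fun k => Nat.multinomial Finset.univ k)
      (fun _ _ => Nat.zero_le _) (by simp)
  have h3 := Nat.multinomial_spec Finset.univ d
  rw [div_le_iff₀ (by positivity)]
  rw [← h3]
  push_cast
  rw [mul_comm]
  gcongr
  exact_mod_cast h1

lemma length_toList_toMultiset {ι : Type*} [Fintype ι] (d : ι →₀ ℕ) :
    (Finsupp.toMultiset d).toList.length = ∑ v, d v := by
  rw [Multiset.length_toList, Finsupp.card_toMultiset, Finsupp.sum_fintype _ _ (by simp)]
  rfl

/-- The iterated derivative is a sum over n! permutations of the n-th term of the power series,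
whose norm is at most C a^n. Dividing by ∏ d_v! leaves a multinomial coefficient, which is again
geometric. -/
lemma taylorCoeff_bound {m : ℕ} {F : (Var m → ℂ) → ℂ} (hF : AnalyticAt ℂ F 0) :
    ∃ C a : ℝ, 0 < C ∧ 1 ≤ a ∧ ∀ d : Var m →₀ ℕ, ‖taylorCoeff F d‖ ≤ C * a ^ (∑ v, d v) := by
  obtain ⟨P, r, hP⟩ := hF
  obtain ⟨C, a, hC, ha, hb⟩ := P.le_mul_pow_of_radius_pos (hP.r_pos.trans_le hP.r_le)
  refine ⟨C, max 1 (a * Fintype.card (Var m)), hC, le_max_left _ _, fun d => ?_⟩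
  have key : ∀ (n : ℕ) (v : Fin n → (Var m → ℂ)), (∀ i, ‖v i‖ ≤ 1) →
      ‖iteratedFDeriv ℂ n F 0 v‖ ≤ n ! * (C * a ^ n) := by
    intro n v hv
    rw [hP.iteratedFDeriv_eq_sum_of_completeSpace]
    refine (norm_sum_le _ _).trans ?_
    calc ∑ s : Equiv.Perm (Fin n), ‖P n fun i => v (s i)‖
        ≤ ∑ _s : Equiv.Perm (Fin n), C * a ^ n := by
          refine Finset.sum_le_sum fun s _ => ?_
          refine ((P n).le_opNorm _).trans ?_
          refine (mul_le_of_le_one_right (norm_nonneg _) ?_).trans (hb n)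
          exact Finset.prod_le_one (fun _ _ => norm_nonneg _) fun i _ => hv _
      _ = n ! * (C * a ^ n) := by simp [Fintype.card_perm]
  have hprod : (0 : ℝ) < ∏ v, ((d v)! : ℝ) := by positivity
  have hn : ‖∏ v, ((d v)! : ℂ)‖ = ∏ v, ((d v)! : ℝ) := by
    rw [norm_prod]; simp
  rw [taylorCoeff, norm_div, hn, div_le_iff₀ hprod]
  refine (key _ _ fun i => ?_).trans ?_
  · rw [Pi.norm_single, norm_one]
  rw [length_toList_toMultiset]
  have hm := multinomial_le_pow (fun v => d v)
  rw [div_le_iff₀ hprod] at hm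
  calc ((∑ v, d v)! : ℝ) * (C * a ^ (∑ v, d v))
      ≤ ((Fintype.card (Var m) : ℝ) ^ (∑ v, d v) * ∏ v, ((d v)! : ℝ)) * (C * a ^ (∑ v, d v)) := by
        gcongr
    _ = C * (a * Fintype.card (Var m)) ^ (∑ v, d v) * ∏ v, ((d v)! : ℝ) := by
        rw [mul_pow]; ring
    _ ≤ _ := by
        gcongr
        exact le_max_right _ _

/-- Restriction to the x-axis gives a one-variable power series of the zero function, so all its
terms vanish; pure x-derivatives see only these terms. -/
lemma taylorCoeff_vx_eq_zero {m : ℕ} {F : (Var m → ℂ) → ℂ} (hF : AnalyticAt ℂ F 0)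
    (h0 : ∀ᶠ y : ℂ in 𝓝 0, F (Pi.single (vx m) y) = 0) (l : ℕ) :
    taylorCoeff F (Finsupp.single (vx m) l) = 0 := by
  obtain ⟨P, r, hP⟩ := hF
  let g : ℂ →L[ℂ] (Var m → ℂ) := ContinuousLinearMap.single ℂ (fun _ => ℂ) (vx m)
  have hg : HasFPowerSeriesAt (F ∘ g) (P.compContinuousLinearMap g) 0 :=
    HasFPowerSeriesAt.compContinuousLinearMap (u := g) (by rw [map_zero]; exact ⟨r, hP⟩)
  have h1 : HasFPowerSeriesAt (0 : ℂ → ℂ) (P.compContinuousLinearMap g) 0 :=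
    hg.congr (by filter_upwards [h0] with y hy using hy)
  have h2 := fun n => h1.apply_eq_zero n 1
  have key : ∀ (n : ℕ) (v : Fin n → (Var m → ℂ)), (∀ i, v i = Pi.single (vx m) 1) →
      iteratedFDeriv ℂ n F 0 v = 0 := by
    intro n v hv
    rw [hP.iteratedFDeriv_eq_sum_of_completeSpace]
    refine Finset.sum_eq_zero fun s _ => ?_
    have := h2 n
    rw [FormalMultilinearSeries.compContinuousLinearMap_apply] at this
    rw [← this]
    congr 1
    funext i
    rw [hv]
    rfl
  rw [taylorCoeff, key, zero_div]
  intro i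
  have hall : ∀ v ∈ (Finsupp.toMultiset (Finsupp.single (vx m) l)).toList, v = vx m := by
    intro v hv
    rw [Multiset.mem_toList, Finsupp.toMultiset_single, Multiset.nsmul_singleton] at hv
    exact Multiset.eq_of_mem_replicate hv
  rw [hall _ (List.get_mem _ i)]

lemma taylor_bound {m : ℕ} {F : (Var m → ℂ) → ℂ} {r : Var m → ℝ} (hr : ∀ v, 0 < r v)
    (hA1 : A1 F r) :
    ∃ C a : ℝ, 0 < C ∧ 1 ≤ a ∧
      ∀ d : Var m →₀ ℕ, ‖MvPowerSeries.coeff d (taylor F)‖ ≤ C * a ^ (∑ v, d v) :=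
  taylorCoeff_bound (hA1 0 fun v => by simpa using hr v)

lemma coeff_taylor_vx {m : ℕ} {F : (Var m → ℂ) → ℂ} {r : Var m → ℝ} (hr : ∀ v, 0 < r v)
    (hA1 : A1 F r) (hA2 : A2 F r) (l : ℕ) :
    MvPowerSeries.coeff (Finsupp.single (vx m) l) (taylor F) = 0 := by
  refine taylorCoeff_vx_eq_zero (hA1 0 fun v => by simpa using hr v) ?_ l
  filter_upwards [Metric.ball_mem_nhds (0 : ℂ) (hr (vx m))] with y hy
  refine hA2 _ (fun v => ?_) fun v hv => by simp [Pi.single_eq_of_ne hv]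
  by_cases h : v = vx m
  · subst h; simpa using hy
  · simpa [Pi.single_eq_of_ne h] using hr v

/-! ### The Newton polygon -/

section Newton

variable {m : ℕ} {F : (Var m → ℂ) → ℂ}

lemma c0_m_zero : c0 F (m, 0) = -1 := by simp [c0, c]

lemma c0_ne_zero_of_mem {q : ℕ × ℕ} (hq : q ∈ Λ₀ F) : c0 F q ≠ 0 := by
  classical
  rw [Λ₀, Finset.mem_insert, Finset.mem_filter] at hq
  rcases hq with rfl | hq
  · simp [c0_m_zero]
  · exact hq.2

lemma m_zero_mem : (m, 0) ∈ Λ₀ F := by simp [Λ₀]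

lemma mem_idxSet {q : ℕ × ℕ} : q ∈ idxSet m ↔ q.1 + q.2 ≤ m ∧ q.1 < m := by
  simp only [idxSet, Finset.mem_filter, Finset.mem_product, Finset.mem_range]
  omega

lemma m_zero_notMem : (m, 0) ∉ idxSet m := by simp [mem_idxSet]

lemma fst_lt_of_mem {q : ℕ × ℕ} (hq : q ∈ Λ₀ F) (hne : q ≠ (m, 0)) : q.1 < m := by
  classical
  rw [Λ₀, Finset.mem_insert, Finset.mem_filter, mem_idxSet] at hq
  rcases hq with rfl | hq
  · exact absurd rfl hne
  · exact hq.1.2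

lemma pt_mem_newtonPolygon {q : ℕ × ℕ} (hq : q ∈ Λ₀ F) {y : ℝ × ℝ} (h1 : y.1 ≤ q.1)
    (h2 : y.2 ≤ q.2) : y ∈ newtonPolygon F := by
  refine subset_convexHull ℝ _ ?_
  simp only [Set.mem_iUnion]
  exact ⟨q, hq, h1, h2⟩

lemma convex_newtonPolygon : Convex ℝ (newtonPolygon F) := convex_convexHull ℝ _

lemma linear_le_of_mem_newtonPolygon {a b' M : ℝ} (ha : 0 ≤ a) (hb : 0 ≤ b')
    (h : ∀ q ∈ Λ₀ F, a * q.1 + b' * q.2 ≤ M) {y : ℝ × ℝ} (hy : y ∈ newtonPolygon F) :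
    a * y.1 + b' * y.2 ≤ M := by
  have hc : Convex ℝ {y : ℝ × ℝ | a * y.1 + b' * y.2 ≤ M} := by
    intro y hy z hz s t hs ht hst
    simp only [Set.mem_ofPred_eq, Prod.fst_add, Prod.smul_fst, smul_eq_mul, Prod.snd_add,
      Prod.smul_snd] at hy hz ⊢
    calc a * (s * y.1 + t * z.1) + b' * (s * y.2 + t * z.2)
        = s * (a * y.1 + b' * y.2) + t * (a * z.1 + b' * z.2) := by ring
      _ ≤ s * M + t * M := by gcongr
      _ = M := by rw [← add_mul, hst, one_mul]
  refine convexHull_min ?_ hc hy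
  intro z hz
  simp only [Set.mem_iUnion] at hz
  obtain ⟨q, hq, h1, h2⟩ := hz
  refine le_trans ?_ (h q hq)
  gcongr
  · exact h1
  · exact h2

/-- A point of `Λ₀` is a vertex if it maximizes the functional `s j + α` and, among the
maximizers, the functional `e j`. -/
lemma isVertex_of_maximal {s e : ℝ} (hs : 0 ≤ s) (he : e ≠ 0) (hse : 0 < s ∨ 0 < e)
    {v : ℕ × ℕ} (hv : v ∈ Λ₀ F)
    (hmax : ∀ q ∈ Λ₀ F, s * q.1 + q.2 < s * v.1 + v.2 ∨
      (s * q.1 + q.2 = s * v.1 + v.2 ∧ e * q.1 ≤ e * v.1)) :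
    IsVertex F v := by
  -- Since Λ₀ is finite, a small tilt of the functional in the direction e keeps its maximum at v.
  -- The two functionals are simultaneously maximal at v only, which makes v extreme.
  obtain ⟨ε, hε0, hεs, hε⟩ : ∃ ε : ℝ, 0 < ε ∧ 0 ≤ s + ε * e ∧
      ∀ q ∈ Λ₀ F, (s + ε * e) * q.1 + q.2 ≤ (s + ε * e) * v.1 + v.2 := by
    have h1 : ∀ᶠ ε : ℝ in 𝓝[>] 0, 0 ≤ s + ε * e := by
      rcases hse with h | h
      · have : Filter.Tendsto (fun ε : ℝ => s + ε * e) (𝓝 0) (𝓝 (s + 0 * e)) :=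
          Continuous.tendsto (by fun_prop) 0
        have := this.eventually (lt_mem_nhds (show (0 : ℝ) < s + 0 * e by simpa using h))
        exact (this.filter_mono nhdsWithin_le_nhds).mono fun _ h => h.le
      · filter_upwards [self_mem_nhdsWithin] with ε hε
        have hε : (0 : ℝ) < ε := hε
        positivity
    have h2 : ∀ᶠ ε : ℝ in 𝓝[>] 0,
        ∀ q ∈ Λ₀ F, (s + ε * e) * q.1 + q.2 ≤ (s + ε * e) * v.1 + v.2 := by
      rw [Filter.eventually_all_finset]
      intro q hq
      rcases hmax q hq with h | ⟨h, h'⟩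
      · have : Filter.Tendsto (fun ε : ℝ => (s + ε * e) * v.1 + v.2 - ((s + ε * e) * q.1 + q.2))
            (𝓝 0) (𝓝 ((s + 0 * e) * v.1 + v.2 - ((s + 0 * e) * q.1 + q.2))) :=
          Continuous.tendsto (by fun_prop) 0
        have := this.eventually (lt_mem_nhds
          (show (0 : ℝ) < (s + 0 * e) * v.1 + v.2 - ((s + 0 * e) * q.1 + q.2) by
            rw [zero_mul, add_zero]; linarith))
        exact (this.filter_mono nhdsWithin_le_nhds).mono fun _ h => by linarith
      · filter_upwards [self_mem_nhdsWithin] with ε hε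
        have hε : (0 : ℝ) < ε := hε
        nlinarith [mul_le_mul_of_nonneg_left h' hε.le]
    obtain ⟨ε, h1, h2, h3⟩ := (h1.and (h2.and self_mem_nhdsWithin)).exists
    exact ⟨ε, h3, h1, h2⟩
  have hle1 : ∀ y ∈ newtonPolygon F, s * y.1 + 1 * y.2 ≤ s * v.1 + v.2 := fun y hy =>
    linear_le_of_mem_newtonPolygon hs zero_le_one (fun q hq => by
      rcases hmax q hq with h | ⟨h, -⟩ <;> linarith) hy
  have hle2 : ∀ y ∈ newtonPolygon F, (s + ε * e) * y.1 + 1 * y.2 ≤ (s + ε * e) * v.1 + v.2 :=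
    fun y hy => linear_le_of_mem_newtonPolygon hεs zero_le_one
      (fun q hq => by linarith [hε q hq]) hy
  have heq : ∀ y ∈ newtonPolygon F, s * y.1 + 1 * y.2 = s * v.1 + v.2 →
      (s + ε * e) * y.1 + 1 * y.2 = (s + ε * e) * v.1 + v.2 → y = pt v := by
    intro y _ h1 h2
    have h3 : ε * e * (y.1 - v.1) = 0 := by linarith
    have h4 : y.1 = v.1 := by
      rcases mul_eq_zero.1 h3 with h | h
      · exact absurd h (mul_ne_zero hε0.ne' he)
      · linarith
    refine Prod.ext h4 ?_
    rw [h4] at h1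
    simp only [pt]
    linarith
  rw [IsVertex, mem_extremePoints]
  refine ⟨pt_mem_newtonPolygon hv le_rfl le_rfl, ?_⟩
  rintro y hy z hz ⟨a, a', ha, ha', haa, hyz⟩
  have e1 : a * y.1 + a' * z.1 = v.1 := by simpa [pt] using congrArg Prod.fst hyz
  have e2 : a * y.2 + a' * z.2 = v.2 := by simpa [pt] using congrArg Prod.snd hyz
  have ha1 : a' = 1 - a := by linarith
  have key : ∀ t : ℝ, t * y.1 + 1 * y.2 ≤ t * v.1 + v.2 → t * z.1 + 1 * z.2 ≤ t * v.1 + v.2 →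
      t * y.1 + 1 * y.2 = t * v.1 + v.2 ∧ t * z.1 + 1 * z.2 = t * v.1 + v.2 := by
    intro t h1 h2
    have h3 : a * (t * v.1 + v.2 - (t * y.1 + 1 * y.2))
        + a' * (t * v.1 + v.2 - (t * z.1 + 1 * z.2)) = 0 := by
      rw [← e1, ← e2, ha1]; ring
    have h4 := mul_nonneg ha.le (sub_nonneg.2 h1)
    have h5 := mul_nonneg ha'.le (sub_nonneg.2 h2)
    have h6 : a * (t * v.1 + v.2 - (t * y.1 + 1 * y.2)) = 0 := by linarith
    have h7 : a' * (t * v.1 + v.2 - (t * z.1 + 1 * z.2)) = 0 := by linarith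
    exact ⟨by linarith [(mul_eq_zero.1 h6).resolve_left ha.ne'],
      by linarith [(mul_eq_zero.1 h7).resolve_left ha'.ne']⟩
  have k1 := key s (hle1 y hy) (hle1 z hz)
  have k2 := key (s + ε * e) (hle2 y hy) (hle2 z hz)
  exact ⟨heq y hy k1.1 k2.1, heq z hz k1.2 k2.2⟩

lemma not_isVertex_of_between {v : ℕ × ℕ} {y z : ℝ × ℝ} (hy : y ∈ newtonPolygon F)
    (hz : z ∈ newtonPolygon F) (hv : pt v ∈ openSegment ℝ y z) (hne : y ≠ pt v) :
    ¬ IsVertex F v := fun h => by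
  rw [IsVertex, mem_extremePoints] at h
  exact hne (h.2 y hy z hz hv).1

/-- The last vertex of the Newton polygon. -/
lemma exists_isLastVertex (F : (Var m → ℂ) → ℂ) :
    ∃ v ∈ Λ₀ F, IsLastVertex F v ∧ ∀ q ∈ Λ₀ F, q.2 < v.2 ∨ (q.2 = v.2 ∧ q.1 ≤ v.1) := by
  -- The last vertex is the rightmost point of Λ₀ at maximal height.
  obtain ⟨v, hv, hmax⟩ := Finset.exists_max_image (Λ₀ F) (fun q => toLex (q.2, q.1))
    ⟨_, m_zero_mem⟩
  have hmax' : ∀ q ∈ Λ₀ F, q.2 < v.2 ∨ (q.2 = v.2 ∧ q.1 ≤ v.1) := fun q hq => by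
    simpa [Prod.Lex.toLex_le_toLex] using hmax q hq
  refine ⟨v, hv, ⟨isVertex_of_maximal (s := 0) (e := 1) le_rfl one_ne_zero (Or.inr one_pos) hv
    fun q hq => ?_, fun y hy => ?_⟩, hmax'⟩
  · rcases hmax' q hq with h | ⟨h, h'⟩
    · left; simpa using h
    · right
      refine ⟨by simp [h], by simpa using h'⟩
  · by_contra hlt
    push Not at hlt
    have hyN : pt y ∈ newtonPolygon F := (mem_extremePoints.1 hy).1
    have hy2 : (y.2 : ℝ) ≤ v.2 := by
      have := linear_le_of_mem_newtonPolygon (F := F) (a := 0) (b' := 1) (M := v.2) le_rfl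
        zero_le_one (fun q hq => by
          rcases hmax' q hq with h | ⟨h, -⟩
          · have : (q.2 : ℝ) < v.2 := by exact_mod_cast h
            linarith
          · simp [h]) hyN
      simpa [pt] using this
    have hy1 : (y.1 : ℝ) < v.1 := by exact_mod_cast hlt
    -- A vertex left of v would be the midpoint of a horizontal segment inside the quadrant below v.
    refine not_isVertex_of_between (y := ((v.1 : ℝ), (y.2 : ℝ)))
      (z := ((y.1 : ℝ) - (v.1 - y.1), (y.2 : ℝ)))
      (pt_mem_newtonPolygon hv le_rfl hy2) (pt_mem_newtonPolygon hv (by simp; linarith) hy2)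
      ⟨1 / 2, 1 / 2, by norm_num, by norm_num, by norm_num, ?_⟩ ?_ hy
    · ext <;> simp [pt] <;> ring
    · intro h
      have := congrArg Prod.fst h
      simp only [pt] at this
      linarith

/-- A face of the Newton polygon with negative finite slope that contains several points of `Λ₀`
is a bounded edge. -/
lemma exists_isEdge {s M : ℝ} (hs : 0 < s) (hle : ∀ q ∈ Λ₀ F, s * q.1 + q.2 ≤ M)
    {q₀ q₁ : ℕ × ℕ} (hq₀ : q₀ ∈ Λ₀ F) (hq₁ : q₁ ∈ Λ₀ F) (h₀ : s * q₀.1 + q₀.2 = M)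
    (h₁ : s * q₁.1 + q₁.2 = M) (hlt : q₁.1 < q₀.1) :
    ∃ v w : ℕ × ℕ, IsEdge F v w ∧ w ∈ Λ₀ F ∧ s * w.1 + w.2 = M ∧
      (∀ q ∈ Λ₀ F, pt q ∈ segment ℝ (pt v) (pt w) ↔ s * q.1 + q.2 = M) ∧
      ∀ q ∈ Λ₀ F, s * q.1 + q.2 = M → w.1 ≤ q.1 := by
  classical
  set S := (Λ₀ F).filter fun q => s * q.1 + q.2 = M with hS
  have hmemS : ∀ q, q ∈ S ↔ q ∈ Λ₀ F ∧ s * q.1 + q.2 = M := fun q => by simp [hS]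
  have hSne : S.Nonempty := ⟨q₀, (hmemS _).2 ⟨hq₀, h₀⟩⟩
  obtain ⟨v, hvS, hv⟩ := Finset.exists_max_image S (fun q => q.1) hSne
  obtain ⟨w, hwS, hw⟩ := Finset.exists_min_image S (fun q => q.1) hSne
  have hvM := (hmemS v).1 hvS
  have hwM := (hmemS w).1 hwS
  have hwv : w.1 < v.1 :=
    (hw q₁ ((hmemS _).2 ⟨hq₁, h₁⟩)).trans_lt (hlt.trans_le (hv q₀ ((hmemS _).2 ⟨hq₀, h₀⟩)))
  have hwvR : (w.1 : ℝ) < v.1 := by exact_mod_cast hwv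
  have hvV : IsVertex F v := by
    refine isVertex_of_maximal (s := s) (e := 1) hs.le one_ne_zero (Or.inl hs) hvM.1 fun q hq => ?_
    rcases (hle q hq).lt_or_eq with h | h
    · left; rw [hvM.2]; exact h
    · right
      refine ⟨by rw [h, hvM.2], ?_⟩
      have : (q.1 : ℝ) ≤ v.1 := by exact_mod_cast hv q ((hmemS q).2 ⟨hq, h⟩)
      linarith
  have hwV : IsVertex F w := by
    refine isVertex_of_maximal (s := s) (e := -1) hs.le (by norm_num) (Or.inl hs) hwM.1
      fun q hq => ?_
    rcases (hle q hq).lt_or_eq with h | h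
    · left; rw [hwM.2]; exact h
    · right
      refine ⟨by rw [h, hwM.2], ?_⟩
      have : (w.1 : ℝ) ≤ q.1 := by exact_mod_cast hw q ((hmemS q).2 ⟨hq, h⟩)
      linarith
  have hseg : ∀ a : ℝ, (w.1 : ℝ) ≤ a → a ≤ v.1 → (a, M - s * a) ∈ segment ℝ (pt v) (pt w) := by
    intro a h1 h2
    have hpos : (0 : ℝ) < v.1 - w.1 := by linarith
    refine ⟨(a - w.1) / (v.1 - w.1), (v.1 - a) / (v.1 - w.1), div_nonneg (by linarith) hpos.le,
      div_nonneg (by linarith) hpos.le, by field_simp; ring, ?_⟩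
    have e1 : (v.2 : ℝ) = M - s * v.1 := by linarith [hvM.2]
    have e2 : (w.2 : ℝ) = M - s * w.1 := by linarith [hwM.2]
    ext
    · simp only [pt, Prod.fst_add, Prod.smul_fst, smul_eq_mul]
      field_simp
      ring
    · simp only [pt, Prod.snd_add, Prod.smul_snd, smul_eq_mul, e1, e2]
      field_simp
      ring
  have hsegN : segment ℝ (pt v) (pt w) ⊆ newtonPolygon F :=
    convex_newtonPolygon.segment_subset (pt_mem_newtonPolygon hvM.1 le_rfl le_rfl)
      (pt_mem_newtonPolygon hwM.1 le_rfl le_rfl)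
  refine ⟨v, w, ⟨hvV, hwV, hwv, ?_⟩, hwM.1, hwM.2, ?_, fun q hq h => hw q ((hmemS q).2 ⟨hq, h⟩)⟩
  · rintro y hy ⟨hy1, hy2⟩
    have hy1R : (w.1 : ℝ) < y.1 := by exact_mod_cast hy1
    have hy2R : (y.1 : ℝ) < v.1 := by exact_mod_cast hy2
    have hyN : pt y ∈ newtonPolygon F := (mem_extremePoints.1 hy).1
    have hyM : s * y.1 + 1 * y.2 ≤ M :=
      linear_le_of_mem_newtonPolygon hs.le zero_le_one (fun q hq => by linarith [hle q hq]) hyN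
    -- A lattice point between v and w lies strictly below the face, hence inside a vertical segment
    -- of the polygon, or on the face, hence inside the segment from v to w. Neither is extreme.
    rcases (show (y.2 : ℝ) ≤ M - s * y.1 by linarith).lt_or_eq with h | h
    · have hz := hsegN (hseg y.1 hy1R.le hy2R.le)
      obtain ⟨z, hzv, hzy⟩ : ∃ z : ℝ, z ≤ v.2 ∧ z < y.2 :=
        ⟨min v.2 (y.2 - 1), min_le_left _ _, (min_le_right _ _).trans_lt (by linarith)⟩
      have hbelow : ((y.1 : ℝ), z) ∈ newtonPolygon F := pt_mem_newtonPolygon hvM.1 hy2R.le hzv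
      have hpos : 0 < M - s * y.1 - z := by linarith
      refine not_isVertex_of_between hz hbelow
        ⟨(y.2 - z) / (M - s * y.1 - z), (M - s * y.1 - y.2) / (M - s * y.1 - z),
          div_pos (by linarith) hpos, div_pos (by linarith) hpos, by field_simp; ring, ?_⟩ ?_ hy
      · ext
        · simp only [pt, Prod.fst_add, Prod.smul_fst, smul_eq_mul]
          field_simp
          ring
        · simp only [pt, Prod.snd_add, Prod.smul_snd, smul_eq_mul]
          field_simp
          ring
      · intro h'
        have := congrArg Prod.snd h'
        simp only [pt] at this
        linarith
    · have hz1 := hsegN (left_mem_segment ℝ (pt v) (pt w))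
      have hz2 := hsegN (right_mem_segment ℝ (pt v) (pt w))
      have hyseg := hseg y.1 hy1R.le hy2R.le
      rw [← h] at hyseg
      have hne1 : pt v ≠ pt y := fun h' => by
        have := congrArg Prod.fst h'
        simp only [pt] at this
        linarith
      have hne2 : pt w ≠ pt y := fun h' => by
        have := congrArg Prod.fst h'
        simp only [pt] at this
        linarith
      exact not_isVertex_of_between hz1 hz2
        (mem_openSegment_of_ne_left_right hne1 hne2 hyseg) hne1 hy
  · intro q hq
    constructor
    · rintro ⟨a, a', -, -, haa, h⟩
      have e1 : a * v.1 + a' * w.1 = q.1 := by simpa [pt] using congrArg Prod.fst h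
      have e2 : a * v.2 + a' * w.2 = q.2 := by simpa [pt] using congrArg Prod.snd h
      rw [← e1, ← e2]
      calc s * (a * v.1 + a' * w.1) + (a * v.2 + a' * w.2)
          = a * (s * v.1 + v.2) + a' * (s * w.1 + w.2) := by ring
        _ = M := by rw [hvM.2, hwM.2, ← add_mul, haa, one_mul]
    · intro h
      have := hseg q.1 (by exact_mod_cast hw q ((hmemS q).2 ⟨hq, h⟩))
        (by exact_mod_cast hv q ((hmemS q).2 ⟨hq, h⟩))
      rwa [show M - s * q.1 = q.2 by linarith] at this

end Newton

/-! ### Lower bound for L(k,l) by the monomials of the Newton polygon. -/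

section LowerBound

variable {m : ℕ} {F : (Var m → ℂ) → ℂ}

/-- The sum of the monomials `k^j (l + 1)^α` with `(j, α) ∈ Λ₀`. -/
def polySize (F : (Var m → ℂ) → ℂ) (k l : ℕ) : ℝ :=
  ∑ q ∈ Λ₀ F, (k : ℝ) ^ q.1 * ((l : ℝ) + 1) ^ q.2

lemma term_le_polySize (k l : ℕ) {q : ℕ × ℕ} (hq : q ∈ Λ₀ F) :
    (k : ℝ) ^ q.1 * ((l : ℝ) + 1) ^ q.2 ≤ polySize F k l :=
  Finset.single_le_sum (f := fun q : ℕ × ℕ => (k : ℝ) ^ q.1 * ((l : ℝ) + 1) ^ q.2)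
    (fun _ _ => by positivity) hq

lemma pow_le_polySize (k l : ℕ) : (k : ℝ) ^ m ≤ polySize F k l := by
  simpa using term_le_polySize (F := F) k l m_zero_mem

lemma polySize_pos {k : ℕ} (hk : 1 ≤ k) (l : ℕ) : 0 < polySize F k l :=
  lt_of_lt_of_le (by positivity) (pow_le_polySize (F := F) k l)

lemma polySize_mono (k : ℕ) {l l' : ℕ} (h : l ≤ l') : polySize F k l ≤ polySize F k l' := by
  refine Finset.sum_le_sum fun q _ => ?_
  gcongr

/-- The logarithm of the left side is linear in y with nonnegative coefficients, so a bound at the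
points of Λ₀ extends to the polygon. -/
lemma rpow_le_polySize {k : ℕ} (hk : 1 ≤ k) (l : ℕ) {y : ℝ × ℝ} (hy : y ∈ newtonPolygon F) :
    (k : ℝ) ^ y.1 * ((l : ℝ) + 1) ^ y.2 ≤ polySize F k l := by
  have hk' : (0 : ℝ) < k := by exact_mod_cast hk
  have hl' : (0 : ℝ) < (l : ℝ) + 1 := by positivity
  have h := linear_le_of_mem_newtonPolygon (F := F) (a := Real.log k) (b' := Real.log ((l : ℝ) + 1))
    (M := Real.log (polySize F k l)) (Real.log_nonneg (by exact_mod_cast hk))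
    (Real.log_nonneg (by simp)) (fun q hq => by
      rw [mul_comm, mul_comm (Real.log ((l : ℝ) + 1)), ← Real.log_pow, ← Real.log_pow,
        ← Real.log_mul (by positivity) (by positivity)]
      exact Real.log_le_log (by positivity) (term_le_polySize k l hq)) hy
  rw [Real.rpow_def_of_pos hk', Real.rpow_def_of_pos hl', ← Real.exp_add]
  exact (Real.le_log_iff_exp_le (polySize_pos hk l)).1 h

/-- A monomial exceeds the Newton polygon by at most the vertical distance. -/
lemma term_le_polySize_mul_rpow {k : ℕ} (hk : 1 ≤ k) (l : ℕ) {q : ℕ × ℕ} (hq : q.1 ≤ m) :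
    (k : ℝ) ^ q.1 * ((l : ℝ) + 1) ^ q.2 ≤ polySize F k l * ((l : ℝ) + 1) ^ d F q := by
  have hl' : (0 : ℝ) < (l : ℝ) + 1 := by positivity
  set Y := {y : ℝ | ((q.1 : ℝ), (q.2 : ℝ) - y) ∈ newtonPolygon F} with hY
  have hYne : Y.Nonempty := ⟨q.2, pt_mem_newtonPolygon m_zero_mem (by simpa using hq) (by simp)⟩
  have hle : ∀ y ∈ Y, (k : ℝ) ^ q.1 * ((l : ℝ) + 1) ^ q.2 ≤ polySize F k l * ((l : ℝ) + 1) ^ y := by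
    intro y hy
    have h := rpow_le_polySize hk l hy
    simp only at h
    rw [Real.rpow_natCast, Real.rpow_sub hl', Real.rpow_natCast, ← mul_div_assoc,
      div_le_iff₀ (by positivity)] at h
    exact h
  -- The estimate is a closed condition on the exponent, so it passes to the infimum without knowing
  -- that the infimum is attained.
  have hcl : IsClosed {y : ℝ | (k : ℝ) ^ q.1 * ((l : ℝ) + 1) ^ q.2
      ≤ polySize F k l * ((l : ℝ) + 1) ^ y} := by
    refine isClosed_le continuous_const (continuous_const.mul ?_)
    exact continuous_const.rpow continuous_id fun _ => Or.inl hl'.ne'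
  have hbdd : BddBelow Y := by
    obtain ⟨v, hv, -, hmax⟩ := exists_isLastVertex F
    refine ⟨(q.2 : ℝ) - v.2, fun y hy => ?_⟩
    have := linear_le_of_mem_newtonPolygon (F := F) (a := 0) (b' := 1) (M := v.2) le_rfl
        zero_le_one (fun q hq => by
          rcases hmax q hq with h | ⟨h, -⟩
          · have : (q.2 : ℝ) < v.2 := by exact_mod_cast h
            linarith
          · simp [h]) hy
    simp only at this
    linarith
  exact closure_minimal (fun y hy => hle y hy) hcl (csInf_mem_closure hYne hbdd)

lemma prod_range_sub_eq_descFactorial (l α : ℕ) :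
    ∏ i ∈ Finset.range α, ((l : ℂ) - (i : ℂ)) = (l.descFactorial α : ℂ) := by
  induction α with
  | zero => simp
  | succ α ih =>
    rw [Finset.prod_range_succ, ih, Nat.descFactorial_succ]
    rcases le_or_gt α l with h | h
    · push_cast [Nat.cast_sub h]; ring
    · simp [Nat.descFactorial_of_lt h]

lemma L_eq (k l : ℕ) :
    L F k l = -∑ q ∈ Λ₀ F, c0 F q * ((k : ℂ) ^ q.1 * (l.descFactorial q.2 : ℂ)) := by
  classical
  rw [L, Λ₀, Finset.sum_insert (by simp [m_zero_notMem]), c0_m_zero, Finset.sum_filter]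
  simp only [prod_range_sub_eq_descFactorial]
  rw [Finset.sum_congr rfl (g := fun q => if c0 F q ≠ 0 then
    c0 F q * ((k : ℂ) ^ q.1 * (l.descFactorial q.2 : ℂ)) else 0)]
  · simp; ring
  · intro q _
    split_ifs with h
    · ring
    · simp [not_not.1 h]

lemma tendsto_descFactorial_div (α : ℕ) :
    Filter.Tendsto (fun l : ℕ => (l.descFactorial α : ℝ) / ((l : ℝ) + 1) ^ α) Filter.atTop
      (𝓝 1) := by
  induction α with
  | zero => simp
  | succ α ih =>
    have h1 : Filter.Tendsto (fun l : ℕ => 1 - ((α : ℝ) + 1) / ((l : ℝ) + 1)) Filter.atTop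
        (𝓝 (1 - 0)) := by
      refine tendsto_const_nhds.sub (Filter.Tendsto.div_atTop tendsto_const_nhds ?_)
      exact Filter.tendsto_atTop_add_const_right _ _ tendsto_natCast_atTop_atTop
    have h2 := h1.mul ih
    rw [sub_zero, one_mul] at h2
    refine h2.congr' ?_
    filter_upwards [Filter.eventually_ge_atTop α] with l hl
    rw [Nat.descFactorial_succ]
    push_cast [Nat.cast_sub hl]
    field_simp
    ring

/-- A sequence bounded on a set of the ultrafilter takes finitely many values there, and the
ultrafilter selects one of them. -/
lemma ultrafilter_eq_const_or_tendsto {ι : Type*} (U : Ultrafilter ι) (κ : ι → ℕ) :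
    (∃ k, ∀ᶠ n in (U : Filter ι), κ n = k) ∨ Filter.Tendsto κ U Filter.atTop := by
  by_cases h : Filter.Tendsto κ U Filter.atTop
  · exact Or.inr h
  left
  rw [Filter.tendsto_atTop] at h
  push Not at h
  obtain ⟨N, hN⟩ := h
  have h1 : (⋃ i ∈ (Finset.range N : Set ℕ), {n | κ n = i}) ∈ U := by
    have hN' : ∀ᶠ n in (U : Filter ι), κ n < N := by simpa using hN
    filter_upwards [hN'] with n hn
    simpa using hn
  rw [Ultrafilter.finite_biUnion_mem_iff (Finset.finite_toSet _)] at h1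
  obtain ⟨i, -, hi⟩ := h1
  exact ⟨i, hi⟩

lemma ultrafilter_tendsto_of_bounded {ι : Type*} (U : Ultrafilter ι) {f : ι → ℝ}
    (hf : ∀ n, f n ∈ Set.Icc (0 : ℝ) 1) :
    ∃ x ∈ Set.Icc (0 : ℝ) 1, Filter.Tendsto f U (𝓝 x) := by
  obtain ⟨x, hx, h⟩ := (isCompact_Icc (a := (0 : ℝ)) (b := 1)).ultrafilter_le_nhds' (U.map f)
    (Filter.mem_map.2 (Filter.univ_mem' hf))
  exact ⟨x, hx, h⟩

/-- The limits `r` of the normalized monomials along an ultrafilter on which both arguments tend to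
infinity are supported on a single point or yield a root of an edge polynomial. -/
lemma sum_limits_ne_zero_of_tendsto_tendsto {ι : Type*} {U : Ultrafilter ι} {κ lam : ι → ℕ}
    (hκ : ∀ n, 1 ≤ κ n) (hκ' : Filter.Tendsto κ U Filter.atTop)
    (hlam : Filter.Tendsto lam U Filter.atTop) {r : ℕ × ℕ → ℝ} (hr0 : ∀ q ∈ Λ₀ F, 0 ≤ r q)
    (hr : ∀ q ∈ Λ₀ F, Filter.Tendsto (fun n => (κ n : ℝ) ^ q.1 * ((lam n : ℝ) + 1) ^ q.2 /
      polySize F (κ n) (lam n)) U (𝓝 (r q)))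
    (hr1 : ∑ q ∈ Λ₀ F, r q = 1) (hGP : GenPoincare F) :
    ∑ q ∈ Λ₀ F, c0 F q * (r q : ℂ) ≠ 0 := by
  classical
  intro hsum
  -- In logarithmic coordinates quotients of monomials become exponentials of linear forms in x and
  -- y, whose behaviour along the ultrafilter determines the surviving face.
  set x : ι → ℝ := fun n => Real.log (κ n) with hx
  set y : ι → ℝ := fun n => Real.log ((lam n : ℝ) + 1) with hy
  have hxT : Filter.Tendsto x U Filter.atTop :=
    Real.tendsto_log_atTop.comp (tendsto_natCast_atTop_atTop.comp hκ')
  have hyT : Filter.Tendsto y U Filter.atTop :=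
    Real.tendsto_log_atTop.comp (Filter.tendsto_atTop_add_const_right _ _
      (tendsto_natCast_atTop_atTop.comp hlam))
  have hexp : ∀ q ∈ Λ₀ F, ∀ q' ∈ Λ₀ F, 0 < r q' → Filter.Tendsto
      (fun n => Real.exp (((q.1 : ℝ) - q'.1) * x n + ((q.2 : ℝ) - q'.2) * y n)) U
      (𝓝 (r q / r q')) := by
    intro q hq q' hq' hpos
    refine ((hr q hq).div (hr q' hq') hpos.ne').congr fun n => ?_
    have hκn : (0 : ℝ) < κ n := by exact_mod_cast hκ n
    have hln : (0 : ℝ) < (lam n : ℝ) + 1 := by positivity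
    have hφ := (polySize_pos (F := F) (hκ n) (lam n)).ne'
    have e1 : ∀ i : ℕ, (κ n : ℝ) ^ i = Real.exp (i * x n) := fun i => by
      rw [Real.exp_nat_mul, hx, Real.exp_log hκn]
    have e2 : ∀ i : ℕ, ((lam n : ℝ) + 1) ^ i = Real.exp (i * y n) := fun i => by
      rw [Real.exp_nat_mul, hy, Real.exp_log hln]
    rw [Pi.div_apply, div_div_div_cancel_right₀ hφ, e1, e1, e2, e2, ← Real.exp_add, ← Real.exp_add,
      ← Real.exp_sub]
    congr 1
    ring
  obtain ⟨q₀, hq₀, hr₀⟩ : ∃ q ∈ Λ₀ F, 0 < r q := by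
    by_contra hcon
    push Not at hcon
    have := Finset.sum_nonpos hcon
    linarith
  by_cases huniq : ∀ q ∈ Λ₀ F, 0 < r q → q = q₀
  · rw [Finset.sum_eq_single_of_mem q₀ hq₀] at hsum
    · rcases mul_eq_zero.1 hsum with h | h
      · exact c0_ne_zero_of_mem hq₀ h
      · exact hr₀.ne' (by exact_mod_cast h)
    · intro q hq hne
      have : r q = 0 := le_antisymm (not_lt.1 fun h => hne (huniq q hq h)) (hr0 q hq)
      simp [this]
  push Not at huniq
  obtain ⟨q₁, hq₁, hr₁, hne⟩ := huniq
  have hlog : ∀ q ∈ Λ₀ F, 0 < r q → ∀ q' ∈ Λ₀ F, 0 < r q' → Filter.Tendsto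
      (fun n => ((q.1 : ℝ) - q'.1) * x n + ((q.2 : ℝ) - q'.2) * y n) U
      (𝓝 (Real.log (r q / r q'))) := by
    intro q hq h q' hq' h'
    refine ((hexp q hq q' hq' h').log (div_pos h h').ne').congr fun n => ?_
    rw [Real.log_exp]
  -- Two surviving monomials with the same power of k would have a quotient equal to a nonzero power
  -- of l + 1, which cannot tend to a positive limit.
  have hfst : q₁.1 ≠ q₀.1 := by
    intro h
    have h1 := hlog q₁ hq₁ hr₁ q₀ hq₀ hr₀
    rw [h] at h1
    simp only [sub_self, zero_mul, zero_add] at h1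
    have h2 : (q₁.2 : ℝ) - q₀.2 ≠ 0 := by
      rw [sub_ne_zero]
      intro h'
      exact hne (Prod.ext h (by exact_mod_cast h'))
    have h3 := h1.const_mul (((q₁.2 : ℝ) - q₀.2)⁻¹)
    simp only [← mul_assoc, inv_mul_cancel₀ h2, one_mul] at h3
    exact not_tendsto_nhds_of_tendsto_atTop hyT _ h3
  set s : ℝ := ((q₁.2 : ℝ) - q₀.2) / ((q₀.1 : ℝ) - q₁.1) with hs
  have hden : (q₀.1 : ℝ) - q₁.1 ≠ 0 := by
    rw [sub_ne_zero]; exact fun h => hfst (by exact_mod_cast h.symm)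
  obtain ⟨ζ, hζ⟩ : ∃ ζ, Filter.Tendsto (fun n => x n - s * y n) U (𝓝 ζ) := by
    refine ⟨_, ((hlog q₀ hq₀ hr₀ q₁ hq₁ hr₁).const_mul (((q₀.1 : ℝ) - q₁.1)⁻¹)).congr fun n => ?_⟩
    rw [hs]
    field_simp
    ring
  -- If s ≤ 0, then x - s y would tend to infinity together with x, although it converges to ζ.
  have hspos : 0 < s := by
    by_contra hcon
    push Not at hcon
    have h1 : Filter.Tendsto (fun n => x n - s * y n) U Filter.atTop := by
      refine Filter.tendsto_atTop_mono' _ ?_ hxT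
      filter_upwards [hyT.eventually_ge_atTop 0] with n hn
      nlinarith
    exact not_tendsto_nhds_of_tendsto_atTop h1 _ hζ
  set M : ℝ := s * q₀.1 + q₀.2 with hM
  have hM₁ : s * q₁.1 + q₁.2 = M := by
    rw [hM, hs]; field_simp; ring
  have hsplit : ∀ q : ℕ × ℕ, (fun n => ((q.1 : ℝ) - q₀.1) * x n + ((q.2 : ℝ) - q₀.2) * y n)
      = fun n => ((q.1 : ℝ) - q₀.1) * (x n - s * y n) + (s * q.1 + q.2 - M) * y n := fun q => by
    funext n; rw [hM]; ring
  have hle : ∀ q ∈ Λ₀ F, s * q.1 + q.2 ≤ M := by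
    intro q hq
    by_contra hcon
    push Not at hcon
    have h1 := hexp q hq q₀ hq₀ hr₀
    have h2 : Filter.Tendsto (fun n => Real.exp (((q.1 : ℝ) - q₀.1) * x n
        + ((q.2 : ℝ) - q₀.2) * y n)) U Filter.atTop := by
      refine Real.tendsto_exp_atTop.comp ?_
      rw [hsplit]
      exact (hζ.const_mul _).add_atTop (hyT.const_mul_atTop (sub_pos.2 hcon))
    exact not_tendsto_nhds_of_tendsto_atTop h2 _ h1
  have hlt : ∀ q ∈ Λ₀ F, s * q.1 + q.2 ≠ M → r q = 0 := by
    intro q hq hneq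
    have h1 := hexp q hq q₀ hq₀ hr₀
    have h2 : Filter.Tendsto (fun n => Real.exp (((q.1 : ℝ) - q₀.1) * x n
        + ((q.2 : ℝ) - q₀.2) * y n)) U (𝓝 0) := by
      refine Real.tendsto_exp_atBot.comp ?_
      rw [hsplit]
      exact (hζ.const_mul _).add_atBot
        (hyT.const_mul_atTop_of_neg (sub_neg.2 (lt_of_le_of_ne (hle q hq) hneq)))
    have h3 := tendsto_nhds_unique h1 h2
    exact (div_eq_zero_iff.1 h3).resolve_right hr₀.ne'
  have heq : ∀ q ∈ Λ₀ F, s * q.1 + q.2 = M →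
      r q = r q₀ * Real.exp (((q.1 : ℝ) - q₀.1) * ζ) := by
    intro q hq h
    have h1 := hexp q hq q₀ hq₀ hr₀
    have h2 : Filter.Tendsto (fun n => Real.exp (((q.1 : ℝ) - q₀.1) * x n
        + ((q.2 : ℝ) - q₀.2) * y n)) U (𝓝 (Real.exp (((q.1 : ℝ) - q₀.1) * ζ))) := by
      refine (Real.continuous_exp.tendsto _).comp ?_
      rw [hsplit]
      simpa [h] using hζ.const_mul ((q.1 : ℝ) - q₀.1)
    have h3 := tendsto_nhds_unique h1 h2
    rw [← h3]
    field_simp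
  obtain ⟨v, w, hedge, hw, hwM, hseg, hwle⟩ : ∃ v w : ℕ × ℕ, IsEdge F v w ∧ w ∈ Λ₀ F ∧
      s * w.1 + w.2 = M ∧ (∀ q ∈ Λ₀ F, pt q ∈ segment ℝ (pt v) (pt w) ↔ s * q.1 + q.2 = M) ∧
      ∀ q ∈ Λ₀ F, s * q.1 + q.2 = M → w.1 ≤ q.1 := by
    rcases lt_or_gt_of_ne hfst with h | h
    · exact exists_isEdge hspos hle hq₀ hq₁ rfl hM₁ h
    · exact exists_isEdge hspos hle hq₁ hq₀ hM₁ rfl h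
  -- On the edge r is proportional to exp(ζ)^j and off it r vanishes. The vanishing sum is therefore
  -- a nonzero multiple of the edge polynomial at exp ζ > 0, which (GP) forbids.
  have hroot : (edgePoly F v w).IsRoot ((Real.exp ζ : ℝ) : ℂ) := by
    rw [Polynomial.IsRoot, edgePoly, Polynomial.eval_finsetSum]
    have hconst : (r q₀ * Real.exp (((w.1 : ℝ) - q₀.1) * ζ)) ≠ 0 := by positivity
    have hconst' : ((r q₀ * Real.exp (((w.1 : ℝ) - q₀.1) * ζ) : ℝ) : ℂ) ≠ 0 := by
      exact_mod_cast hconst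
    refine (mul_eq_zero.1 ?_).resolve_left hconst'
    rw [← hsum, Finset.mul_sum, Finset.sum_filter]
    refine Finset.sum_congr rfl fun q hq => ?_
    by_cases h : s * q.1 + q.2 = M
    · rw [if_pos ((hseg q hq).2 h), heq q hq h]
      simp only [Polynomial.eval_mul, Polynomial.eval_C, Polynomial.eval_pow, Polynomial.eval_X]
      have : Real.exp (((q.1 : ℝ) - q₀.1) * ζ)
          = Real.exp (((w.1 : ℝ) - q₀.1) * ζ) * Real.exp ζ ^ (q.1 - w.1) := by
        rw [← Real.exp_nat_mul, ← Real.exp_add, Nat.cast_sub (hwle q hq h)]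
        congr 1
        ring
      rw [this]
      push_cast
      ring
    · rw [if_neg fun h' => h ((hseg q hq).1 h'), hlt q hq h]
      simp
  exact hGP.1 v w hedge _ hroot _ (Real.exp_pos ζ).le rfl

/-- The case in which the first argument is eventually constant. -/
lemma sum_limits_ne_zero_of_const_tendsto {ι : Type*} {U : Ultrafilter ι} {κ lam : ι → ℕ} {k : ℕ}
    (hk : 1 ≤ k) (hκ' : ∀ᶠ n in (U : Filter ι), κ n = k)
    (hlam : Filter.Tendsto lam U Filter.atTop) {r : ℕ × ℕ → ℝ}
    (hr : ∀ q ∈ Λ₀ F, Filter.Tendsto (fun n => (κ n : ℝ) ^ q.1 * ((lam n : ℝ) + 1) ^ q.2 /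
      polySize F (κ n) (lam n)) U (𝓝 (r q)))
    (hr1 : ∑ q ∈ Λ₀ F, r q = 1) (hGP : GenPoincare F) :
    ∑ q ∈ Λ₀ F, c0 F q * (r q : ℂ) ≠ 0 := by
  classical
  intro hsum
  obtain ⟨v, hv, hlast, hmax⟩ := exists_isLastVertex F
  have hk0 : (0 : ℝ) < k := by exact_mod_cast hk
  have hlT : Filter.Tendsto (fun n => (lam n : ℝ) + 1) U Filter.atTop :=
    Filter.tendsto_atTop_add_const_right _ _ (tendsto_natCast_atTop_atTop.comp hlam)
  -- For fixed k only the monomials of maximal α survive as l tends to infinity, and these form the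
  -- horizontal edge.
  have hratio : ∀ q ∈ Λ₀ F, r q = r v * (if q.2 = v.2 then (k : ℝ) ^ q.1 / (k : ℝ) ^ v.1 else 0) := by
    intro q hq
    refine tendsto_nhds_unique (hr q hq) ?_
    have h1 : Filter.Tendsto (fun n => (k : ℝ) ^ q.1 / (k : ℝ) ^ v.1 *
        (((lam n : ℝ) + 1) ^ q.2 / ((lam n : ℝ) + 1) ^ v.2)) U
        (𝓝 (if q.2 = v.2 then (k : ℝ) ^ q.1 / (k : ℝ) ^ v.1 else 0)) := by
      rcases hmax q hq with h | ⟨h, -⟩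
      · rw [if_neg h.ne]
        have h2 := (tendsto_pow_neg_atTop (𝕜 := ℝ) (n := v.2 - q.2) (by omega)).comp hlT
        have h3 := h2.const_mul ((k : ℝ) ^ q.1 / (k : ℝ) ^ v.1)
        rw [mul_zero] at h3
        refine h3.congr fun n => ?_
        congr 1
        have hl0 : (0 : ℝ) < (lam n : ℝ) + 1 := by positivity
        simp only [Function.comp]
        rw [eq_div_iff (by positivity), zpow_neg, zpow_natCast, inv_mul_eq_iff_eq_mul₀ (by positivity),
          ← pow_add, Nat.sub_add_cancel h.le]
      · rw [if_pos h, h]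
        refine tendsto_const_nhds.congr fun n => ?_
        have hl0 : (0 : ℝ) < (lam n : ℝ) + 1 := by positivity
        rw [div_self (by positivity), mul_one]
    refine ((hr v hv).mul h1).congr' ?_
    filter_upwards [hκ'] with n hn
    have hl0 : (0 : ℝ) < (lam n : ℝ) + 1 := by positivity
    have hφ := (polySize_pos (F := F) hk (lam n)).ne'
    rw [hn]
    field_simp
  have hrv : r v ≠ 0 := by
    intro h
    have : ∑ q ∈ Λ₀ F, r q = 0 := Finset.sum_eq_zero fun q hq => by rw [hratio q hq, h, zero_mul]
    linarith
  have hzero : ∑ q ∈ (Λ₀ F).filter (fun q => q.1 ≤ v.1 ∧ q.2 = v.2), c0 F q * (k : ℂ) ^ q.1 = 0 := by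
    have hconst : ((r v / (k : ℝ) ^ v.1 : ℝ) : ℂ) ≠ 0 := by
      have : r v / (k : ℝ) ^ v.1 ≠ 0 := div_ne_zero hrv (by positivity)
      exact_mod_cast this
    refine (mul_eq_zero.1 ?_).resolve_left hconst
    rw [← hsum, Finset.mul_sum, Finset.sum_filter]
    refine Finset.sum_congr rfl fun q hq => ?_
    rw [hratio q hq]
    by_cases h : q.2 = v.2
    · have h' : q.1 ≤ v.1 := by
        rcases hmax q hq with h1 | h1
        · omega
        · exact h1.2
      rw [if_pos ⟨h', h⟩, if_pos h]
      push_cast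
      ring
    · rw [if_neg fun h1 => h h1.2, if_neg h]
      simp
  -- If m_p = 0, the horizontal edge contains no point of Λ₀ except v, and its coefficient is
  -- nonzero; otherwise k is a positive integer root of `lastPoly`.
  by_cases hv0 : v.1 = 0
  · rw [Finset.sum_eq_single_of_mem v (by simp [hv])] at hzero
    · have hkC : (k : ℂ) ≠ 0 := by exact_mod_cast hk0.ne'
      exact (mul_ne_zero (c0_ne_zero_of_mem hv) (pow_ne_zero _ hkC)) hzero
    · intro q hq hne
      simp only [Finset.mem_filter] at hq
      exact absurd (Prod.ext (by omega) hq.2.2) hne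
  · refine hGP.2 v hlast (k : ℂ) ?_ k hk rfl
    rw [Polynomial.IsRoot, lastPoly, if_neg hv0, Polynomial.eval_finsetSum, ← hzero]
    exact Finset.sum_congr rfl fun q _ => by simp

/-- A counterexample sequence is examined along a nonprincipal ultrafilter, where each of k and l is
eventually constant or tends to infinity. The four cases use, in turn, (N), the last polynomial, the
term k^m with coefficient -1, and the edge polynomials. -/
lemma exists_lower_bound (hN : NonResonance F) (hGP : GenPoincare F) :
    ∃ δ : ℝ, 0 < δ ∧ ∀ k l : ℕ, 1 ≤ k → δ * polySize F k l ≤ ‖L F k l‖ := by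
  classical
  by_contra hcon
  push Not at hcon
  choose κ lam hκ hlt using fun n : ℕ => hcon (1 / ((n : ℝ) + 1)) (by positivity)
  set U : Ultrafilter ℕ := Filter.hyperfilter ℕ with hU
  have hφ : ∀ n, 0 < polySize F (κ n) (lam n) := fun n => polySize_pos (hκ n) _
  have hlim : Filter.Tendsto (fun n => L F (κ n) (lam n) / (polySize F (κ n) (lam n) : ℂ)) U
      (𝓝 0) := by
    rw [tendsto_zero_iff_norm_tendsto_zero]
    have h1 : Filter.Tendsto (fun n : ℕ => 1 / ((n : ℝ) + 1)) U (𝓝 0) :=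
      tendsto_one_div_add_atTop_nhds_zero_nat.mono_left (Nat.hyperfilter_le_atTop)
    refine squeeze_zero (fun _ => norm_nonneg _) (fun n => ?_) h1
    rw [norm_div, Complex.norm_real, Real.norm_of_nonneg (hφ n).le, div_le_iff₀ (hφ n)]
    exact (hlt n).le
  have hbd : ∀ q ∈ Λ₀ F, ∀ n, (κ n : ℝ) ^ q.1 * ((lam n : ℝ) + 1) ^ q.2 /
      polySize F (κ n) (lam n) ∈ Set.Icc (0 : ℝ) 1 := fun q hq n =>
    ⟨div_nonneg (by positivity) (hφ n).le, (div_le_one (hφ n)).2 (term_le_polySize _ _ hq)⟩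
  have hex : ∀ q, ∃ x : ℝ, q ∈ Λ₀ F → 0 ≤ x ∧ Filter.Tendsto (fun n => (κ n : ℝ) ^ q.1 *
      ((lam n : ℝ) + 1) ^ q.2 / polySize F (κ n) (lam n)) U (𝓝 x) := by
    intro q
    by_cases hq : q ∈ Λ₀ F
    · obtain ⟨x, hx, h⟩ := ultrafilter_tendsto_of_bounded U (hbd q hq)
      exact ⟨x, fun _ => ⟨hx.1, h⟩⟩
    · exact ⟨0, fun h => absurd h hq⟩
  choose r hr using hex
  have hr1 : ∑ q ∈ Λ₀ F, r q = 1 := by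
    have h1 := tendsto_finsetSum (Λ₀ F) fun q hq => (hr q hq).2
    refine tendsto_nhds_unique h1 (tendsto_const_nhds.congr fun n => ?_)
    rw [← Finset.sum_div]
    exact (div_self (hφ n).ne').symm
  -- D corrects for l(l-1)⋯(l-α+1) against (l+1)^α. It is 1 when l tends to infinity, and the actual
  -- ratio when l is eventually constant.
  have hdesc : ∀ D : ℕ → ℝ, (∀ α, Filter.Tendsto
      (fun n => ((lam n).descFactorial α : ℝ) / ((lam n : ℝ) + 1) ^ α) U (𝓝 (D α))) →
      ∑ q ∈ Λ₀ F, c0 F q * ((r q * D q.2 : ℝ) : ℂ) = 0 := by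
    intro D hD
    have h1 := tendsto_finsetSum (Λ₀ F) fun q hq => Filter.Tendsto.const_mul (c0 F q)
      ((Complex.continuous_ofReal.tendsto _).comp (((hr q hq).2).mul (hD q.2)))
    have h2 := tendsto_nhds_unique h1 (Filter.Tendsto.congr (fun n => ?_) hlim.neg)
    · rw [h2, neg_zero]
    · rw [L_eq, neg_div, neg_neg, Finset.sum_div]
      refine Finset.sum_congr rfl fun q _ => ?_
      have hl0 : ((lam n : ℂ) + 1) ≠ 0 := by exact_mod_cast Nat.succ_ne_zero (lam n)
      have hφC : (polySize F (κ n) (lam n) : ℂ) ≠ 0 := by exact_mod_cast (hφ n).ne'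
      simp only [Function.comp]
      push_cast
      field_simp
  rcases ultrafilter_eq_const_or_tendsto U κ with ⟨k, hk⟩ | hk <;>
    rcases ultrafilter_eq_const_or_tendsto U lam with ⟨l, hl⟩ | hl
  · obtain ⟨n, hn1, hn2⟩ := (hk.and hl).exists
    have hk1 : 1 ≤ k := hn1 ▸ hκ n
    have h1 : Filter.Tendsto (fun n => L F (κ n) (lam n) / (polySize F (κ n) (lam n) : ℂ)) U
        (𝓝 (L F k l / (polySize F k l : ℂ))) := by
      refine tendsto_const_nhds.congr' ?_
      filter_upwards [hk, hl] with n h1 h2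
      rw [h1, h2]
    have h2 := tendsto_nhds_unique h1 hlim
    rcases div_eq_zero_iff.1 h2 with h | h
    · exact hN k l hk1 h
    · exact (polySize_pos (F := F) hk1 l).ne' (by exact_mod_cast h)
  · obtain ⟨n, hn1⟩ := hk.exists
    refine sum_limits_ne_zero_of_const_tendsto (hn1 ▸ hκ n) hk hl (fun q hq => (hr q hq).2) hr1
      hGP ?_
    simpa using hdesc (fun _ => 1) fun α => (tendsto_descFactorial_div α).comp hl
  -- For bounded l and k tending to infinity, k^m dominates because every other point of Λ₀ has j <
  -- m.
  · have hrz : ∀ q ∈ Λ₀ F, q ≠ (m, 0) → r q = 0 := by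
      intro q hq hne
      have hlt := fst_lt_of_mem hq hne
      have hκT : Filter.Tendsto (fun n => (κ n : ℝ)) U Filter.atTop :=
        tendsto_natCast_atTop_atTop.comp hk
      have h1 := ((tendsto_pow_neg_atTop (𝕜 := ℝ) (n := m - q.1) (by omega)).comp hκT).const_mul
        (((l : ℝ) + 1) ^ q.2)
      rw [mul_zero] at h1
      have h2 := (hr (m, 0) m_zero_mem).2.mul h1
      rw [mul_zero] at h2
      refine tendsto_nhds_unique (hr q hq).2 (h2.congr' ?_)
      filter_upwards [hl] with n hn
      have hκn : (0 : ℝ) < κ n := by exact_mod_cast hκ n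
      simp only [Function.comp, pow_zero, mul_one]
      have hpow : (κ n : ℝ) ^ m = (κ n : ℝ) ^ (m - q.1) * (κ n : ℝ) ^ q.1 := by
        rw [← pow_add, Nat.sub_add_cancel hlt.le]
      rw [hn, zpow_neg, zpow_natCast, hpow]
      field_simp
    have h1 := hdesc (fun α => (l.descFactorial α : ℝ) / ((l : ℝ) + 1) ^ α) fun α => by
      refine tendsto_const_nhds.congr' ?_
      filter_upwards [hl] with n hn
      rw [hn]
    have hrm : r (m, 0) = 1 := by
      rw [← hr1, Finset.sum_eq_single_of_mem _ m_zero_mem hrz]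
    rw [Finset.sum_eq_single_of_mem _ m_zero_mem fun q hq hne => by simp [hrz q hq hne]] at h1
    simp [c0_m_zero, hrm] at h1
  · refine sum_limits_ne_zero_of_tendsto_tendsto hκ hk hl (fun q hq => (hr q hq).1)
      (fun q hq => (hr q hq).2) hr1 hGP ?_
    simpa using hdesc (fun _ => 1) fun α => (tendsto_descFactorial_div α).comp hl

end LowerBound

/-! ### The recursion for the coefficients of a formal solution -/

section Recursion

variable {m : ℕ} {F : (Var m → ℂ) → ℂ}

/-- The total degree of a monomial in the variables `t` and `z`. -/
def tzDeg (e : Var m →₀ ℕ) : ℕ := e (vt m) + ∑ q : Idx m, e (vz q)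

/-- The monomial with exponent `e`, evaluated at the jet of `u`. -/
def jetMonomial (u : FPS) (e : Var m →₀ ℕ) : FPS := e.prod fun v n => jet m u v ^ n

lemma jetMonomial_eq_prod (u : FPS) (e : Var m →₀ ℕ) :
    jetMonomial u e = MvPowerSeries.X 0 ^ e (vt m) * MvPowerSeries.X 1 ^ e (vx m) *
      ∏ q : Idx m, jet m u (vz q) ^ e (vz q) := by
  rw [jetMonomial, Finsupp.prod_fintype _ _ (by simp), Fintype.prod_sum_type, Fin.prod_univ_two]
  rfl

lemma hasSubst_jet {u : FPS} (hu : ∀ l, co u 0 l = 0) : MvPowerSeries.HasSubst (jet m u) := by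
  refine MvPowerSeries.hasSubst_of_constantCoeff_zero fun v => ?_
  rcases v with i | q
  · simp [jet]
  · have h : MvPowerSeries.constantCoeff (jet m u (vz q)) = co (jet m u (vz q)) 0 0 := by
      rw [co, ← MvPowerSeries.coeff_zero_eq_constantCoeff_apply]
      simp [expo]
    rw [h, co_jet, hu]
    simp

lemma co_subst {u : FPS} (hu : ∀ l, co u 0 l = 0) (f : MvPowerSeries (Var m) ℂ) (k l : ℕ) :
    co (MvPowerSeries.subst (jet m u) f) k l
      = ∑ᶠ e, MvPowerSeries.coeff e f * co (jetMonomial u e) k l := by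
  rw [co, MvPowerSeries.coeff_subst (hasSubst_jet hu)]
  rfl

lemma co_subst_finite {u : FPS} (hu : ∀ l, co u 0 l = 0) (f : MvPowerSeries (Var m) ℂ)
    (k l : ℕ) :
    (Function.support fun e => MvPowerSeries.coeff e f * co (jetMonomial u e) k l).Finite :=
  MvPowerSeries.coeff_subst_finite (hasSubst_jet hu) f (expo k l)

/-- `f` and `g` are divisible by `t^n` and congruent modulo `t^{k+n-1}`. -/
def TCong (k n : ℕ) (f g : FPS) : Prop :=
  MvPowerSeries.X 0 ^ n ∣ f ∧ MvPowerSeries.X 0 ^ n ∣ g ∧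
    MvPowerSeries.X 0 ^ (k + n) ∣ MvPowerSeries.X 0 * (f - g)

lemma TCong.refl {k n : ℕ} {f : FPS} (h : MvPowerSeries.X 0 ^ n ∣ f) : TCong k n f f :=
  ⟨h, h, by simp⟩

/-- Replacing one factor at a time, the other factor contributes its own order in t to the error.
The extra factor t in `TCong` avoids the truncated subtraction k + n - 1. -/
lemma TCong.mul {k n n' : ℕ} {f f' g g' : FPS} (h : TCong k n f g) (h' : TCong k n' f' g') :
    TCong k (n + n') (f * f') (g * g') := by
  refine ⟨?_, ?_, ?_⟩
  · rw [pow_add]; exact mul_dvd_mul h.1 h'.1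
  · rw [pow_add]; exact mul_dvd_mul h.2.1 h'.2.1
  · have e : (MvPowerSeries.X 0 : FPS) * (f * f' - g * g')
        = f * (MvPowerSeries.X 0 * (f' - g')) + (MvPowerSeries.X 0 * (f - g)) * g' := by ring
    rw [e]
    refine dvd_add ?_ ?_
    · rw [show k + (n + n') = n + (k + n') by ring, pow_add]
      exact mul_dvd_mul h.1 h'.2.2
    · rw [show k + (n + n') = (k + n) + n' by ring, pow_add]
      exact mul_dvd_mul h.2.2 h'.2.1

lemma TCong.pow {k n : ℕ} {f g : FPS} (h : TCong k n f g) (i : ℕ) :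
    TCong k (i * n) (f ^ i) (g ^ i) := by
  induction i with
  | zero => simpa using TCong.refl (k := k) (n := 0) (f := 1) (by simp)
  | succ i ih => rw [pow_succ, pow_succ, Nat.succ_mul]; exact ih.mul h

lemma TCong.prod {k : ℕ} {ι : Type*} (s : Finset ι) (n : ι → ℕ) (f g : ι → FPS)
    (h : ∀ i ∈ s, TCong k (n i) (f i) (g i)) :
    TCong k (∑ i ∈ s, n i) (∏ i ∈ s, f i) (∏ i ∈ s, g i) := by
  classical
  induction s using Finset.induction_on with
  | empty => simpa using TCong.refl (k := k) (n := 0) (f := 1) (by simp)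
  | insert i s hi ih =>
    rw [Finset.sum_insert hi, Finset.prod_insert hi, Finset.prod_insert hi]
    exact (h i (by simp)).mul (ih fun j hj => h j (by simp [hj]))

lemma tCong_jet {u v : FPS} {k : ℕ} (hu : ∀ l, co u 0 l = 0) (hv : ∀ l, co v 0 l = 0)
    (h : ∀ k' < k, ∀ l, co u k' l = co v k' l) (q : Idx m) :
    TCong k 1 (jet m u (vz q)) (jet m v (vz q)) := by
  refine ⟨?_, ?_, ?_⟩
  · rw [X_zero_pow_dvd_iff]
    intro k l hk
    obtain rfl : k = 0 := by omega
    rw [co_jet, hu]; simp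
  · rw [X_zero_pow_dvd_iff]
    intro k l hk
    obtain rfl : k = 0 := by omega
    rw [co_jet, hv]; simp
  · rw [pow_succ']
    refine mul_dvd_mul_left _ ?_
    rw [X_zero_pow_dvd_iff]
    intro k' l hk'
    rw [co_sub, co_jet, co_jet, h k' hk', sub_self]

lemma tCong_jetMonomial {u v : FPS} {k : ℕ} (hu : ∀ l, co u 0 l = 0) (hv : ∀ l, co v 0 l = 0)
    (h : ∀ k' < k, ∀ l, co u k' l = co v k' l) (e : Var m →₀ ℕ) :
    TCong k (tzDeg e) (jetMonomial u e) (jetMonomial v e) := by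
  rw [jetMonomial_eq_prod, jetMonomial_eq_prod, tzDeg]
  refine TCong.mul ?_ ?_
  · exact TCong.refl (Dvd.intro _ rfl)
  · refine TCong.prod _ _ _ _ fun q _ => ?_
    simpa using (tCong_jet hu hv h q).pow (e (vz q))

/-- With at least two factors of positive order in t, the congruence modulo t^{k+n-1} reaches
t^{k+1}. This is why the nonlinear part is explicit in the recursion. -/
lemma co_jetMonomial_congr {u v : FPS} {k : ℕ} (hu : ∀ l, co u 0 l = 0) (hv : ∀ l, co v 0 l = 0)
    (h : ∀ k' < k, ∀ l, co u k' l = co v k' l) {e : Var m →₀ ℕ} (he : 2 ≤ tzDeg e) (l : ℕ) :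
    co (jetMonomial u e) k l = co (jetMonomial v e) k l := by
  have h1 := (tCong_jetMonomial hu hv h e).2.2
  have h2 : (MvPowerSeries.X 0 : FPS) * MvPowerSeries.X 0 ^ (k + 1)
      ∣ MvPowerSeries.X 0 * (jetMonomial u e - jetMonomial v e) := by
    rw [← pow_succ']
    exact (pow_dvd_pow _ (by omega)).trans h1
  have hX : (MvPowerSeries.X 0 : FPS) ≠ 0 := fun h0 => by
    have := co_X_zero 1 0
    rw [h0] at this
    simp [co] at this
  rw [mul_dvd_mul_iff_left hX, X_zero_pow_dvd_iff] at h2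
  have := h2 k l (by omega)
  rwa [co_sub, sub_eq_zero] at this

lemma co_jetMonomial_eq_zero {u : FPS} (hu : ∀ l, co u 0 l = 0) {e : Var m →₀ ℕ} {k : ℕ}
    (hk : k < tzDeg e) (l : ℕ) : co (jetMonomial u e) k l = 0 :=
  (X_zero_pow_dvd_iff _ _).1 (tCong_jetMonomial (k := 0) hu hu (by simp) e).1 k l hk

lemma coeff_R₂ (e : Var m →₀ ℕ) : MvPowerSeries.coeff e (R₂ F)
    = if 2 ≤ tzDeg e then MvPowerSeries.coeff e (taylor F) else 0 := rfl

lemma co_subst_R₂_congr {u v : FPS} {k : ℕ} (hu : ∀ l, co u 0 l = 0) (hv : ∀ l, co v 0 l = 0)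
    (h : ∀ k' < k, ∀ l, co u k' l = co v k' l) (l : ℕ) :
    co (MvPowerSeries.subst (jet m u) (R₂ F)) k l
      = co (MvPowerSeries.subst (jet m v) (R₂ F)) k l := by
  rw [co_subst hu, co_subst hv]
  refine finsum_congr fun e => ?_
  rw [coeff_R₂]
  split_ifs with he
  · rw [co_jetMonomial_congr hu hv h he]
  · simp

lemma co_subst_R₂_zero {u : FPS} (hu : ∀ l, co u 0 l = 0) (l : ℕ) :
    co (MvPowerSeries.subst (jet m u) (R₂ F)) 0 l = 0 := by
  rw [co_subst hu]
  refine finsum_eq_zero_of_forall_eq_zero fun e => ?_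
  rw [coeff_R₂]
  split_ifs with he
  · rw [co_jetMonomial_eq_zero hu (by omega), mul_zero]
  · simp

/-- The exponents of degree one in `(t, z)`. -/
def linearExpo (y : Option (Idx m) × ℕ) : Var m →₀ ℕ :=
  match y.1 with
  | none => Finsupp.single (vt m) 1 + Finsupp.single (vx m) y.2
  | some q => linExp q y.2

lemma jetMonomial_linearExpo_none (u : FPS) (μ : ℕ) :
    jetMonomial u (linearExpo (m := m) (none, μ)) = MvPowerSeries.X 1 ^ μ * MvPowerSeries.X 0 := by
  rw [jetMonomial, linearExpo, Finsupp.prod_add_index' (by simp) (by simp [pow_add]),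
    Finsupp.prod_single_index (by simp), Finsupp.prod_single_index (by simp)]
  simp [jet, mul_comm]

lemma jetMonomial_linearExpo_some (u : FPS) (q : Idx m) (μ : ℕ) :
    jetMonomial u (linearExpo (some q, μ)) = MvPowerSeries.X 1 ^ μ * jet m u (vz q) := by
  change (linExp q μ).prod (fun v n => jet m u v ^ n) = _
  rw [linExp, Finsupp.prod_add_index' (by simp) (by simp [pow_add]),
    Finsupp.prod_single_index (by simp), Finsupp.prod_single_index (by simp)]
  simp [jet]

lemma linearExpo_injective : Function.Injective (linearExpo (m := m)) := by
  rintro ⟨o, μ⟩ ⟨o', μ'⟩ h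
  have hx := DFunLike.congr_fun h (vx m)
  rcases o with _ | q <;> rcases o' with _ | q'
  · simp [linearExpo] at hx; simp [hx]
  · have := DFunLike.congr_fun h (vt m)
    simp [linearExpo, linExp] at this
  · have := DFunLike.congr_fun h (vt m)
    simp [linearExpo, linExp] at this
  · have hq := DFunLike.congr_fun h (vz q)
    simp only [linearExpo, linExp, Finsupp.add_apply] at hx hq
    simp [Finsupp.single_apply] at hx hq
    rw [hx, hq]

lemma eq_linearExpo_of_tzDeg_eq_one {e : Var m →₀ ℕ} (he : tzDeg e = 1) :
    ∃ o, e = linearExpo (o, e (vx m)) := by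
  classical
  rw [tzDeg] at he
  by_cases ht : e (vt m) = 1
  · have hz : ∀ q : Idx m, e (vz q) = 0 := by
      have : ∑ q : Idx m, e (vz q) = 0 := by omega
      simpa using this
    refine ⟨none, ?_⟩
    ext v
    rcases v with i | q
    · fin_cases i <;> simp [linearExpo, ht]
    · simp [linearExpo, hz]
  · have ht0 : e (vt m) = 0 := by omega
    have hs : ∑ q : Idx m, e (vz q) = 1 := by omega
    obtain ⟨q, -, hq⟩ := Finset.exists_ne_zero_of_sum_ne_zero (hs.trans_ne one_ne_zero)
    have hs' := Finset.add_sum_erase Finset.univ (fun q : Idx m => e (vz q)) (Finset.mem_univ q)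
    have hq1 : e (vz q) = 1 := by omega
    have hz : ∀ q' : Idx m, q' ≠ q → e (vz q') = 0 := by
      have h0 : ∑ q' ∈ Finset.univ.erase q, e (vz q') = 0 := by omega
      intro q' hq'
      exact Finset.sum_eq_zero_iff.1 h0 q' (by simp [hq'])
    refine ⟨some q, ?_⟩
    ext v
    rcases v with i | q'
    · fin_cases i <;> simp [linearExpo, linExp, ht0]
    · by_cases h : q' = q
      · subst h; simp [linearExpo, linExp, hq1]
      · simp [linearExpo, linExp, hz q' h, Ne.symm h]

lemma tzDeg_linearExpo (y : Option (Idx m) × ℕ) : tzDeg (linearExpo y) = 1 := by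
  classical
  rcases y with ⟨_ | q, μ⟩
  · simp [tzDeg, linearExpo]
  · simp [tzDeg, linearExpo, linExp, Finsupp.single_apply]

lemma coeff_taylor_of_tzDeg_eq_zero
    (h0 : ∀ l, MvPowerSeries.coeff (Finsupp.single (vx m) l) (taylor F) = 0) {e : Var m →₀ ℕ}
    (he : tzDeg e = 0) : MvPowerSeries.coeff e (taylor F) = 0 := by
  rw [tzDeg] at he
  have hz : ∀ q : Idx m, e (vz q) = 0 := by
    have : ∑ q : Idx m, e (vz q) = 0 := by omega
    simpa using this
  have : e = Finsupp.single (vx m) (e (vx m)) := by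
    ext v
    rcases v with i | q
    · fin_cases i
      · have ht : e (vt m) = 0 := by omega
        simpa using ht
      · simp
    · simp [hz]
  rw [this]
  exact h0 _

lemma coeff_c (q : Idx m) (i : ℕ) : PowerSeries.coeff i (c F q.1)
    = MvPowerSeries.coeff (linExp q (i + q.1.2)) (taylor F) := by
  have hne : q.1 ≠ (m, 0) := fun h => m_zero_notMem (h ▸ q.2)
  rw [c, if_neg hne, dif_pos q.2, PowerSeries.coeff_mk, b, PowerSeries.coeff_mk]

lemma coeff_linExp_of_lt (hA3 : A3 F) (q : Idx m) {μ : ℕ} (hμ : μ < q.1.2) :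
    MvPowerSeries.coeff (linExp q μ) (taylor F) = 0 := by
  have h := (PowerSeries.X_pow_dvd_iff.1 (hA3 q (by omega))) μ hμ
  rwa [b, PowerSeries.coeff_mk] at h

/-- The inhomogeneity `a(x)`. -/
def aCoeff (F : (Var m → ℂ) → ℂ) (l : ℕ) : ℂ :=
  MvPowerSeries.coeff (linearExpo (none, l)) (taylor F)

/-- By A₃ only μ = i + α contributes, and x^{i+α}∂_x^α maps x^{l-i} to (l-i)⋯(l-i-α+1) x^l. The
surplus indices i > l - α carry a vanishing falling factorial. -/
lemma sum_linear_some (hA3 : A3 F) (u : FPS) (q : Idx m) (k l : ℕ) :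
    ∑ μ ∈ Finset.range (l + 1), MvPowerSeries.coeff (linExp q μ) (taylor F) *
        co (MvPowerSeries.X 1 ^ μ * jet m u (vz q)) k l
      = ∑ i ∈ Finset.range (l + 1), PowerSeries.coeff i (c F q.1) *
        ((k : ℂ) ^ q.1.1 * ((l - i).descFactorial q.1.2 : ℂ)) * co u k (l - i) := by
  set α := q.1.2 with hα
  rcases le_or_gt α l with hl | hl
  · obtain ⟨n, rfl⟩ := Nat.exists_eq_add_of_le hl
    rw [show α + n + 1 = α + (n + 1) by ring, Finset.sum_range_add, Finset.sum_eq_zero, zero_add]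
    · have hsub : Finset.range (n + 1) ⊆ Finset.range (α + (n + 1)) :=
        Finset.range_subset_range.2 (by omega)
      rw [← Finset.sum_subset hsub]
      · refine Finset.sum_congr rfl fun i hi => ?_
        have hi : i ≤ n := by simpa [Nat.lt_succ_iff] using hi
        rw [co_X_one_pow_mul, if_pos (by omega), co_jet, coeff_c, add_comm i,
          show α + n - (α + i) = n - i by omega, show α + n - i = (n - i) + α by omega,
          Nat.add_descFactorial_eq_ascFactorial]
        ring
      · intro i hi' hi
        have hi' : i < α + (n + 1) := Finset.mem_range.1 hi'
        have hi : n < i := by simpa [Nat.lt_succ_iff] using hi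
        rw [Nat.descFactorial_of_lt (by omega)]
        simp
    · intro μ hμ
      rw [coeff_linExp_of_lt hA3 q (by simpa using hμ), zero_mul]
  · rw [Finset.sum_eq_zero, Finset.sum_eq_zero]
    · intro i _
      rw [Nat.descFactorial_of_lt (by omega)]
      simp
    · intro μ hμ
      rw [coeff_linExp_of_lt hA3 q (by have := Finset.mem_range.1 hμ; omega), zero_mul]

/-- The coefficients of the right-hand side of the equation. -/
lemma co_subst_taylor
    (h0 : ∀ l, MvPowerSeries.coeff (Finsupp.single (vx m) l) (taylor F) = 0) (hA3 : A3 F)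
    {u : FPS} (hu : ∀ l, co u 0 l = 0) (k l : ℕ) :
    co (MvPowerSeries.subst (jet m u) (taylor F)) k l
      = (if k = 1 then aCoeff F l else 0)
        + ∑ q : Idx m, ∑ i ∈ Finset.range (l + 1), PowerSeries.coeff i (c F q.1) *
          ((k : ℂ) ^ q.1.1 * ((l - i).descFactorial q.1.2 : ℂ)) * co u k (l - i)
        + co (MvPowerSeries.subst (jet m u) (R₂ F)) k l := by
  classical
  -- After removal of R₂ and of the terms of degree zero in (t,z), which vanish by A₂, only the
  -- exponents `linearExpo` remain.
  have hsplit : MvPowerSeries.subst (jet m u) (taylor F)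
      = MvPowerSeries.subst (jet m u) (taylor F - R₂ F)
        + MvPowerSeries.subst (jet m u) (R₂ F) := by
    rw [← MvPowerSeries.subst_add (hasSubst_jet hu), sub_add_cancel]
  have hadd : ∀ f g : FPS, co (f + g) k l = co f k l + co g k l := fun f g => by simp [co]
  rw [hsplit, hadd]
  congr 1
  rw [co_subst hu, finsum_eq_sum_of_support_subset (s := (Finset.univ ×ˢ Finset.range (l + 1)).map
    ⟨linearExpo, linearExpo_injective⟩)]
  · rw [Finset.sum_map, Finset.sum_product, Fintype.sum_option]
    have hlin : ∀ y : Option (Idx m) × ℕ, MvPowerSeries.coeff (linearExpo y) (taylor F - R₂ F)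
        = MvPowerSeries.coeff (linearExpo y) (taylor F) := fun y => by
      rw [map_sub, coeff_R₂, tzDeg_linearExpo, if_neg (by norm_num), sub_zero]
    simp only [Function.Embedding.coeFn_mk, hlin, jetMonomial_linearExpo_none,
      jetMonomial_linearExpo_some]
    congr 1
    · rw [Finset.sum_eq_single_of_mem l (by simp)]
      · rw [co_X_one_pow_mul, if_pos le_rfl, co_X_zero, aCoeff]
        simp
      · intro μ hμ hne
        have : μ < l := lt_of_le_of_ne (by simpa [Nat.lt_succ_iff] using hμ) hne
        rw [co_X_one_pow_mul, if_pos this.le, co_X_zero, if_neg (by omega), mul_zero]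
    · exact Finset.sum_congr rfl fun q _ => sum_linear_some hA3 u q k l
  · intro e he
    rw [Function.mem_support, map_sub, coeff_R₂] at he
    have hdeg : tzDeg e < 2 := by
      by_contra hcon
      rw [if_pos (by omega)] at he
      simp at he
    rw [if_neg (by omega), sub_zero] at he
    have hne0 : tzDeg e ≠ 0 := fun h => he (by rw [coeff_taylor_of_tzDeg_eq_zero h0 h, zero_mul])
    obtain ⟨o, ho⟩ := eq_linearExpo_of_tzDeg_eq_one (show tzDeg e = 1 by omega)
    refine Finset.mem_coe.2 (Finset.mem_map.2 ⟨(o, e (vx m)), ?_, ho.symm⟩)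
    simp only [Finset.mem_product, Finset.mem_univ, Finset.mem_range, true_and]
    by_contra hcon
    refine he ?_
    rw [ho]
    rcases o with _ | q
    · rw [jetMonomial_linearExpo_none, co_X_one_pow_mul, if_neg (by omega), mul_zero]
    · rw [jetMonomial_linearExpo_some, co_X_one_pow_mul, if_neg (by omega), mul_zero]

/-- The part of the equation for the coefficient of `t^k x^l` that involves earlier coefficients
only. -/
def recRhs (F : (Var m → ℂ) → ℂ) (u : FPS) (k l : ℕ) : ℂ :=
  (if k = 1 then aCoeff F l else 0)
    + ∑ q : Idx m, ∑ i ∈ Finset.range l, PowerSeries.coeff (i + 1) (c F q.1) *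
      ((k : ℂ) ^ q.1.1 * ((l - (i + 1)).descFactorial q.1.2 : ℂ)) * co u k (l - (i + 1))
    + co (MvPowerSeries.subst (jet m u) (R₂ F)) k l

/-- The terms i = 0 of the linear part combine with (t∂_t)^m to L(k,l), and the others go into
`recRhs`. For k = 0 both sides vanish. -/
lemma isFormalSolution_iff
    (h0 : ∀ l, MvPowerSeries.coeff (Finsupp.single (vx m) l) (taylor F) = 0) (hA3 : A3 F)
    (u : FPS) :
    IsFormalSolution F u ↔ (∀ l, co u 0 l = 0) ∧
      ∀ k l : ℕ, 1 ≤ k → L F k l * co u k l = recRhs F u k l := by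
  have hzero : (∀ l : ℕ, MvPowerSeries.coeff (Finsupp.single 1 l) u = 0) ↔ ∀ l, co u 0 l = 0 := by
    simp [co, expo]
  rw [IsFormalSolution, hzero]
  refine and_congr_right fun hu => ?_
  have hL : ∀ k l : ℕ, L F k l = (k : ℂ) ^ m - ∑ q : Idx m, PowerSeries.coeff 0 (c F q.1) *
      ((k : ℂ) ^ q.1.1 * (l.descFactorial q.1.2 : ℂ)) := by
    intro k l
    rw [L, ← Finset.sum_coe_sort]
    congr 1
    refine Finset.sum_congr rfl fun q _ => ?_
    rw [prod_range_sub_eq_descFactorial, c0, ← PowerSeries.coeff_zero_eq_constantCoeff_apply]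
    ring
  have key : ∀ k l : ℕ, co (tDt^[m] u) k l = co (MvPowerSeries.subst (jet m u) (taylor F)) k l ↔
      L F k l * co u k l = recRhs F u k l := by
    intro k l
    rw [co_tDt_iterate, co_subst_taylor h0 hA3 hu, hL, recRhs]
    simp only [Finset.sum_range_succ', Finset.sum_add_distrib, Nat.sub_zero, ← Finset.sum_mul]
    constructor <;> intro h <;> linear_combination h
  constructor
  · intro h k l _
    exact (key k l).1 (by rw [h])
  · intro h
    refine co_ext fun k l => ?_
    rcases Nat.eq_zero_or_pos k with rfl | hk
    · rw [key, hu, recRhs, co_subst_R₂_zero hu]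
      simp [hu]
    · exact (key k l).2 (h k l hk)

lemma recRhs_congr {u v : FPS} {k l : ℕ} (hu : ∀ l, co u 0 l = 0) (hv : ∀ l, co v 0 l = 0)
    (h : ∀ k' l', k' < k ∨ (k' = k ∧ l' < l) → co u k' l' = co v k' l') :
    recRhs F u k l = recRhs F v k l := by
  rw [recRhs, recRhs, co_subst_R₂_congr hu hv fun k' hk' l' => h k' l' (Or.inl hk')]
  congr 2
  refine Finset.sum_congr rfl fun q _ => Finset.sum_congr rfl fun i hi => ?_
  have := Finset.mem_range.1 hi
  rw [h k _ (Or.inr ⟨rfl, by omega⟩)]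

/-- Well-founded recursion for an operator that reads only earlier values; later entries may be
filled with a default. -/
lemma exists_fixedPoint {ι α : Type*} [Inhabited α] {r : ι → ι → Prop} (hr : WellFounded r)
    (Φ : (ι → α) → ι → α)
    (hΦ : ∀ a a' i, (∀ j, r j i → a j = a' j) → Φ a i = Φ a' i) : ∃ a, ∀ i, a i = Φ a i := by
  classical
  refine ⟨hr.fix fun i rec => Φ (fun j => if h : r j i then rec j h else default) i, fun i => ?_⟩
  rw [hr.fix_eq]
  refine hΦ _ _ _ fun j hj => ?_
  rw [dif_pos hj]

/-- Existence and uniqueness of the formal solution. -/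
lemma exists_unique_formalSolution
    (h0 : ∀ l, MvPowerSeries.coeff (Finsupp.single (vx m) l) (taylor F) = 0) (hA3 : A3 F)
    (hN : NonResonance F) :
    ∃ u, IsFormalSolution F u ∧ ∀ v, IsFormalSolution F v → v = u := by
  have hwf : WellFounded (Prod.Lex (· < ·) (· < ·) : ℕ × ℕ → ℕ × ℕ → Prop) :=
    WellFounded.prod_lex wellFounded_lt wellFounded_lt
  -- The row k = 0 is forced to zero, so the values of the recursion there, where L may vanish, are
  -- never used.
  let norm0 : (ℕ × ℕ → ℂ) → FPS := fun a => ofCo fun k l => if k = 0 then 0 else a (k, l)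
  have hnorm : ∀ a l, co (norm0 a) 0 l = 0 := fun a l => by simp [norm0]
  obtain ⟨a, ha⟩ := exists_fixedPoint hwf
    (fun (a : ℕ × ℕ → ℂ) y => recRhs F (norm0 a) y.1 y.2 / L F y.1 y.2) (by
      intro a a' y hy
      rw [recRhs_congr (hnorm a) (hnorm a')]
      intro k' l' h
      have := hy (k', l') (Prod.lex_def.2 h)
      simp [norm0, this])
  refine ⟨norm0 a, (isFormalSolution_iff h0 hA3 _).2 ⟨hnorm a, fun k l hk => ?_⟩, ?_⟩
  · have h1 : co (norm0 a) k l = a (k, l) := by simp [norm0, show k ≠ 0 by omega]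
    rw [h1, ha (k, l), mul_div_cancel₀ _ (hN k l hk)]
  · intro v hv
    rw [isFormalSolution_iff h0 hA3] at hv
    have hmain : ∀ y : ℕ × ℕ, co v y.1 y.2 = co (norm0 a) y.1 y.2 := by
      intro y
      induction y using hwf.induction with
      | _ y ih =>
        obtain ⟨k, l⟩ := y
        rcases Nat.eq_zero_or_pos k with rfl | hk
        · rw [hv.1, hnorm]
        · have h1 : co (norm0 a) k l = a (k, l) := by simp [norm0, show k ≠ 0 by omega]
          simp only
          rw [h1, ha (k, l), eq_div_iff (hN k l hk), mul_comm, hv.2 k l hk]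
          exact recRhs_congr hv.1 (hnorm a) fun k' l' h => ih (k', l') (Prod.lex_def.2 h)
    exact co_ext fun k l => hmain (k, l)

end Recursion

/-! ### Numerical estimates -/

/-- The condition on a' is needed because `multichoose 0 l` drops from 1 to 0 after l = 0. -/
lemma multichoose_mono {a a' l l' : ℕ} (ha : a ≤ a') (hl : l ≤ l') (h : 1 ≤ a') :
    Nat.multichoose a l ≤ Nat.multichoose a' l' := by
  have h1 : Monotone fun a => Nat.multichoose a l := by
    refine monotone_nat_of_le_succ fun a => ?_
    rcases l with _ | l
    · simp
    · simp only [Nat.multichoose_succ_succ]; omega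
  have h2 : Monotone fun l => Nat.multichoose a' l := by
    refine monotone_nat_of_le_succ fun l => ?_
    obtain ⟨b, rfl⟩ := Nat.exists_eq_add_of_le' h
    simp only [Nat.multichoose_succ_succ]; omega
  exact (h1 ha).trans (h2 hl)

lemma factorial_mul_multichoose {a : ℕ} (ha : 1 ≤ a) (l : ℕ) :
    l ! * Nat.multichoose a l = a.ascFactorial l := by
  obtain ⟨b, rfl⟩ := Nat.exists_eq_add_of_le' ha
  rw [Nat.multichoose_eq, Nat.ascFactorial_eq_factorial_mul_choose]
  congr 2
  omega

lemma coeff_invOneSubPow (a l : ℕ) :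
    PowerSeries.coeff l (PowerSeries.invOneSubPow ℝ a : PowerSeries ℝ)
      = (Nat.multichoose a l : ℝ) := by
  rcases a with _ | a
  · rcases l with _ | l
    · simp [PowerSeries.invOneSubPow_zero]
    · simp [PowerSeries.invOneSubPow_zero, PowerSeries.coeff_one]
  · rw [PowerSeries.invOneSubPow_val_succ_eq_mk_add_choose, PowerSeries.coeff_mk,
      Nat.multichoose_eq, show a + 1 + l - 1 = a + l by omega, Nat.choose_symm_add]

/-- Coefficient form of (1-x)^{-a} (1-x)^{-a'} = (1-x)^{-(a+a')}. -/
lemma sum_multichoose_mul (a a' l : ℕ) :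
    ∑ y ∈ Finset.HasAntidiagonal.antidiagonal l,
      (Nat.multichoose a y.1 : ℝ) * (Nat.multichoose a' y.2 : ℝ)
        = (Nat.multichoose (a + a') l : ℝ) := by
  rw [← coeff_invOneSubPow, PowerSeries.invOneSubPow_add, Units.val_mul, PowerSeries.coeff_mul]
  simp only [coeff_invOneSubPow]

/-- The last μ factors of a'(a'+1)⋯(a'+l-1) are all at least s. -/
lemma ascFactorial_mul_pow_le {a a' s l μ : ℕ} (ha : a ≤ a') (hμ : μ ≤ l) (hs : s ≤ a' + (l - μ)) :
    s ^ μ * a.ascFactorial (l - μ) ≤ a'.ascFactorial l := by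
  calc s ^ μ * a.ascFactorial (l - μ)
      ≤ (a' + (l - μ)).ascFactorial μ * a'.ascFactorial (l - μ) :=
        Nat.mul_le_mul ((Nat.pow_le_pow_left hs μ).trans (Nat.pow_succ_le_ascFactorial _ _))
          (Nat.ascFactorial_le _ ha)
    _ = a'.ascFactorial l := by
        rw [mul_comm, Nat.ascFactorial_mul_ascFactorial, Nat.sub_add_cancel hμ]

/-- The part of the majorant that depends on the exponent of `x`. -/
def xWeight (τ B : ℝ) (a l : ℕ) : ℝ :=
  B ^ l * (a.ascFactorial l : ℝ) ^ τ * (Nat.multichoose a l : ℝ)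

section xWeight

variable {τ B : ℝ}

lemma xWeight_nonneg (hB : 0 ≤ B) (a l : ℕ) : 0 ≤ xWeight τ B a l := by
  unfold xWeight; positivity

lemma sum_xWeight_mul_le (hτ : 0 ≤ τ) (hB : 0 ≤ B) (a a' l : ℕ) :
    ∑ y ∈ Finset.HasAntidiagonal.antidiagonal l, xWeight τ B a y.1 * xWeight τ B a' y.2
      ≤ xWeight τ B (a + a') l := by
  calc ∑ y ∈ Finset.HasAntidiagonal.antidiagonal l, xWeight τ B a y.1 * xWeight τ B a' y.2
      ≤ ∑ y ∈ Finset.HasAntidiagonal.antidiagonal l,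
          B ^ l * ((a + a').ascFactorial l : ℝ) ^ τ *
            ((Nat.multichoose a y.1 : ℝ) * (Nat.multichoose a' y.2 : ℝ)) := by
        refine Finset.sum_le_sum fun y hy => ?_
        rw [Finset.HasAntidiagonal.mem_antidiagonal] at hy
        have h1 : (a.ascFactorial y.1 : ℝ) ^ τ * (a'.ascFactorial y.2 : ℝ) ^ τ
            ≤ ((a + a').ascFactorial l : ℝ) ^ τ := by
          rw [← Real.mul_rpow (by positivity) (by positivity)]
          refine Real.rpow_le_rpow (by positivity) ?_ hτ
          rw [← hy, ← Nat.ascFactorial_mul_ascFactorial]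
          exact_mod_cast Nat.mul_le_mul (Nat.ascFactorial_le _ (by omega))
            (Nat.ascFactorial_le _ (by omega))
        calc xWeight τ B a y.1 * xWeight τ B a' y.2
            = B ^ (y.1 + y.2) * ((a.ascFactorial y.1 : ℝ) ^ τ * (a'.ascFactorial y.2 : ℝ) ^ τ) *
              ((Nat.multichoose a y.1 : ℝ) * (Nat.multichoose a' y.2 : ℝ)) := by
              unfold xWeight; ring
          _ ≤ _ := by
              rw [hy]; gcongr
    _ = xWeight τ B (a + a') l := by
        rw [← Finset.mul_sum, sum_multichoose_mul, xWeight]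

/-- A factor x^μ buys s^{τμ}. It is used with s = l - i + 1 for the linear part and with s = k for
the nonlinear part. -/
lemma rpow_mul_xWeight_le (hτ : 0 ≤ τ) (hB : 0 ≤ B) {a a' s l μ : ℕ} (ha : a ≤ a') (ha' : 1 ≤ a')
    (hμ : μ ≤ l) (hs : s ≤ a' + (l - μ)) :
    (s : ℝ) ^ (τ * μ) * (xWeight τ B a (l - μ) * B ^ μ) ≤ xWeight τ B a' l := by
  have h1 : (s : ℝ) ^ (τ * μ) * (a.ascFactorial (l - μ) : ℝ) ^ τ ≤ (a'.ascFactorial l : ℝ) ^ τ := by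
    rw [mul_comm τ, Real.rpow_mul (by positivity), Real.rpow_natCast,
      ← Real.mul_rpow (by positivity) (by positivity)]
    refine Real.rpow_le_rpow (by positivity) ?_ hτ
    exact_mod_cast ascFactorial_mul_pow_le ha hμ hs
  have h2 : (Nat.multichoose a (l - μ) : ℝ) ≤ (Nat.multichoose a' l : ℝ) := by
    exact_mod_cast multichoose_mono ha (Nat.sub_le _ _) ha'
  calc (s : ℝ) ^ (τ * μ) * (xWeight τ B a (l - μ) * B ^ μ)
      = B ^ (l - μ + μ) * ((s : ℝ) ^ (τ * μ) * (a.ascFactorial (l - μ) : ℝ) ^ τ) *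
        (Nat.multichoose a (l - μ) : ℝ) := by
        rw [pow_add]; unfold xWeight; ring
    _ ≤ _ := by
        rw [Nat.sub_add_cancel hμ, xWeight]; gcongr

/-- The cost of ∂_x^α. Since a^{(l+α)} = a^{(α)} (a+α)^{(l)} for rising factorials, the derivative
costs s^α in the factor `multichoose` and s^{ατ} in the Gevrey factor. -/
lemma ascFactorial_mul_xWeight_le (hτ : 0 ≤ τ) (hB : 0 ≤ B) {a a' s α : ℕ} (l : ℕ) (ha : 1 ≤ a)
    (ha' : a + α ≤ a') (hs : a + α ≤ s + 1) :
    ((l + 1).ascFactorial α : ℝ) * xWeight τ B a (l + α)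
      ≤ B ^ α * (s : ℝ) ^ (α * (1 + τ)) * xWeight τ B a' l := by
  have hasc : a.ascFactorial (l + α) ≤ s ^ α * a'.ascFactorial l := by
    rw [add_comm l, ← Nat.ascFactorial_mul_ascFactorial]
    refine Nat.mul_le_mul ?_ (Nat.ascFactorial_le _ ha')
    obtain ⟨b, rfl⟩ := Nat.exists_eq_add_of_le' ha
    exact (Nat.ascFactorial_le_pow_add b α).trans (Nat.pow_le_pow_left (by omega) α)
  have hascR : (a.ascFactorial (l + α) : ℝ) ≤ (s : ℝ) ^ α * (a'.ascFactorial l : ℝ) := by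
    exact_mod_cast hasc
  have hl : (0 : ℝ) < (l ! : ℝ) := by positivity
  have h1 : ((l + 1).ascFactorial α : ℝ) * (Nat.multichoose a (l + α) : ℝ)
      ≤ (s : ℝ) ^ α * (Nat.multichoose a' l : ℝ) := by
    refine le_of_mul_le_mul_left ?_ hl
    calc (l ! : ℝ) * (((l + 1).ascFactorial α : ℝ) * (Nat.multichoose a (l + α) : ℝ))
        = (a.ascFactorial (l + α) : ℝ) := by
          rw [← mul_assoc, ← factorial_mul_multichoose ha, ← Nat.factorial_mul_ascFactorial]
          push_cast; ring
      _ ≤ _ := hascR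
      _ = _ := by
          rw [← factorial_mul_multichoose (show 1 ≤ a' by omega)]
          push_cast; ring
  have h2 : (a.ascFactorial (l + α) : ℝ) ^ τ
      ≤ (s : ℝ) ^ (α * τ) * (a'.ascFactorial l : ℝ) ^ τ := by
    rw [Real.rpow_mul (by positivity), Real.rpow_natCast,
      ← Real.mul_rpow (by positivity) (by positivity)]
    exact Real.rpow_le_rpow (by positivity) hascR hτ
  have h3 : (s : ℝ) ^ (α * (1 + τ)) = (s : ℝ) ^ α * (s : ℝ) ^ (α * τ) := by
    rcases Nat.eq_zero_or_pos α with rfl | hα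
    · simp
    · have hs0 : (0 : ℝ) < s := by
        have : 0 < s := by omega
        exact_mod_cast this
      rw [mul_add, mul_one, Real.rpow_add hs0, Real.rpow_natCast]
  calc ((l + 1).ascFactorial α : ℝ) * xWeight τ B a (l + α)
      = B ^ (l + α) * (a.ascFactorial (l + α) : ℝ) ^ τ *
        (((l + 1).ascFactorial α : ℝ) * (Nat.multichoose a (l + α) : ℝ)) := by
        unfold xWeight; ring
    _ ≤ B ^ (l + α) * ((s : ℝ) ^ (α * τ) * (a'.ascFactorial l : ℝ) ^ τ) *
        ((s : ℝ) ^ α * (Nat.multichoose a' l : ℝ)) := by gcongr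
    _ = _ := by
        rw [h3, pow_add]; unfold xWeight; ring

end xWeight

/-! ### Convolution of powers of k, and factorials against powers. -/

lemma sum_inv_sq_le (n : ℕ) :
    ∑ a ∈ Finset.range n, 1 / ((a : ℝ) + 1) ^ 2 ≤ 2 - 2 / ((n : ℝ) + 1) := by
  induction n with
  | zero => simp
  | succ n ih =>
    rw [Finset.sum_range_succ]
    have : 1 / ((n : ℝ) + 1) ^ 2 ≤ 2 / ((n : ℝ) + 1) - 2 / ((n : ℝ) + 1 + 1) := by
      rw [div_sub_div _ _ (by positivity) (by positivity), div_le_div_iff₀ (by positivity)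
        (by positivity)]
      have : (0 : ℝ) ≤ n := by positivity
      nlinarith [mul_nonneg this this, mul_nonneg (mul_nonneg this this) this]
    push_cast
    linarith

/-- The larger of a and a' is at least half of a + a', and the smaller contributes a summable
inverse square. The constant depends only on D, hence is uniform in γ. -/
lemma rpow_neg_mul_rpow_neg_le {γ D : ℝ} (hγ : 2 ≤ γ) (hγD : γ ≤ D) {a a' : ℕ} (ha : 1 ≤ a)
    (ha' : 1 ≤ a') :
    (a : ℝ) ^ (-γ) * (a' : ℝ) ^ (-γ)
      ≤ 2 ^ D * (1 / (a : ℝ) ^ 2 + 1 / (a' : ℝ) ^ 2) * ((a + a' : ℕ) : ℝ) ^ (-γ) := by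
  wlog haa : a ≤ a' generalizing a a'
  · have := this ha' ha (by omega)
    rw [add_comm a, mul_comm, add_comm (1 / (a : ℝ) ^ 2)]
    exact this
  have h0 : (0 : ℝ) < a := by exact_mod_cast ha
  have h0' : (0 : ℝ) < a' := by exact_mod_cast ha'
  have h1 : (a : ℝ) ^ (-γ) ≤ 1 / (a : ℝ) ^ 2 := by
    rw [one_div, ← Real.rpow_natCast, ← Real.rpow_neg h0.le]
    exact Real.rpow_le_rpow_of_exponent_le (by exact_mod_cast ha) (by push_cast; linarith)
  have h2 : (a' : ℝ) ^ (-γ) ≤ 2 ^ D * ((a + a' : ℕ) : ℝ) ^ (-γ) := by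
    have h3 : ((a + a' : ℕ) : ℝ) ≤ 2 * a' := by
      have : (a : ℝ) ≤ a' := by exact_mod_cast haa
      push_cast; linarith
    have h4 : (0 : ℝ) < ((a + a' : ℕ) : ℝ) := by push_cast; positivity
    calc (a' : ℝ) ^ (-γ) = 2 ^ γ * (2 * a' : ℝ) ^ (-γ) := by
          rw [Real.mul_rpow (by norm_num) h0'.le, ← mul_assoc, ← Real.rpow_add (by norm_num)]
          simp
      _ ≤ 2 ^ D * ((a + a' : ℕ) : ℝ) ^ (-γ) := by
          exact mul_le_mul (Real.rpow_le_rpow_of_exponent_le (by norm_num) hγD)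
            (Real.rpow_le_rpow_of_nonpos h4 h3 (by linarith)) (by positivity) (by positivity)
  calc (a : ℝ) ^ (-γ) * (a' : ℝ) ^ (-γ)
      ≤ (1 / (a : ℝ) ^ 2 + 1 / (a' : ℝ) ^ 2) * (2 ^ D * ((a + a' : ℕ) : ℝ) ^ (-γ)) := by
        gcongr
        exact h1.trans (le_add_of_nonneg_right (by positivity))
    _ = _ := by ring

/-- The powers `k^{-γ}`, `k ≥ 1`, form a convolution algebra up to a constant. -/
lemma sum_rpow_neg_mul_le {γ D : ℝ} (hγ : 2 ≤ γ) (hγD : γ ≤ D) (k : ℕ) :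
    ∑ y ∈ Finset.HasAntidiagonal.antidiagonal k,
      (if 1 ≤ y.1 ∧ 1 ≤ y.2 then (y.1 : ℝ) ^ (-γ) * (y.2 : ℝ) ^ (-γ) else 0)
        ≤ 4 * 2 ^ D * (k : ℝ) ^ (-γ) := by
  have hsq : ∀ g : ℕ × ℕ → ℕ, (∀ y z : ℕ × ℕ, y.1 + y.2 = k → z.1 + z.2 = k → g y = g z → y = z) →
      (∀ y : ℕ × ℕ, y.1 + y.2 = k → g y ≤ k) →
      ∑ y ∈ Finset.HasAntidiagonal.antidiagonal k,
        (if 1 ≤ g y then 1 / (g y : ℝ) ^ 2 else 0) ≤ 2 := by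
    intro g hg hgk
    calc ∑ y ∈ Finset.HasAntidiagonal.antidiagonal k, (if 1 ≤ g y then 1 / (g y : ℝ) ^ 2 else 0)
        = ∑ a ∈ (Finset.HasAntidiagonal.antidiagonal k).image g,
            (if 1 ≤ a then 1 / (a : ℝ) ^ 2 else 0) := by
          rw [Finset.sum_image]
          intro y hy z hz h
          simp only [Finset.mem_coe, Finset.HasAntidiagonal.mem_antidiagonal] at hy hz
          exact hg y z hy hz h
      _ ≤ ∑ a ∈ Finset.range (k + 1), (if 1 ≤ a then 1 / (a : ℝ) ^ 2 else 0) := by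
          refine Finset.sum_le_sum_of_subset_of_nonneg ?_ fun a _ _ => ?_
          · intro a ha
            obtain ⟨y, hy, rfl⟩ := Finset.mem_image.1 ha
            rw [Finset.HasAntidiagonal.mem_antidiagonal] at hy
            exact Finset.mem_range.2 (Nat.lt_succ_of_le (hgk y hy))
          · split_ifs <;> positivity
      _ = ∑ a ∈ Finset.range k, 1 / ((a : ℝ) + 1) ^ 2 := by
          rw [Finset.sum_range_succ']
          simp
      _ ≤ 2 := (sum_inv_sq_le k).trans (by
          have : (0 : ℝ) ≤ 2 / ((k : ℝ) + 1) := by positivity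
          linarith)
  have h1 := hsq Prod.fst (fun y z hy hz h => Prod.ext h (by omega)) (fun y hy => by omega)
  have h2 := hsq Prod.snd (fun y z hy hz h => Prod.ext (by omega) h) (fun y hy => by omega)
  calc _ ≤ ∑ y ∈ Finset.HasAntidiagonal.antidiagonal k,
        2 ^ D * ((if 1 ≤ y.1 then 1 / (y.1 : ℝ) ^ 2 else 0)
          + (if 1 ≤ y.2 then 1 / (y.2 : ℝ) ^ 2 else 0)) * (k : ℝ) ^ (-γ) := by
        refine Finset.sum_le_sum fun y hy => ?_
        rw [Finset.HasAntidiagonal.mem_antidiagonal] at hy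
        by_cases h : 1 ≤ y.1 ∧ 1 ≤ y.2
        · rw [if_pos h, if_pos h.1, if_pos h.2, ← hy]
          exact rpow_neg_mul_rpow_neg_le hγ hγD h.1 h.2
        · rw [if_neg h]
          have : ∀ a : ℕ, (0 : ℝ) ≤ if 1 ≤ a then 1 / (a : ℝ) ^ 2 else 0 := fun a => by
            split_ifs <;> positivity
          have h1 := this y.1
          have h2 := this y.2
          positivity
    _ = 2 ^ D * (∑ y ∈ Finset.HasAntidiagonal.antidiagonal k,
          (if 1 ≤ y.1 then 1 / (y.1 : ℝ) ^ 2 else 0)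
        + ∑ y ∈ Finset.HasAntidiagonal.antidiagonal k,
          (if 1 ≤ y.2 then 1 / (y.2 : ℝ) ^ 2 else 0)) * (k : ℝ) ^ (-γ) := by
        rw [← Finset.sum_add_distrib, Finset.mul_sum, Finset.sum_mul]
    _ ≤ 2 ^ D * (2 + 2) * (k : ℝ) ^ (-γ) := by gcongr
    _ = _ := by ring

/-- Each induction step costs (1 + 1/k)^n ≤ e < 3 for n ≤ k. -/
lemma pow_mul_factorial_le {n k : ℕ} (h : n ≤ k) : k ^ n * (k - n)! ≤ 3 ^ n * k ! := by
  induction n generalizing k with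
  | zero => simp
  | succ n ih =>
    obtain ⟨k, rfl⟩ := Nat.exists_eq_add_of_le' (show 1 ≤ k by omega)
    have hnk : n ≤ k := by omega
    have h3 : (k + 1) ^ n ≤ 3 * k ^ n := by
      rcases Nat.eq_zero_or_pos k with rfl | hk
      · obtain rfl : n = 0 := by omega
        simp
      have hk0 : (0 : ℝ) < k := by exact_mod_cast hk
      have h4 : (1 + 1 / (k : ℝ)) ^ n ≤ 3 := by
        calc (1 + 1 / (k : ℝ)) ^ n ≤ (Real.exp (1 / k)) ^ n := by
              gcongr
              rw [add_comm]; exact Real.add_one_le_exp _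
          _ = Real.exp (n * (1 / k)) := by rw [Real.exp_nat_mul]
          _ ≤ Real.exp 1 := by
              refine Real.exp_le_exp.2 ?_
              rw [mul_one_div, div_le_one hk0]
              exact_mod_cast hnk
          _ ≤ 3 := Real.exp_one_lt_three.le
      have h5 : ((k : ℝ) + 1) ^ n ≤ 3 * (k : ℝ) ^ n := by
        calc ((k : ℝ) + 1) ^ n = (1 + 1 / (k : ℝ)) ^ n * (k : ℝ) ^ n := by
              rw [← mul_pow]; congr 1; field_simp
          _ ≤ 3 * (k : ℝ) ^ n := by gcongr
      exact_mod_cast h5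
    calc (k + 1) ^ (n + 1) * (k + 1 - (n + 1))! = (k + 1) * ((k + 1) ^ n * (k - n)!) := by
          rw [Nat.add_sub_add_right]; ring
      _ ≤ (k + 1) * (3 * k ^ n * (k - n)!) := by gcongr
      _ = 3 * (k + 1) * (k ^ n * (k - n)!) := by ring
      _ ≤ 3 * (k + 1) * (3 ^ n * k !) := Nat.mul_le_mul_left _ (ih hnk)
      _ = 3 ^ (n + 1) * (k + 1)! := by rw [Nat.factorial_succ]; ring

lemma pow_mul_factorial_sub_le {n k : ℕ} (hn : 1 ≤ n) (h : n ≤ k) :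
    k ^ (n - 1) * (k - n)! ≤ 3 ^ n * (k - 1)! := by
  have hk : 0 < k := by omega
  refine Nat.le_of_mul_le_mul_left ?_ hk
  calc k * (k ^ (n - 1) * (k - n)!) = k ^ n * (k - n)! := by
        rw [← mul_assoc, ← pow_succ', Nat.sub_add_cancel hn]
    _ ≤ 3 ^ n * k ! := pow_mul_factorial_le h
    _ = k * (3 ^ n * (k - 1)!) := by rw [← Nat.mul_factorial_pred hk.ne']; ring

/-! ### Majorants of products -/

section Majorant

variable {m : ℕ} {τ ς A B : ℝ}

/-- The majorant of the coefficients of the solution. -/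
def solWeight (m : ℕ) (τ ς A B : ℝ) (k l : ℕ) : ℝ :=
  A ^ (2 * k - 1) * ((k - 1)! : ℝ) ^ ς * (k : ℝ) ^ (-(m + τ * m + 2)) *
    xWeight τ B ((2 * m + 1) * (k - 1) + 1) l

/-- The majorant of the coefficients of a product of `n` components of the jet. -/
def prodWeight (m : ℕ) (τ ς A B γ : ℝ) (n k l : ℕ) : ℝ :=
  if n ≤ k then A ^ (2 * k - n) * ((k - n)! : ℝ) ^ ς * (k : ℝ) ^ (-γ) *
    xWeight τ B ((2 * m + 1) * (k - n) + n * (m + 1)) l else 0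

lemma solWeight_nonneg (hA : 0 ≤ A) (hB : 0 ≤ B) (k l : ℕ) : 0 ≤ solWeight m τ ς A B k l := by
  have := xWeight_nonneg (τ := τ) hB ((2 * m + 1) * (k - 1) + 1) l
  unfold solWeight
  positivity

lemma prodWeight_nonneg (hA : 0 ≤ A) (hB : 0 ≤ B) (γ : ℝ) (n k l : ℕ) :
    0 ≤ prodWeight m τ ς A B γ n k l := by
  have := xWeight_nonneg (τ := τ) hB ((2 * m + 1) * (k - n) + n * (m + 1)) l
  unfold prodWeight
  split_ifs <;> positivity

lemma sum_prodWeight_mul_le (hτ : 0 ≤ τ) (hς : 0 ≤ ς) (hA : 0 ≤ A) (hB : 0 ≤ B) {γ D : ℝ}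
    (hγ : 2 ≤ γ) (hγD : γ ≤ D) {n n' : ℕ} (hn : 1 ≤ n) (hn' : 1 ≤ n') (k l : ℕ) :
    ∑ y ∈ Finset.HasAntidiagonal.antidiagonal k, ∑ w ∈ Finset.HasAntidiagonal.antidiagonal l,
      prodWeight m τ ς A B γ n y.1 w.1 * prodWeight m τ ς A B γ n' y.2 w.2
        ≤ 4 * 2 ^ D * prodWeight m τ ς A B γ (n + n') k l := by
  by_cases hk : n + n' ≤ k
  swap
  · rw [Finset.sum_eq_zero]
    · have : 0 ≤ prodWeight m τ ς A B γ (n + n') k l := prodWeight_nonneg hA hB _ _ _ _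
      positivity
    intro y hy
    rw [Finset.HasAntidiagonal.mem_antidiagonal] at hy
    refine Finset.sum_eq_zero fun w _ => ?_
    by_cases h : n ≤ y.1
    · rw [mul_comm, prodWeight, if_neg (by omega), zero_mul]
    · rw [prodWeight, if_neg h, zero_mul]
  set E := (2 * m + 1) * (k - (n + n')) + (n + n') * (m + 1) with hE
  have hx := xWeight_nonneg (τ := τ) hB E l
  calc _ ≤ ∑ y ∈ Finset.HasAntidiagonal.antidiagonal k,
        (A ^ (2 * k - (n + n')) * ((k - (n + n'))! : ℝ) ^ ς * xWeight τ B E l) *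
        (if 1 ≤ y.1 ∧ 1 ≤ y.2 then (y.1 : ℝ) ^ (-γ) * (y.2 : ℝ) ^ (-γ) else 0) := by
        refine Finset.sum_le_sum fun y hy => ?_
        rw [Finset.HasAntidiagonal.mem_antidiagonal] at hy
        by_cases h : n ≤ y.1 ∧ n' ≤ y.2
        · rw [if_pos ⟨by omega, by omega⟩]
          simp only [prodWeight, if_pos h.1, if_pos h.2]
          have hfac : ((y.1 - n)! : ℝ) ^ ς * ((y.2 - n')! : ℝ) ^ ς
              ≤ ((k - (n + n'))! : ℝ) ^ ς := by
            rw [← Real.mul_rpow (by positivity) (by positivity)]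
            refine Real.rpow_le_rpow (by positivity) ?_ hς
            have h1 := Nat.factorial_mul_factorial_dvd_factorial_add (y.1 - n) (y.2 - n')
            rw [show y.1 - n + (y.2 - n') = k - (n + n') by omega] at h1
            exact_mod_cast Nat.le_of_dvd (Nat.factorial_pos _) h1
          have hA' : A ^ (2 * y.1 - n) * A ^ (2 * y.2 - n') = A ^ (2 * k - (n + n')) := by
            rw [← pow_add]; congr 1; omega
          -- The parameters of the x-weights add exactly, so the product has the same shape with n +
          -- n' factors.
          have hEE : (2 * m + 1) * (y.1 - n) + n * (m + 1)
              + ((2 * m + 1) * (y.2 - n') + n' * (m + 1)) = E := by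
            rw [hE, show k - (n + n') = (y.1 - n) + (y.2 - n') by omega]; ring
          calc _ = (A ^ (2 * y.1 - n) * A ^ (2 * y.2 - n')) *
                (((y.1 - n)! : ℝ) ^ ς * ((y.2 - n')! : ℝ) ^ ς) *
                ((y.1 : ℝ) ^ (-γ) * (y.2 : ℝ) ^ (-γ)) *
                ∑ w ∈ Finset.HasAntidiagonal.antidiagonal l,
                  xWeight τ B ((2 * m + 1) * (y.1 - n) + n * (m + 1)) w.1 *
                  xWeight τ B ((2 * m + 1) * (y.2 - n') + n' * (m + 1)) w.2 := by
                rw [Finset.mul_sum]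
                exact Finset.sum_congr rfl fun w _ => by ring
            _ ≤ A ^ (2 * k - (n + n')) * ((k - (n + n'))! : ℝ) ^ ς *
                ((y.1 : ℝ) ^ (-γ) * (y.2 : ℝ) ^ (-γ)) * xWeight τ B E l := by
                rw [hA', ← hEE]
                gcongr
                · exact Finset.sum_nonneg fun w _ =>
                    mul_nonneg (xWeight_nonneg hB _ _) (xWeight_nonneg hB _ _)
                · exact sum_xWeight_mul_le hτ hB _ _ _
            _ = _ := by ring
        · refine le_of_eq_of_le (Finset.sum_eq_zero fun w _ => ?_) ?_
          · by_cases h' : n ≤ y.1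
            · rw [mul_comm, prodWeight, if_neg fun h'' => h ⟨h', h''⟩, zero_mul]
            · rw [prodWeight, if_neg h', zero_mul]
          · have : (0 : ℝ) ≤ if 1 ≤ y.1 ∧ 1 ≤ y.2 then (y.1 : ℝ) ^ (-γ) * (y.2 : ℝ) ^ (-γ)
                else 0 := by split_ifs <;> positivity
            positivity
    _ = (A ^ (2 * k - (n + n')) * ((k - (n + n'))! : ℝ) ^ ς * xWeight τ B E l) *
        ∑ y ∈ Finset.HasAntidiagonal.antidiagonal k,
        (if 1 ≤ y.1 ∧ 1 ≤ y.2 then (y.1 : ℝ) ^ (-γ) * (y.2 : ℝ) ^ (-γ) else 0) := by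
        rw [Finset.mul_sum]
    _ ≤ (A ^ (2 * k - (n + n')) * ((k - (n + n'))! : ℝ) ^ ς * xWeight τ B E l) *
        (4 * 2 ^ D * (k : ℝ) ^ (-γ)) := by
        gcongr
        exact sum_rpow_neg_mul_le hγ hγD k
    _ = _ := by
        rw [prodWeight, if_pos hk]; ring

/-- `f` is bounded like a product of `n` components of the jet. -/
def ProdBound (m : ℕ) (τ ς A B γ K M : ℝ) (n : ℕ) (f : FPS) : Prop :=
  if n = 0 then f = 1 else ∀ k l, ‖co f k l‖ ≤ M ^ n / K * prodWeight m τ ς A B γ n k l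

section ProdBound

variable {γ D M : ℝ}

lemma ProdBound.mul (hτ : 0 ≤ τ) (hς : 0 ≤ ς) (hA : 0 ≤ A) (hB : 0 ≤ B) (hM : 0 ≤ M)
    (hγ : 2 ≤ γ) (hγD : γ ≤ D) {n n' : ℕ} {f g : FPS}
    (hf : ProdBound m τ ς A B γ (4 * 2 ^ D) M n f)
    (hg : ProdBound m τ ς A B γ (4 * 2 ^ D) M n' g) :
    ProdBound m τ ς A B γ (4 * 2 ^ D) M (n + n') (f * g) := by
  rcases Nat.eq_zero_or_pos n with rfl | hn
  · rw [ProdBound, if_pos rfl] at hf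
    rwa [hf, zero_add, one_mul]
  rcases Nat.eq_zero_or_pos n' with rfl | hn'
  · rw [ProdBound, if_pos rfl] at hg
    rwa [hg, add_zero, mul_one]
  rw [ProdBound, if_neg hn.ne'] at hf
  rw [ProdBound, if_neg hn'.ne'] at hg
  rw [ProdBound, if_neg (by omega)]
  intro k l
  have hK : (0 : ℝ) < 4 * 2 ^ D := by positivity
  rw [co_mul]
  calc _ ≤ ∑ y ∈ Finset.HasAntidiagonal.antidiagonal k,
        ∑ w ∈ Finset.HasAntidiagonal.antidiagonal l,
        (M ^ n / (4 * 2 ^ D) * prodWeight m τ ς A B γ n y.1 w.1) *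
          (M ^ n' / (4 * 2 ^ D) * prodWeight m τ ς A B γ n' y.2 w.2) := by
        refine (norm_sum_le _ _).trans (Finset.sum_le_sum fun y _ => ?_)
        refine (norm_sum_le _ _).trans (Finset.sum_le_sum fun w _ => ?_)
        rw [norm_mul]
        exact mul_le_mul (hf _ _) (hg _ _) (norm_nonneg _)
          (mul_nonneg (by positivity) (prodWeight_nonneg hA hB _ _ _ _))
    _ = (M ^ n / (4 * 2 ^ D) * (M ^ n' / (4 * 2 ^ D))) *
        ∑ y ∈ Finset.HasAntidiagonal.antidiagonal k,
        ∑ w ∈ Finset.HasAntidiagonal.antidiagonal l,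
        prodWeight m τ ς A B γ n y.1 w.1 * prodWeight m τ ς A B γ n' y.2 w.2 := by
        rw [Finset.mul_sum]
        refine Finset.sum_congr rfl fun y _ => ?_
        rw [Finset.mul_sum]
        exact Finset.sum_congr rfl fun w _ => by ring
    _ ≤ (M ^ n / (4 * 2 ^ D) * (M ^ n' / (4 * 2 ^ D))) *
        (4 * 2 ^ D * prodWeight m τ ς A B γ (n + n') k l) := by
        gcongr
        exact sum_prodWeight_mul_le hτ hς hA hB hγ hγD hn hn' k l
    _ = _ := by
        -- The division by K = 4·2^D in `ProdBound` cancels the convolution constant, so no power of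
        -- K accumulates.
        rw [pow_add]; field_simp

lemma ProdBound.pow (hτ : 0 ≤ τ) (hς : 0 ≤ ς) (hA : 0 ≤ A) (hB : 0 ≤ B) (hM : 0 ≤ M)
    (hγ : 2 ≤ γ) (hγD : γ ≤ D) {f : FPS} (i : ℕ)
    (hf : 1 ≤ i → ProdBound m τ ς A B γ (4 * 2 ^ D) M 1 f) :
    ProdBound m τ ς A B γ (4 * 2 ^ D) M i (f ^ i) := by
  induction i with
  | zero => simp [ProdBound]
  | succ i ih =>
    rw [pow_succ]
    exact (ih fun _ => hf (by omega)).mul hτ hς hA hB hM hγ hγD (hf (by omega))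

lemma ProdBound.prod (hτ : 0 ≤ τ) (hς : 0 ≤ ς) (hA : 0 ≤ A) (hB : 0 ≤ B) (hM : 0 ≤ M)
    (hγ : 2 ≤ γ) (hγD : γ ≤ D) {ι : Type*} (s : Finset ι) (n : ι → ℕ) (f : ι → FPS)
    (hf : ∀ i ∈ s, ProdBound m τ ς A B γ (4 * 2 ^ D) M (n i) (f i)) :
    ProdBound m τ ς A B γ (4 * 2 ^ D) M (∑ i ∈ s, n i) (∏ i ∈ s, f i) := by
  classical
  induction s using Finset.induction_on with
  | empty => simp [ProdBound]
  | insert i s hi ih =>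
    rw [Finset.sum_insert hi, Finset.prod_insert hi]
    exact (hf i (by simp)).mul hτ hς hA hB hM hγ hγD (ih fun j hj => hf j (by simp [hj]))

end ProdBound

/-- The components of the jet of a series with the majorant `solWeight`. -/
lemma norm_co_jet_le (hτ : 0 ≤ τ) (hA : 0 ≤ A) (hB : 1 ≤ B) {u : FPS}
    (hu : ∀ l, co u 0 l = 0) (hW : ∀ k l, 1 ≤ k → ‖co u k l‖ ≤ solWeight m τ ς A B k l)
    {β : ℝ} (q : Idx m) (hq : (q.1.1 : ℝ) + q.1.2 + τ * q.1.2 ≤ β) (k l : ℕ) :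
    ‖co (jet m u (vz q)) k l‖ ≤ (B ^ m * ((2 * m + 1 : ℕ) : ℝ) ^ (m * (1 + τ))) *
      prodWeight m τ ς A B (m + τ * m + 2 - β) 1 k l := by
  have hB0 : 0 ≤ B := by linarith
  set j := q.1.1
  set α := q.1.2
  have hα : α ≤ m := by have := (mem_idxSet.1 q.2).1; omega
  rw [co_jet]
  rcases Nat.eq_zero_or_pos k with rfl | hk
  · rw [hu]
    simp [prodWeight]
  have hk0 : (0 : ℝ) < k := by exact_mod_cast hk
  have hk1 : (1 : ℝ) ≤ k := by exact_mod_cast hk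
  have hxw := xWeight_nonneg (τ := τ) hB0 ((2 * m + 1) * (k - 1) + 1 * (m + 1)) l
  have hd := ascFactorial_mul_xWeight_le hτ hB0 (a := (2 * m + 1) * (k - 1) + 1)
    (a' := (2 * m + 1) * (k - 1) + 1 * (m + 1)) (s := (2 * m + 1) * k) (α := α) l (by omega)
    (by omega) (by
      obtain ⟨k, rfl⟩ := Nat.exists_eq_add_of_le' hk
      rw [Nat.add_sub_cancel, mul_add]
      omega)
  have hs : (((2 * m + 1) * k : ℕ) : ℝ) ^ (α * (1 + τ))
      ≤ ((2 * m + 1 : ℕ) : ℝ) ^ (m * (1 + τ)) * (k : ℝ) ^ (α * (1 + τ)) := by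
    rw [Nat.cast_mul, Real.mul_rpow (by positivity) hk0.le]
    gcongr
    exact_mod_cast (show 1 ≤ 2 * m + 1 by omega)
  have hBα : B ^ α ≤ B ^ m := pow_le_pow_right₀ hB hα
  have hpow : (k : ℝ) ^ j * (k : ℝ) ^ (α * (1 + τ)) * (k : ℝ) ^ (-(m + τ * m + 2))
      ≤ (k : ℝ) ^ (-(m + τ * m + 2 - β)) := by
    rw [← Real.rpow_natCast, ← Real.rpow_add hk0, ← Real.rpow_add hk0]
    exact Real.rpow_le_rpow_of_exponent_le hk1 (by nlinarith)
  rw [prodWeight, if_pos (show 1 ≤ k from hk), norm_mul, norm_pow, norm_mul, Complex.norm_natCast,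
    Complex.norm_natCast]
  calc (k : ℝ) ^ j * (((l + 1).ascFactorial α : ℝ) * ‖co u k (l + α)‖)
      ≤ (k : ℝ) ^ j * (((l + 1).ascFactorial α : ℝ) * solWeight m τ ς A B k (l + α)) := by
        gcongr
        exact hW k _ hk
    _ = A ^ (2 * k - 1) * ((k - 1)! : ℝ) ^ ς * ((k : ℝ) ^ j * (k : ℝ) ^ (-(m + τ * m + 2))) *
        (((l + 1).ascFactorial α : ℝ) * xWeight τ B ((2 * m + 1) * (k - 1) + 1) (l + α)) := by
        unfold solWeight; ring
    _ ≤ A ^ (2 * k - 1) * ((k - 1)! : ℝ) ^ ς * ((k : ℝ) ^ j * (k : ℝ) ^ (-(m + τ * m + 2))) *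
        (B ^ m * (((2 * m + 1 : ℕ) : ℝ) ^ (m * (1 + τ)) * (k : ℝ) ^ (α * (1 + τ))) *
          xWeight τ B ((2 * m + 1) * (k - 1) + 1 * (m + 1)) l) := by
        refine mul_le_mul_of_nonneg_left (hd.trans ?_) (by positivity)
        gcongr
    _ = (B ^ m * ((2 * m + 1 : ℕ) : ℝ) ^ (m * (1 + τ))) * (A ^ (2 * k - 1) * ((k - 1)! : ℝ) ^ ς *
        ((k : ℝ) ^ j * (k : ℝ) ^ (α * (1 + τ)) * (k : ℝ) ^ (-(m + τ * m + 2))) *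
          xWeight τ B ((2 * m + 1) * (k - 1) + 1 * (m + 1)) l) := by ring
    _ ≤ _ := by gcongr

lemma norm_co_X_zero_le (hA : 1 ≤ A) (hB : 0 ≤ B) (γ : ℝ) (k l : ℕ) :
    ‖co (MvPowerSeries.X 0) k l‖ ≤ prodWeight m τ ς A B γ 1 k l := by
  rw [co_X_zero]
  split_ifs with h
  · obtain ⟨rfl, rfl⟩ := h
    simpa [prodWeight, xWeight] using hA
  · rw [norm_zero]
    exact prodWeight_nonneg (by linarith) hB _ _ _ _

/-- Comparison of the majorant of a product with that of the solution. -/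
lemma prodWeight_le_solWeight (hτ : 0 ≤ τ) (hς : 0 ≤ ς) (hA : 1 ≤ A) (hB : 1 ≤ B) {β : ℝ}
    {n k l μ : ℕ} (hn : 2 ≤ n) (hk : 1 ≤ k) (hμ : μ ≤ l)
    (hβ : β ≤ m + τ * μ + ς * ((n : ℝ) - 1)) :
    prodWeight m τ ς A B (m + τ * m + 2 - β) n k (l - μ)
      ≤ ((3 : ℝ) ^ ς) ^ n * (1 / A) ^ (n - 1) * (1 / B) ^ μ *
        ((k : ℝ) ^ m * solWeight m τ ς A B k l) := by
  have hA0 : 0 < A := by linarith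
  have hB0 : 0 < B := by linarith
  have hk0 : (0 : ℝ) < k := by exact_mod_cast hk
  have hk1 : (1 : ℝ) ≤ k := by exact_mod_cast hk
  have hsol := solWeight_nonneg (m := m) (τ := τ) (ς := ς) hA0.le hB0.le k l
  by_cases hnk : n ≤ k
  swap
  · rw [prodWeight, if_neg hnk]
    positivity
  rw [prodWeight, if_pos hnk]
  have hApow : A ^ (2 * k - n) = (1 / A) ^ (n - 1) * A ^ (2 * k - 1) := by
    rw [show 2 * k - 1 = (n - 1) + (2 * k - n) by omega, pow_add, ← mul_assoc, ← mul_pow,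
      one_div_mul_cancel hA0.ne', one_pow, one_mul]
  have hfac : ((k - n)! : ℝ) ^ ς
      ≤ ((3 : ℝ) ^ ς) ^ n * ((k - 1)! : ℝ) ^ ς * (k : ℝ) ^ (-(ς * ((n : ℝ) - 1))) := by
    have h1 : (k : ℝ) ^ (n - 1) * ((k - n)! : ℝ) ≤ 3 ^ n * ((k - 1)! : ℝ) := by
      exact_mod_cast pow_mul_factorial_sub_le (by omega) hnk
    have h2 := Real.rpow_le_rpow (by positivity) h1 hς
    have e1 : ((k : ℝ) ^ (n - 1)) ^ ς = (k : ℝ) ^ (ς * ((n : ℝ) - 1)) := by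
      rw [← Real.rpow_natCast, ← Real.rpow_mul hk0.le, Nat.cast_sub (by omega), Nat.cast_one,
        mul_comm]
    have e2 : ((3 : ℝ) ^ n) ^ ς = ((3 : ℝ) ^ ς) ^ n := by
      rw [← Real.rpow_natCast, ← Real.rpow_natCast, ← Real.rpow_mul (by norm_num),
        ← Real.rpow_mul (by norm_num), mul_comm]
    rw [Real.mul_rpow (by positivity) (by positivity),
      Real.mul_rpow (by positivity) (by positivity), e1, e2] at h2
    rw [Real.rpow_neg hk0.le, ← div_eq_mul_inv, le_div_iff₀ (by positivity)]
    linarith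
  -- This amounts to 2m ≤ nm. The slope 2m + 1 makes n = 2 the equality case, so the loss of m per
  -- jet component is recovered in every product.
  have hE : (2 * m + 1) * (k - n) + n * (m + 1) ≤ (2 * m + 1) * (k - 1) + 1 := by
    obtain ⟨i, rfl⟩ := Nat.exists_eq_add_of_le hnk
    obtain ⟨n, rfl⟩ := Nat.exists_eq_add_of_le' hn
    rw [show n + 2 + i - (n + 2) = i by omega, show n + 2 + i - 1 = n + 1 + i by omega]
    nlinarith [Nat.zero_le (m * n)]
  have hx : xWeight τ B ((2 * m + 1) * (k - n) + n * (m + 1)) (l - μ)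
      ≤ (1 / B) ^ μ * (k : ℝ) ^ (-(τ * μ)) * xWeight τ B ((2 * m + 1) * (k - 1) + 1) l := by
    have h1 := rpow_mul_xWeight_le hτ hB0.le (s := k) hE (by omega) hμ (by
      obtain ⟨k, rfl⟩ := Nat.exists_eq_add_of_le' hk
      rw [Nat.add_sub_cancel]
      nlinarith [Nat.zero_le (m * k)])
    rw [Real.rpow_neg hk0.le, one_div, inv_pow, ← mul_inv, inv_mul_eq_div,
      le_div_iff₀ (by positivity)]
    linarith
  have hpow : (k : ℝ) ^ (-(m + τ * m + 2 - β)) * (k : ℝ) ^ (-(ς * ((n : ℝ) - 1))) *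
      (k : ℝ) ^ (-(τ * μ)) ≤ (k : ℝ) ^ m * (k : ℝ) ^ (-(m + τ * m + 2)) := by
    rw [← Real.rpow_natCast, ← Real.rpow_add hk0, ← Real.rpow_add hk0, ← Real.rpow_add hk0]
    exact Real.rpow_le_rpow_of_exponent_le hk1 (by linarith)
  have hxw := xWeight_nonneg (τ := τ) hB0.le ((2 * m + 1) * (k - 1) + 1) l
  have hxw' := xWeight_nonneg (τ := τ) hB0.le ((2 * m + 1) * (k - n) + n * (m + 1)) (l - μ)
  calc _ ≤ (1 / A) ^ (n - 1) * A ^ (2 * k - 1) *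
        (((3 : ℝ) ^ ς) ^ n * ((k - 1)! : ℝ) ^ ς * (k : ℝ) ^ (-(ς * ((n : ℝ) - 1)))) *
        (k : ℝ) ^ (-(m + τ * m + 2 - β)) *
        ((1 / B) ^ μ * (k : ℝ) ^ (-(τ * μ)) * xWeight τ B ((2 * m + 1) * (k - 1) + 1) l) := by
        rw [hApow]
        gcongr
    _ = ((3 : ℝ) ^ ς) ^ n * (1 / A) ^ (n - 1) * (1 / B) ^ μ * (A ^ (2 * k - 1) *
        ((k - 1)! : ℝ) ^ ς * xWeight τ B ((2 * m + 1) * (k - 1) + 1) l) *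
        ((k : ℝ) ^ (-(m + τ * m + 2 - β)) * (k : ℝ) ^ (-(ς * ((n : ℝ) - 1))) *
      (k : ℝ) ^ (-(τ * μ))) := by ring
    _ ≤ ((3 : ℝ) ^ ς) ^ n * (1 / A) ^ (n - 1) * (1 / B) ^ μ * (A ^ (2 * k - 1) *
        ((k - 1)! : ℝ) ^ ς * xWeight τ B ((2 * m + 1) * (k - 1) + 1) l) *
        ((k : ℝ) ^ m * (k : ℝ) ^ (-(m + τ * m + 2))) := by gcongr
    _ = _ := by unfold solWeight; ring

/-- The constant in the estimate of the monomials. -/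
def monoConst (m : ℕ) (τ ς B : ℝ) : ℝ :=
  4 * 2 ^ (m + τ * m + 2) * (B ^ m * ((2 * m + 1 : ℕ) : ℝ) ^ (m * (1 + τ))) * 3 ^ ς

/-- The coefficients of a monomial in the jet. -/
lemma norm_co_jetMonomial_le (hτ : 0 ≤ τ) (hς : 0 ≤ ς) (hA : 1 ≤ A) (hB : 1 ≤ B) {u : FPS}
    (hu : ∀ l, co u 0 l = 0) (hW : ∀ k l, 1 ≤ k → ‖co u k l‖ ≤ solWeight m τ ς A B k l)
    {e : Var m →₀ ℕ} (he : 2 ≤ tzDeg e)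
    (hes : ∀ q : Idx m, 1 ≤ e (vz q) →
      (q.1.1 : ℝ) + q.1.2 + τ * (q.1.2 - e (vx m)) - m ≤ ς * ((tzDeg e : ℝ) - 1))
    {k : ℕ} (hk : 1 ≤ k) (l : ℕ) :
    ‖co (jetMonomial u e) k l‖ ≤ monoConst m τ ς B ^ tzDeg e * (1 / A) ^ (tzDeg e - 1) *
      (1 / B) ^ e (vx m) * ((k : ℝ) ^ m * solWeight m τ ς A B k l) := by
  have hA0 : 0 < A := by linarith
  have hB0 : 0 < B := by linarith
  set n := tzDeg e with hn
  set μ := e (vx m) with hμ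
  set D : ℝ := m + τ * m + 2 with hD
  set M₁ : ℝ := B ^ m * ((2 * m + 1 : ℕ) : ℝ) ^ (m * (1 + τ)) with hM₁
  have hM₁1 : 1 ≤ M₁ := by
    have h1 : 1 ≤ B ^ m := one_le_pow₀ hB
    have h2 : (1 : ℝ) ≤ ((2 * m + 1 : ℕ) : ℝ) ^ (m * (1 + τ)) :=
      Real.one_le_rpow (by exact_mod_cast (show 1 ≤ 2 * m + 1 by omega)) (by positivity)
    nlinarith
  have hD2 : 2 ≤ D := by
    have : 0 ≤ τ * m := by positivity
    have : (0 : ℝ) ≤ m := by positivity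
    linarith
  have hK1 : (1 : ℝ) ≤ 4 * 2 ^ D := by
    have : (1 : ℝ) ≤ 2 ^ D := Real.one_le_rpow (by norm_num) (by linarith)
    linarith
  have hn2 : (2 : ℝ) ≤ n := by exact_mod_cast he
  -- The first bound keeps the remaining exponent D - β at least 2, as convolution requires; the
  -- second is the power of k that the comparison with k^m `solWeight` can afford.
  set β : ℝ := min (m + τ * m) (m + τ * μ + ς * ((n : ℝ) - 1)) with hβ
  have hβ0 : 0 ≤ β := by
    refine le_min (by positivity) ?_
    have : 0 ≤ ς * ((n : ℝ) - 1) := mul_nonneg hς (by linarith)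
    positivity
  have hβ1 : β ≤ m + τ * m := min_le_left _ _
  have hγ : 2 ≤ D - β := by linarith
  have hγD : D - β ≤ D := by linarith
  have hM0 : 0 ≤ 4 * 2 ^ D * M₁ := by positivity
  have hone : ∀ f : FPS, (∀ k l, ‖co f k l‖ ≤ M₁ * prodWeight m τ ς A B (D - β) 1 k l) →
      ProdBound m τ ς A B (D - β) (4 * 2 ^ D) (4 * 2 ^ D * M₁) 1 f := by
    intro f hf
    rw [ProdBound, if_neg one_ne_zero]
    intro k l
    rw [pow_one, mul_div_cancel_left₀ _ (by positivity)]
    exact hf k l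
  have hfac : ProdBound m τ ς A B (D - β) (4 * 2 ^ D) (4 * 2 ^ D * M₁) n
      (MvPowerSeries.X 0 ^ e (vt m) * ∏ q : Idx m, jet m u (vz q) ^ e (vz q)) := by
    refine ProdBound.mul hτ hς hA0.le hB0.le hM0 hγ hγD ?_ ?_
    · refine ProdBound.pow hτ hς hA0.le hB0.le hM0 hγ hγD _ fun _ => hone _ fun k l => ?_
      refine (norm_co_X_zero_le (m := m) (τ := τ) (ς := ς) hA hB0.le (D - β) k l).trans ?_
      exact le_mul_of_one_le_left (prodWeight_nonneg hA0.le hB0.le _ _ _ _) hM₁1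
    · refine ProdBound.prod hτ hς hA0.le hB0.le hM0 hγ hγD _ _ _ fun q _ => ?_
      refine ProdBound.pow hτ hς hA0.le hB0.le hM0 hγ hγD _ fun hq => hone _ fun k l => ?_
      refine norm_co_jet_le hτ hA0.le hB hu hW q (le_min ?_ ?_) k l
      · have h1 : (q.1.1 : ℝ) + q.1.2 ≤ m := by exact_mod_cast (mem_idxSet.1 q.2).1
        have h2 : (q.1.2 : ℝ) ≤ m := by
          have : (0 : ℝ) ≤ q.1.1 := by positivity
          linarith
        have := mul_le_mul_of_nonneg_left h2 hτ
        linarith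
      · have := hes q hq
        linarith
  rw [ProdBound, if_neg (by omega)] at hfac
  rw [jetMonomial_eq_prod, mul_comm (MvPowerSeries.X 0 ^ e (vt m)), mul_assoc, co_X_one_pow_mul]
  have hsol := solWeight_nonneg (m := m) (τ := τ) (ς := ς) hA0.le hB0.le k l
  have hmc : 0 ≤ monoConst m τ ς B := by unfold monoConst; positivity
  split_ifs with hle
  swap
  · rw [norm_zero]; positivity
  calc _ ≤ (4 * 2 ^ D * M₁) ^ n / (4 * 2 ^ D) * prodWeight m τ ς A B (D - β) n k (l - μ) :=
        hfac k (l - μ)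
    _ ≤ (4 * 2 ^ D * M₁) ^ n * (((3 : ℝ) ^ ς) ^ n * (1 / A) ^ (n - 1) * (1 / B) ^ μ *
        ((k : ℝ) ^ m * solWeight m τ ς A B k l)) := by
        gcongr
        · exact prodWeight_nonneg hA0.le hB0.le _ _ _ _
        · exact div_le_self (by positivity) hK1
        · exact prodWeight_le_solWeight hτ hς hA hB he hk hle (min_le_right _ _)
    _ = _ := by
        rw [monoConst, mul_pow _ ((3 : ℝ) ^ ς)]
        ring

end Majorant

/-! ### The estimate of the solution -/

/-- A finite set of exponents lies in a box, over which the sum factors into geometric sums. -/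
lemma sum_half_pow_le {ι : Type*} [Fintype ι] (s : Finset (ι →₀ ℕ)) :
    ∑ e ∈ s, (1 / 2 : ℝ) ^ (∑ v, e v) ≤ 2 ^ Fintype.card ι := by
  classical
  set N := s.sup (fun e => ∑ v, e v) + 1 with hN
  have hlt : ∀ e ∈ s, ∀ v, e v < N := by
    intro e he v
    have h1 : e v ≤ ∑ v, e v :=
      Finset.single_le_sum (f := fun v => e v) (fun _ _ => Nat.zero_le _) (Finset.mem_univ v)
    have h2 : ∑ v, e v ≤ s.sup (fun e => ∑ v, e v) :=
      Finset.le_sup (f := fun e : ι →₀ ℕ => ∑ v, e v) he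
    omega
  calc ∑ e ∈ s, (1 / 2 : ℝ) ^ (∑ v, e v)
      = ∑ f ∈ s.image (fun e : ι →₀ ℕ => (⇑e : ι → ℕ)), (1 / 2 : ℝ) ^ (∑ v, f v) := by
        rw [Finset.sum_image fun e _ e' _ h => DFunLike.coe_injective h]
    _ ≤ ∑ f ∈ Fintype.piFinset fun _ : ι => Finset.range N, (1 / 2 : ℝ) ^ (∑ v, f v) := by
        refine Finset.sum_le_sum_of_subset_of_nonneg ?_ fun _ _ _ => by positivity
        intro f hf
        obtain ⟨e, he, rfl⟩ := Finset.mem_image.1 hf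
        exact Fintype.mem_piFinset.2 fun v => Finset.mem_range.2 (hlt e he v)
    _ = ∏ _v : ι, ∑ i ∈ Finset.range N, (1 / 2 : ℝ) ^ i := by
        rw [Finset.prod_univ_sum]
        exact Finset.sum_congr rfl fun f _ => (Finset.prod_pow_eq_pow_sum _ _ _).symm
    _ ≤ ∏ _v : ι, (2 : ℝ) := by
        refine Finset.prod_le_prod (fun _ _ => by positivity) fun _ _ => ?_
        exact sum_geometric_two_le N
    _ = 2 ^ Fintype.card ι := by simp

lemma sum_pow_succ_le {x : ℝ} (hx0 : 0 ≤ x) (hx : x ≤ 1 / 2) (l : ℕ) :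
    ∑ i ∈ Finset.range l, x ^ (i + 1) ≤ 2 * x := by
  calc ∑ i ∈ Finset.range l, x ^ (i + 1) ≤ ∑ i ∈ Finset.range l, x * (1 / 2) ^ i := by
        refine Finset.sum_le_sum fun i _ => ?_
        rw [pow_succ']
        gcongr
    _ = x * ∑ i ∈ Finset.range l, (1 / 2 : ℝ) ^ i := by rw [Finset.mul_sum]
    _ ≤ x * 2 := by gcongr; exact sum_geometric_two_le l
    _ = 2 * x := by ring

section Estimate

variable {m : ℕ} {F : (Var m → ℂ) → ℂ} {τ ς A B C a : ℝ}

lemma sum_eq_tzDeg_add (e : Var m →₀ ℕ) : ∑ v, e v = tzDeg e + e (vx m) := by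
  rw [Fintype.sum_sum_type, Fin.sum_univ_two, tzDeg]
  simp only [vt, vx, vz]
  ring

/-- Because n ≤ 2(n-1), each of the n - 1 factors 1/A can cancel a Q² and still leave 1/(4N). -/
lemma pow_mul_pow_sub_one_le {N Q : ℝ} (hN : 1 ≤ N) (hQ : 1 ≤ Q) (hA : 4 * N * Q ^ 2 ≤ A) {n : ℕ}
    (hn : 2 ≤ n) : Q ^ n * (1 / A) ^ (n - 1) ≤ 1 / N * (1 / 2) ^ n := by
  have hA0 : 0 < A := lt_of_lt_of_le (by positivity) hA
  have hN0 : 0 < N := by linarith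
  have h1 : Q ^ n ≤ (Q ^ 2) ^ (n - 1) := by
    rw [← pow_mul]
    exact pow_le_pow_right₀ hQ (by omega)
  have h2 : Q ^ 2 * (1 / A) ≤ 1 / N * (1 / 4) := by
    rw [mul_one_div, div_mul_div_comm, div_le_div_iff₀ hA0 (by positivity)]
    linarith
  have h3 : (1 / N) ^ (n - 1) ≤ 1 / N :=
    pow_le_of_le_one (by positivity) (by rw [div_le_one hN0]; exact hN) (by omega)
  have h4 : (1 / 4 : ℝ) ^ (n - 1) ≤ (1 / 2) ^ n := by
    rw [show (1 / 4 : ℝ) = (1 / 2) ^ 2 by norm_num, ← pow_mul]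
    exact pow_le_pow_of_le_one (by norm_num) (by norm_num) (by omega)
  calc Q ^ n * (1 / A) ^ (n - 1) ≤ (Q ^ 2) ^ (n - 1) * (1 / A) ^ (n - 1) := by gcongr
    _ = (Q ^ 2 * (1 / A)) ^ (n - 1) := by rw [mul_pow]
    _ ≤ (1 / N * (1 / 4)) ^ (n - 1) := by gcongr
    _ = (1 / N) ^ (n - 1) * (1 / 4) ^ (n - 1) := by rw [mul_pow]
    _ ≤ 1 / N * (1 / 2) ^ n := by gcongr

/-- The nonlinear part of the equation. -/
lemma norm_co_subst_R₂_le (hτ : 0 ≤ τ) (hς : 0 ≤ ς) (hA1 : 1 ≤ A) (hB1 : 1 ≤ B) (hC : 0 ≤ C)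
    (ha : 1 ≤ a) (hF : ∀ e : Var m →₀ ℕ, ‖MvPowerSeries.coeff e (taylor F)‖ ≤ C * a ^ (∑ v, e v))
    (hR : ∀ e : Var m →₀ ℕ, MvPowerSeries.coeff e (R₂ F) ≠ 0 → ∀ q : Idx m, 1 ≤ e (vz q) →
      (q.1.1 : ℝ) + q.1.2 + τ * (q.1.2 - e (vx m)) - m ≤ ς * ((tzDeg e : ℝ) - 1))
    (haB : 2 * a ≤ B) {N : ℝ} (hN : 1 ≤ N) (hQ : 1 ≤ a * monoConst m τ ς B)
    (hA : 4 * N * (a * monoConst m τ ς B) ^ 2 ≤ A) {u : FPS}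
    (hu : ∀ l, co u 0 l = 0) (hW : ∀ k l, 1 ≤ k → ‖co u k l‖ ≤ solWeight m τ ς A B k l)
    {k : ℕ} (hk : 1 ≤ k) (l : ℕ) :
    ‖co (MvPowerSeries.subst (jet m u) (R₂ F)) k l‖
      ≤ C * 2 ^ Fintype.card (Var m) / N * ((k : ℝ) ^ m * solWeight m τ ς A B k l) := by
  have hA0 : 0 < A := by linarith
  have hB0 : 0 < B := by linarith
  have ha0 : 0 < a := by linarith
  have hN0 : 0 < N := by linarith
  have hW0 : 0 ≤ (k : ℝ) ^ m * solWeight m τ ς A B k l :=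
    mul_nonneg (by positivity) (solWeight_nonneg hA0.le hB0.le k l)
  rw [co_subst hu, finsum_eq_sum_of_support_toFinset_subset _ (co_subst_finite hu _ k l)
    (subset_refl _)]
  set s := (co_subst_finite hu (R₂ F) k l).toFinset
  calc _ ≤ ∑ e ∈ s, C / N * ((k : ℝ) ^ m * solWeight m τ ς A B k l) * (1 / 2) ^ (∑ v, e v) := by
        refine (norm_sum_le _ _).trans (Finset.sum_le_sum fun e _ => ?_)
        by_cases hc : MvPowerSeries.coeff e (R₂ F) = 0
        · rw [hc, zero_mul, norm_zero]
          positivity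
        have hdeg : 2 ≤ tzDeg e := by
          by_contra hcon
          rw [coeff_R₂, if_neg hcon] at hc
          exact hc rfl
        have h1 := norm_co_jetMonomial_le hτ hς hA1 hB1 hu hW hdeg (hR e hc) hk l
        have h2 := hF e
        have h3 := pow_mul_pow_sub_one_le hN hQ hA hdeg
        have h4 : (a * (1 / B)) ^ e (vx m) ≤ (1 / 2) ^ e (vx m) := by
          have : a * (1 / B) ≤ 1 / 2 := by
            rw [mul_one_div, div_le_div_iff₀ hB0 (by norm_num)]; linarith
          gcongr
        rw [norm_mul, coeff_R₂, if_pos hdeg]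
        calc _ ≤ (C * a ^ (∑ v, e v)) * (monoConst m τ ς B ^ tzDeg e * (1 / A) ^ (tzDeg e - 1) *
              (1 / B) ^ e (vx m) * ((k : ℝ) ^ m * solWeight m τ ς A B k l)) :=
              mul_le_mul h2 h1 (norm_nonneg _) (by positivity)
          _ = C * ((k : ℝ) ^ m * solWeight m τ ς A B k l) *
              ((a * monoConst m τ ς B) ^ tzDeg e * (1 / A) ^ (tzDeg e - 1)) *
              (a * (1 / B)) ^ e (vx m) := by
              rw [sum_eq_tzDeg_add, pow_add, mul_pow, mul_pow]; ring
          _ ≤ C * ((k : ℝ) ^ m * solWeight m τ ς A B k l) * (1 / N * (1 / 2) ^ tzDeg e) *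
              (1 / 2) ^ e (vx m) := by gcongr
          _ = _ := by
              rw [sum_eq_tzDeg_add, pow_add]; ring
    _ = C / N * ((k : ℝ) ^ m * solWeight m τ ς A B k l) * ∑ e ∈ s, (1 / 2) ^ (∑ v, e v) := by
        rw [Finset.mul_sum]
    _ ≤ C / N * ((k : ℝ) ^ m * solWeight m τ ς A B k l) * 2 ^ Fintype.card (Var m) := by
        gcongr
        exact sum_half_pow_le s
    _ = _ := by ring

/-- The terms of the linear part that raise the exponent of `x` by `i`. -/
lemma term_le_polySize_mul_rpow_of_coeff_ne_zero (hτ : 0 ≤ τ)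
    (hσ : ∀ q ∈ Λ₁ F, d F q ≤ τ * p F q) (q : Idx m) {i : ℕ}
    (hi : PowerSeries.coeff i (c F q.1) ≠ 0) {k : ℕ} (hk : 1 ≤ k) (l : ℕ) :
    (k : ℝ) ^ q.1.1 * ((l : ℝ) + 1) ^ q.1.2 ≤ polySize F k l * ((l : ℝ) + 1) ^ (τ * i) := by
  classical
  have hl1 : (1 : ℝ) ≤ (l : ℝ) + 1 := by simp
  have hφ := polySize_pos (F := F) hk l
  by_cases h0 : c0 F q.1 = 0
  · have hcne : c F q.1 ≠ 0 := fun h => hi (by rw [h]; simp)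
    have hq : q.1 ∈ Λ₁ F := by
      rw [Λ₁, Finset.mem_filter]
      exact ⟨q.2, h0, hcne⟩
    have hp : p F q.1 ≤ i := by
      have := PowerSeries.order_le i hi
      rw [p]
      exact ENat.toNat_le_of_le_natCast this
    have hpR : (p F q.1 : ℝ) ≤ i := by exact_mod_cast hp
    refine (term_le_polySize_mul_rpow (F := F) hk l (mem_idxSet.1 q.2).2.le).trans ?_
    refine mul_le_mul_of_nonneg_left ?_ hφ.le
    refine Real.rpow_le_rpow_of_exponent_le hl1 ((hσ _ hq).trans ?_)
    gcongr
  · have hq : q.1 ∈ Λ₀ F := by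
      rw [Λ₀, Finset.mem_insert, Finset.mem_filter]
      exact Or.inr ⟨q.2, h0⟩
    refine (term_le_polySize k l hq).trans (le_mul_of_one_le_right hφ.le ?_)
    exact Real.one_le_rpow hl1 (by positivity)

lemma descFactorial_le_succ_pow (l α : ℕ) : l.descFactorial α ≤ (l + 1) ^ α :=
  (Nat.descFactorial_le_pow l α).trans (Nat.pow_le_pow_left (Nat.le_succ l) α)

/-- The excess (l-i+1)^{τi} over the Newton polygon is what the Gevrey factor gains when l - i is
raised to l; the powers of B leave B^{-i}. -/
lemma norm_linear_term_le (hτ : 0 ≤ τ) (hA : 0 ≤ A) (hB : 1 ≤ B)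
    (hσ : ∀ q ∈ Λ₁ F, d F q ≤ τ * p F q) (q : Idx m) {i k l : ℕ} (hk : 1 ≤ k) (hil : i ≤ l) :
    ‖PowerSeries.coeff i (c F q.1)‖ * ((k : ℝ) ^ q.1.1 * ((l - i).descFactorial q.1.2 : ℝ)) *
        solWeight m τ ς A B k (l - i)
      ≤ ‖PowerSeries.coeff i (c F q.1)‖ *
        (polySize F k l * solWeight m τ ς A B k l * (1 / B) ^ i) := by
  have hB0 : 0 < B := by linarith
  by_cases hi : PowerSeries.coeff i (c F q.1) = 0
  · simp [hi]
  rw [mul_assoc]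
  refine mul_le_mul_of_nonneg_left ?_ (norm_nonneg _)
  have hφ := polySize_pos (F := F) hk l
  have hφ' := polySize_pos (F := F) hk (l - i)
  have h1 : (k : ℝ) ^ q.1.1 * ((l - i).descFactorial q.1.2 : ℝ)
      ≤ polySize F k l * (((l - i : ℕ) : ℝ) + 1) ^ (τ * i) := by
    calc (k : ℝ) ^ q.1.1 * ((l - i).descFactorial q.1.2 : ℝ)
        ≤ (k : ℝ) ^ q.1.1 * (((l - i : ℕ) : ℝ) + 1) ^ q.1.2 := by
          gcongr
          exact_mod_cast descFactorial_le_succ_pow (l - i) q.1.2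
      _ ≤ polySize F k (l - i) * (((l - i : ℕ) : ℝ) + 1) ^ (τ * i) :=
          term_le_polySize_mul_rpow_of_coeff_ne_zero hτ hσ q hi hk (l - i)
      _ ≤ _ := by
          gcongr
          exact polySize_mono k (Nat.sub_le _ _)
  set E := (2 * m + 1) * (k - 1) + 1 with hE
  have h2 : (((l - i : ℕ) : ℝ) + 1) ^ (τ * i) * xWeight τ B E (l - i)
      ≤ xWeight τ B E l * (1 / B) ^ i := by
    have := rpow_mul_xWeight_le hτ hB0.le (a := E) (a' := E) (s := l - i + 1) le_rfl (by omega)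
      hil (by omega)
    rw [one_div, inv_pow, ← div_eq_mul_inv, le_div_iff₀ (by positivity), mul_assoc]
    exact_mod_cast this
  have hx := xWeight_nonneg (τ := τ) hB0.le E (l - i)
  calc (k : ℝ) ^ q.1.1 * ((l - i).descFactorial q.1.2 : ℝ) * solWeight m τ ς A B k (l - i)
      ≤ polySize F k l * (((l - i : ℕ) : ℝ) + 1) ^ (τ * i) * solWeight m τ ς A B k (l - i) :=
        mul_le_mul_of_nonneg_right h1 (solWeight_nonneg hA hB0.le _ _)
    _ = polySize F k l * (A ^ (2 * k - 1) * ((k - 1)! : ℝ) ^ ς * (k : ℝ) ^ (-(m + τ * m + 2))) *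
        ((((l - i : ℕ) : ℝ) + 1) ^ (τ * i) * xWeight τ B E (l - i)) := by
        rw [solWeight]; ring
    _ ≤ polySize F k l * (A ^ (2 * k - 1) * ((k - 1)! : ℝ) ^ ς * (k : ℝ) ^ (-(m + τ * m + 2))) *
        (xWeight τ B E l * (1 / B) ^ i) := by gcongr
    _ = _ := by rw [solWeight]; ring

lemma norm_linear_le (hτ : 0 ≤ τ) (hA : 0 ≤ A) (hB : 1 ≤ B) (hC : 0 ≤ C) (ha : 1 ≤ a)
    (haB : 2 * a ≤ B)
    (hF : ∀ e : Var m →₀ ℕ, ‖MvPowerSeries.coeff e (taylor F)‖ ≤ C * a ^ (∑ v, e v))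
    (hσ : ∀ q ∈ Λ₁ F, d F q ≤ τ * p F q) {u : FPS} {k l : ℕ} (hk : 1 ≤ k)
    (hW : ∀ l' < l, ‖co u k l'‖ ≤ solWeight m τ ς A B k l') :
    ‖∑ q : Idx m, ∑ i ∈ Finset.range l, PowerSeries.coeff (i + 1) (c F q.1) *
      ((k : ℂ) ^ q.1.1 * ((l - (i + 1)).descFactorial q.1.2 : ℂ)) * co u k (l - (i + 1))‖
      ≤ Fintype.card (Idx m) * (C * a ^ (m + 1) * (2 * (a / B))) *
        (polySize F k l * solWeight m τ ς A B k l) := by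
  have hB0 : 0 < B := by linarith
  have ha0 : 0 < a := by linarith
  have hφ := polySize_pos (F := F) hk l
  have hS := solWeight_nonneg (m := m) (τ := τ) (ς := ς) hA hB0.le k l
  have hc : ∀ (q : Idx m) (i : ℕ), ‖PowerSeries.coeff i (c F q.1)‖ ≤ C * a ^ (m + 1) * a ^ i := by
    intro q i
    rw [coeff_c]
    refine (hF _).trans ?_
    rw [sum_eq_tzDeg_add]
    have h1 : tzDeg (linExp q (i + q.1.2)) = 1 := tzDeg_linearExpo (some q, i + q.1.2)
    have h2 : linExp q (i + q.1.2) (vx m) = i + q.1.2 := by simp [linExp]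
    have h3 : q.1.2 ≤ m := by have := (mem_idxSet.1 q.2).1; omega
    rw [h1, h2, mul_assoc, ← pow_add]
    exact mul_le_mul_of_nonneg_left (pow_le_pow_right₀ ha (by omega)) hC
  have hterm : ∀ q : Idx m, ‖∑ i ∈ Finset.range l, PowerSeries.coeff (i + 1) (c F q.1) *
      ((k : ℂ) ^ q.1.1 * ((l - (i + 1)).descFactorial q.1.2 : ℂ)) * co u k (l - (i + 1))‖
      ≤ C * a ^ (m + 1) * (2 * (a / B)) * (polySize F k l * solWeight m τ ς A B k l) := by
    intro q
    calc _ ≤ ∑ i ∈ Finset.range l, (C * a ^ (m + 1) *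
          (polySize F k l * solWeight m τ ς A B k l)) * (a / B) ^ (i + 1) := by
          refine (norm_sum_le _ _).trans (Finset.sum_le_sum fun i hi => ?_)
          have hi : i < l := Finset.mem_range.1 hi
          rw [norm_mul, norm_mul, norm_mul, norm_pow, Complex.norm_natCast, Complex.norm_natCast]
          calc _ ≤ ‖PowerSeries.coeff (i + 1) (c F q.1)‖ *
                ((k : ℝ) ^ q.1.1 * ((l - (i + 1)).descFactorial q.1.2 : ℝ)) *
                  solWeight m τ ς A B k (l - (i + 1)) := by
                gcongr
                exact hW _ (by omega)
            _ ≤ ‖PowerSeries.coeff (i + 1) (c F q.1)‖ *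
                (polySize F k l * solWeight m τ ς A B k l * (1 / B) ^ (i + 1)) :=
                norm_linear_term_le hτ hA hB hσ q hk (by omega)
            _ ≤ (C * a ^ (m + 1) * a ^ (i + 1)) *
                (polySize F k l * solWeight m τ ς A B k l * (1 / B) ^ (i + 1)) := by
                gcongr
                exact hc q (i + 1)
            _ = _ := by rw [div_eq_mul_one_div a B, mul_pow]; ring
      _ = (C * a ^ (m + 1) * (polySize F k l * solWeight m τ ς A B k l)) *
          ∑ i ∈ Finset.range l, (a / B) ^ (i + 1) := by rw [Finset.mul_sum]
      _ ≤ (C * a ^ (m + 1) * (polySize F k l * solWeight m τ ς A B k l)) * (2 * (a / B)) := by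
          gcongr
          refine sum_pow_succ_le (by positivity) ?_ l
          rw [div_le_div_iff₀ hB0 (by norm_num)]; linarith
      _ = _ := by ring
  calc _ ≤ ∑ _q : Idx m, C * a ^ (m + 1) * (2 * (a / B)) *
        (polySize F k l * solWeight m τ ς A B k l) :=
        (norm_sum_le _ _).trans (Finset.sum_le_sum fun q _ => hterm q)
    _ = _ := by
        rw [Finset.sum_const, Finset.card_univ, nsmul_eq_mul]; ring

lemma pow_le_solWeight_one (hτ : 0 ≤ τ) (hA : 0 ≤ A) (hB : 0 ≤ B) (l : ℕ) :
    A * B ^ l ≤ solWeight m τ ς A B 1 l := by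
  have h1 : (1 : ℝ) ≤ (l ! : ℝ) ^ τ :=
    Real.one_le_rpow (by exact_mod_cast Nat.factorial_pos l) hτ
  simp only [solWeight, xWeight, Nat.sub_self, mul_zero, zero_add, Nat.multichoose_one,
    Nat.factorial_zero, Nat.cast_one, Real.one_rpow, mul_one]
  norm_num
  exact mul_le_mul_of_nonneg_left (le_mul_of_one_le_right (by positivity) h1) hA

/-- The coefficients of a formal solution have the majorant `solWeight`. -/
theorem exists_solWeight_bound (hτ : 0 ≤ τ) (hς : 0 ≤ ς) (hC : 0 < C) (ha : 1 ≤ a)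
    (hF : ∀ e : Var m →₀ ℕ, ‖MvPowerSeries.coeff e (taylor F)‖ ≤ C * a ^ (∑ v, e v))
    (hR : ∀ e : Var m →₀ ℕ, MvPowerSeries.coeff e (R₂ F) ≠ 0 → ∀ q : Idx m, 1 ≤ e (vz q) →
      (q.1.1 : ℝ) + q.1.2 + τ * (q.1.2 - e (vx m)) - m ≤ ς * ((tzDeg e : ℝ) - 1))
    (hσ : ∀ q ∈ Λ₁ F, d F q ≤ τ * p F q) {δ : ℝ} (hδ : 0 < δ)
    (hL : ∀ k l : ℕ, 1 ≤ k → δ * polySize F k l ≤ ‖L F k l‖) {u : FPS}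
    (hu : ∀ l, co u 0 l = 0)
    (heq : ∀ k l : ℕ, 1 ≤ k → L F k l * co u k l = recRhs F u k l) :
    ∃ A B : ℝ, 1 ≤ A ∧ 1 ≤ B ∧ ∀ k l, 1 ≤ k → ‖co u k l‖ ≤ solWeight m τ ς A B k l := by
  have ha0 : 0 < a := by linarith
  set I : ℝ := (Fintype.card (Idx m) : ℝ) with hI
  -- B makes the linear part at most δ/4. N does the same for the nonlinear part, and A, chosen last
  -- because Q depends on B, also covers the inhomogeneity. The total is 3δ/4.
  set B : ℝ := max (2 * a) (8 * I * C * a ^ (m + 2) / δ) with hB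
  have haB : 2 * a ≤ B := le_max_left _ _
  have hB1 : 1 ≤ B := by linarith
  have hB0 : 0 < B := by linarith
  set N : ℝ := max 1 (4 * C * 2 ^ Fintype.card (Var m) / δ) with hN
  have hN1 : 1 ≤ N := le_max_left _ _
  have hN0 : 0 < N := by linarith
  set Q : ℝ := a * monoConst m τ ς B with hQ
  have hmc : 1 ≤ monoConst m τ ς B := by
    have h1 : (1 : ℝ) ≤ 2 ^ (m + τ * m + 2) := Real.one_le_rpow (by norm_num) (by positivity)
    have h2 : 1 ≤ B ^ m := one_le_pow₀ hB1
    have h3 : (1 : ℝ) ≤ ((2 * m + 1 : ℕ) : ℝ) ^ (m * (1 + τ)) :=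
      Real.one_le_rpow (by exact_mod_cast (show 1 ≤ 2 * m + 1 by omega)) (by positivity)
    have h4 : (1 : ℝ) ≤ 3 ^ ς := Real.one_le_rpow (by norm_num) hς
    have h5 := one_le_mul_of_one_le_of_one_le h2 h3
    unfold monoConst
    exact one_le_mul_of_one_le_of_one_le (one_le_mul_of_one_le_of_one_le (by linarith) h5) h4
  have hQ1 : 1 ≤ Q := one_le_mul_of_one_le_of_one_le ha hmc
  set A : ℝ := max (4 * N * Q ^ 2) (4 * C * a / δ) with hA
  have hAQ : 4 * N * Q ^ 2 ≤ A := le_max_left _ _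
  have hA1 : 1 ≤ A := by
    refine le_trans ?_ hAQ
    have : 1 ≤ Q ^ 2 := one_le_pow₀ hQ1
    nlinarith
  have hA0 : 0 < A := by linarith
  refine ⟨A, B, hA1, hB1, ?_⟩
  have hlin : I * (C * a ^ (m + 1) * (2 * (a / B))) ≤ δ / 4 := by
    have h1 : 8 * I * C * a ^ (m + 2) / δ ≤ B := le_max_right _ _
    rw [div_le_iff₀ hδ] at h1
    have h2 : I * (C * a ^ (m + 1) * (2 * (a / B))) = 8 * I * C * a ^ (m + 2) / (4 * B) := by
      rw [pow_succ a (m + 1)]; field_simp; ring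
    rw [h2, div_le_div_iff₀ (by positivity) (by norm_num)]
    linarith
  have hnonlin : C * 2 ^ Fintype.card (Var m) / N ≤ δ / 4 := by
    have h1 : 4 * C * 2 ^ Fintype.card (Var m) / δ ≤ N := le_max_right _ _
    rw [div_le_iff₀ hδ] at h1
    rw [div_le_div_iff₀ hN0 (by norm_num)]
    linarith
  have hacoef : C * a ≤ δ / 4 * A := by
    have h1 : 4 * C * a / δ ≤ A := le_max_right _ _
    rw [div_le_iff₀ hδ] at h1
    linarith
  intro k
  induction k using Nat.strong_induction_on with
  | _ k ihk =>
  intro l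
  induction l using Nat.strong_induction_on with
  | _ l ihl =>
  intro hk
  have hφ := polySize_pos (F := F) hk l
  have hφk := pow_le_polySize (F := F) k l
  have hS := solWeight_nonneg (m := m) (τ := τ) (ς := ς) hA0.le hB0.le k l
  -- The nonlinear estimate needs bounds for all coefficients, while the induction supplies only the
  -- rows below k. The truncation v satisfies them all and gives the same coefficient in row k.
  set v : FPS := ofCo fun k' l' => if k' < k then co u k' l' else 0 with hv
  have hv0 : ∀ l, co v 0 l = 0 := fun l => by simp [hv, hu]
  have hvW : ∀ k' l', 1 ≤ k' → ‖co v k' l'‖ ≤ solWeight m τ ς A B k' l' := by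
    intro k' l' hk'
    rw [hv, co_ofCo]
    split_ifs with h
    · exact ihk k' h l' hk'
    · rw [norm_zero]; exact solWeight_nonneg hA0.le hB0.le _ _
  have h1 : ‖(if k = 1 then aCoeff F l else 0 : ℂ)‖
      ≤ δ / 4 * (polySize F k l * solWeight m τ ς A B k l) := by
    split_ifs with h
    · subst h
      have h2 : ‖aCoeff F l‖ ≤ C * a ^ (l + 1) := by
        refine (hF _).trans (le_of_eq ?_)
        rw [sum_eq_tzDeg_add, tzDeg_linearExpo]
        simp [linearExpo, add_comm]
      have h3 : (1 : ℝ) ≤ polySize F 1 l := by simpa using hφk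
      have h4 := pow_le_solWeight_one (m := m) (τ := τ) (ς := ς) hτ hA0.le hB0.le l
      calc ‖aCoeff F l‖ ≤ C * a ^ (l + 1) := h2
        _ = C * a * a ^ l := by ring
        _ ≤ (δ / 4 * A) * B ^ l := by gcongr; linarith
        _ = δ / 4 * (1 * (A * B ^ l)) := by ring
        _ ≤ _ := by gcongr
    · rw [norm_zero]; positivity
  have h2 := norm_linear_le (ς := ς) hτ hA0.le hB1 hC.le ha haB hF hσ (u := u) (l := l) hk
    fun l' hl' => ihl l' hl' hk
  have h3 := norm_co_subst_R₂_le hτ hς hA1 hB1 hC.le ha hF hR haB hN1 hQ1 hAQ hv0 hvW hk l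
  rw [← co_subst_R₂_congr hu hv0 fun k' hk' l' => by simp [hv, hk']] at h3
  have h4 : ‖L F k l‖ * ‖co u k l‖ ≤ 3 * (δ / 4) * (polySize F k l * solWeight m τ ς A B k l) := by
    rw [← norm_mul, heq k l hk, recRhs]
    refine (norm_add₃_le).trans ?_
    have h2' := h2.trans (mul_le_mul_of_nonneg_right hlin (by positivity))
    have h3' : ‖co (MvPowerSeries.subst (jet m u) (R₂ F)) k l‖
        ≤ δ / 4 * (polySize F k l * solWeight m τ ς A B k l) := by
      refine h3.trans ?_
      gcongr
    linarith
  have h5 : δ * polySize F k l * ‖co u k l‖ ≤ δ * polySize F k l * solWeight m τ ς A B k l := by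
    calc δ * polySize F k l * ‖co u k l‖ ≤ ‖L F k l‖ * ‖co u k l‖ := by
          gcongr; exact hL k l hk
      _ ≤ _ := h4
      _ ≤ δ * polySize F k l * solWeight m τ ς A B k l := by
          have : 0 ≤ δ * (polySize F k l * solWeight m τ ς A B k l) := by positivity
          linarith
  exact le_of_mul_le_mul_left h5 (by positivity)

end Estimate

/-! ### Convergence and Gevrey classes -/

lemma isConvergent_of_norm_coeff_le {f : FPS} {a b : ℝ} (ha : 0 < a) (hb : 0 < b)
    (h : ∀ k l, ‖co f k l‖ ≤ a ^ k * b ^ l) : IsConvergent f := by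
  have h1 : ∀ᶠ w : ℂ × ℂ in 𝓝 0, a * ‖w.1‖ < 1 / 2 := by
    have : Filter.Tendsto (fun w : ℂ × ℂ => a * ‖w.1‖) (𝓝 0) (𝓝 (a * ‖(0 : ℂ × ℂ).1‖)) :=
      (by fun_prop : Continuous fun w : ℂ × ℂ => a * ‖w.1‖).tendsto 0
    exact this.eventually_lt_const (by simp)
  have h2 : ∀ᶠ w : ℂ × ℂ in 𝓝 0, b * ‖w.2‖ < 1 / 2 := by
    have : Filter.Tendsto (fun w : ℂ × ℂ => b * ‖w.2‖) (𝓝 0) (𝓝 (b * ‖(0 : ℂ × ℂ).2‖)) :=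
      (by fun_prop : Continuous fun w : ℂ × ℂ => b * ‖w.2‖).tendsto 0
    exact this.eventually_lt_const (by simp)
  filter_upwards [h1, h2] with w hw1 hw2
  rw [← expoEquiv.summable_iff]
  have hg : Summable fun y : ℕ × ℕ => (1 / 2 : ℝ) ^ y.1 * (1 / 2 : ℝ) ^ y.2 :=
    summable_geometric_two.mul_of_nonneg summable_geometric_two
      (fun _ => by positivity) fun _ => by positivity
  refine Summable.of_norm_bounded hg fun y => ?_
  have hy := h y.1 y.2
  simp only [Function.comp_apply, expoEquiv, Equiv.coe_fn_mk, expo_apply_zero, expo_apply_one,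
    norm_mul, norm_pow]
  calc ‖MvPowerSeries.coeff (expo y.1 y.2) f‖ * ‖w.1‖ ^ y.1 * ‖w.2‖ ^ y.2
      ≤ a ^ y.1 * b ^ y.2 * ‖w.1‖ ^ y.1 * ‖w.2‖ ^ y.2 := by gcongr; exact hy
    _ = (a * ‖w.1‖) ^ y.1 * (b * ‖w.2‖) ^ y.2 := by rw [mul_pow, mul_pow]; ring
    _ ≤ _ := by gcongr

lemma mem_gevrey_of_norm_coeff_le {f : FPS} {a b s σ τ ς : ℝ} (ha : 0 < a) (hb : 0 < b)
    (hς : 1 + ς ≤ s) (hτ : 1 + τ ≤ σ)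
    (h : ∀ k l, ‖co f k l‖ ≤ a ^ k * b ^ l * ((k ! : ℝ) ^ ς * (l ! : ℝ) ^ τ)) :
    f ∈ Gevrey s σ := by
  refine isConvergent_of_norm_coeff_le ha hb fun k l => ?_
  have hk : (1 : ℝ) ≤ k ! := by exact_mod_cast Nat.factorial_pos k
  have hl : (1 : ℝ) ≤ l ! := by exact_mod_cast Nat.factorial_pos l
  have h1 : co (borel s σ f) k l
      = co f k l / (((k ! : ℝ) ^ (s - 1) * (l ! : ℝ) ^ (σ - 1) : ℝ) : ℂ) := by
    change co f k l / (((((expo k l) 0)! : ℝ) ^ (s - 1) * (((expo k l) 1)! : ℝ) ^ (σ - 1) : ℝ) : ℂ)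
      = _
    simp only [expo_apply_zero, expo_apply_one]
  have hpos : 0 < (k ! : ℝ) ^ (s - 1) * (l ! : ℝ) ^ (σ - 1) := by positivity
  rw [h1, norm_div, Complex.norm_real, Real.norm_of_nonneg hpos.le, div_le_iff₀ hpos]
  refine (h k l).trans (mul_le_mul_of_nonneg_left ?_ (by positivity))
  gcongr
  · linarith
  · linarith

/-- The rising factorial is l! times `multichoose`, and `multichoose` is at most a power of 2 with
exponent linear in k and l. Only k!^ς l!^τ is not geometric. -/
lemma solWeight_le {m : ℕ} {τ ς A B : ℝ} (hτ : 0 ≤ τ) (hς : 0 ≤ ς) (hA : 1 ≤ A) (hB : 1 ≤ B)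
    {k : ℕ} (hk : 1 ≤ k) (l : ℕ) :
    solWeight m τ ς A B k l ≤ (A ^ 2 * ((2 : ℝ) ^ (1 + τ)) ^ (2 * m + 1)) ^ k *
      (B * (2 : ℝ) ^ (1 + τ)) ^ l * ((k ! : ℝ) ^ ς * (l ! : ℝ) ^ τ) := by
  set E := (2 * m + 1) * (k - 1) + 1 with hE
  have hk0 : (1 : ℝ) ≤ k := by exact_mod_cast hk
  have h1 : A ^ (2 * k - 1) ≤ (A ^ 2) ^ k := by
    rw [← pow_mul]
    exact pow_le_pow_right₀ hA (by omega)
  have h2 : ((k - 1)! : ℝ) ^ ς ≤ (k ! : ℝ) ^ ς := by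
    gcongr
    omega
  have h3 : (k : ℝ) ^ (-(m + τ * m + 2)) ≤ 1 :=
    Real.rpow_le_one_of_one_le_of_nonpos hk0 (by have : 0 ≤ (m : ℝ) + τ * m + 2 := by positivity
                                                 linarith)
  have h4 : (Nat.multichoose E l : ℝ) ≤ (2 : ℝ) ^ ((2 * m + 1) * k + l) := by
    have hle : E + l - 1 ≤ (2 * m + 1) * k + l := by
      have : (2 * m + 1) * (k - 1) ≤ (2 * m + 1) * k := Nat.mul_le_mul_left _ (Nat.sub_le _ _)
      omega
    rw [Nat.multichoose_eq]
    calc ((E + l - 1).choose l : ℝ) ≤ (2 : ℝ) ^ (E + l - 1) := by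
          exact_mod_cast Nat.choose_le_two_pow _ _
      _ ≤ _ := pow_le_pow_right₀ (by norm_num) hle
  have h5 : (Nat.multichoose E l : ℝ) ^ (1 + τ) ≤ ((2 : ℝ) ^ (1 + τ)) ^ ((2 * m + 1) * k + l) := by
    refine (Real.rpow_le_rpow (by positivity) h4 (by positivity)).trans (le_of_eq ?_)
    rw [← Real.rpow_natCast, ← Real.rpow_natCast, ← Real.rpow_mul (by norm_num),
      ← Real.rpow_mul (by norm_num), mul_comm]
  have h6 : (E.ascFactorial l : ℝ) ^ τ * (Nat.multichoose E l : ℝ)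
      = (l ! : ℝ) ^ τ * (Nat.multichoose E l : ℝ) ^ (1 + τ) := by
    have hpos : (0 : ℝ) < Nat.multichoose E l := by
      have h := factorial_mul_multichoose (a := E) (by omega) l
      have h' : 0 < E.ascFactorial l := by
        rw [hE]; exact Nat.ascFactorial_pos _ l
      rw [← h] at h'
      exact_mod_cast Nat.pos_of_mul_pos_left h'
    rw [← factorial_mul_multichoose (a := E) (by omega) l, Nat.cast_mul,
      Real.mul_rpow (by positivity) (by positivity), Real.rpow_add hpos, Real.rpow_one]
    ring
  calc solWeight m τ ς A B k l
      = A ^ (2 * k - 1) * ((k - 1)! : ℝ) ^ ς * (k : ℝ) ^ (-(m + τ * m + 2)) *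
        (B ^ l * ((l ! : ℝ) ^ τ * (Nat.multichoose E l : ℝ) ^ (1 + τ))) := by
        rw [solWeight, xWeight, mul_assoc (B ^ l), h6]
    _ ≤ (A ^ 2) ^ k * (k ! : ℝ) ^ ς * 1 *
        (B ^ l * ((l ! : ℝ) ^ τ * ((2 : ℝ) ^ (1 + τ)) ^ ((2 * m + 1) * k + l))) := by gcongr
    _ = _ := by rw [pow_add, pow_mul, mul_pow, mul_pow]; ring

/-! ### What the definitions of σ₀ and s₀ provide. -/

section Indices

variable {m : ℕ} {F : (Var m → ℂ) → ℂ}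

lemma one_le_σ₀ : 1 ≤ σ₀ F := (Finset.le_fold_max _).2 (Or.inl le_rfl)

lemma one_le_s₀ : 1 ≤ s₀ F := by
  have : (0 : ℝ) ≤ (Finset.range m ×ˢ (Finset.univ : Finset (Idx m))).fold max 0
    fun y => s₀Quot F y.1 y.2 := (Finset.le_fold_max _).2 (Or.inl le_rfl)
  rw [s₀]
  linarith

lemma d_le_of_mem_Λ₁ {q : ℕ × ℕ} (hq : q ∈ Λ₁ F) : d F q ≤ (σ₀ F - 1) * p F q := by
  classical
  have hq' := hq
  rw [Λ₁, Finset.mem_filter] at hq'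
  obtain ⟨-, h0, hne⟩ := hq'
  have hp : p F q ≠ 0 := by
    rw [p, Ne, ENat.toNat_eq_zero, not_or]
    exact ⟨fun h => PowerSeries.order_ne_zero_iff_constCoeff_eq_zero.2 h0 h,
      fun h => hne (PowerSeries.order_eq_top.1 h)⟩
  have hp0 : (0 : ℝ) < p F q := by exact_mod_cast Nat.pos_of_ne_zero hp
  have h1 : ((p F q : ℝ) + d F q) / (p F q : ℝ) ≤ σ₀ F :=
    (Finset.le_fold_max _).2 (Or.inr ⟨q, hq, le_rfl⟩)
  rw [div_le_iff₀ hp0] at h1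
  linarith

lemma coeff_iterate_pderiv_ne_zero_iff {ι : Type*} (i : ι) (f : MvPowerSeries ι ℂ) (μ : ℕ)
    (e : ι →₀ ℕ) : MvPowerSeries.coeff e ((MvPowerSeries.pderiv ℂ i)^[μ] f) ≠ 0 ↔
      MvPowerSeries.coeff (e + Finsupp.single i μ) f ≠ 0 := by
  induction μ generalizing e with
  | zero => simp
  | succ μ ih =>
    have h : ((e i : ℂ) + 1) ≠ 0 := Nat.cast_add_one_ne_zero _
    rw [Function.iterate_succ_apply', MvPowerSeries.coeff_pderiv, mul_ne_zero_iff,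
      and_iff_left h, ih, add_assoc, ← Finsupp.single_add, add_comm 1 μ]

lemma coeff_Lval_series_ne_zero_iff {μ : ℕ} {q : Idx m} {e : Var m →₀ ℕ} (he : e (vx m) = 0) :
    MvPowerSeries.coeff e (atXZero (MvPowerSeries.pderiv ℂ (vz q)
        ((MvPowerSeries.pderiv ℂ (vx m))^[μ] (R₂ F)))) ≠ 0 ↔
      MvPowerSeries.coeff (e + Finsupp.single (vz q) 1 + Finsupp.single (vx m) μ) (R₂ F) ≠ 0 := by
  have h : ((e (vz q) : ℂ) + 1) ≠ 0 := Nat.cast_add_one_ne_zero _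
  have h1 : ∀ f : MvPowerSeries (Var m) ℂ,
      MvPowerSeries.coeff e (atXZero f) = MvPowerSeries.coeff e f := fun f => if_pos he
  rw [h1, MvPowerSeries.coeff_pderiv, mul_ne_zero_iff, and_iff_left h,
    coeff_iterate_pderiv_ne_zero_iff]

/-- Terms of R₂ have degree at least two in (t,z), so one z-derivative leaves no constant term.
Finite denominators in `s₀Quot` are thus positive. -/
lemma Lval_ne_zero (μ : ℕ) (q : Idx m) : Lval F μ q ≠ 0 := by
  rw [Lval, ← Order.one_le_iff_ne_zero, MvPowerSeries.one_le_order_iff_constCoeff_eq_zero,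
    ← MvPowerSeries.coeff_zero_eq_constantCoeff_apply]
  by_contra h
  rw [← ne_eq, coeff_Lval_series_ne_zero_iff (by simp), coeff_R₂, if_neg] at h
  · exact h rfl
  · simp [tzDeg, Finsupp.single_apply]

/-- The monomial e survives μ derivatives in x and one in z_q, and then has degree one less in
(t,z). -/
lemma Lval_le {μ : ℕ} {q : Idx m} {e : Var m →₀ ℕ} (he : MvPowerSeries.coeff e (R₂ F) ≠ 0)
    (hμ : e (vx m) = μ) (hq : 1 ≤ e (vz q)) : Lval F μ q ≤ ((tzDeg e - 1 : ℕ) : ℕ∞) := by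
  classical
  set e' := e - Finsupp.single (vz q) 1 - Finsupp.single (vx m) μ with he'
  have hsum : e' + Finsupp.single (vz q) 1 + Finsupp.single (vx m) μ = e := by
    ext v
    simp only [he', Finsupp.add_apply, Finsupp.tsub_apply, Finsupp.single_apply]
    split_ifs with h1 h2 h2
    · rw [← h1] at h2; simp at h2
    · subst h1; omega
    · subst h2; omega
    · omega
  have hx : e' (vx m) = 0 := by simp [he', hμ]
  have hdeg : Finsupp.degree e' = tzDeg e - 1 := by
    rw [Finsupp.degree_eq_sum, sum_eq_tzDeg_add, hx, ← hsum]
    simp [tzDeg, Finsupp.single_apply, Finset.sum_add_distrib]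
  rw [← hdeg, Lval]
  refine MvPowerSeries.order_le ?_
  rwa [coeff_Lval_series_ne_zero_iff hx, hsum]

/-- The left side is the numerator j + μ + σ₀(α-μ) - m of `s₀Quot`, and its denominator is at most
the degree minus one. For μ ≥ m, where s₀ imposes nothing, α ≤ μ makes the left side nonpositive. -/
lemma le_s₀_mul {e : Var m →₀ ℕ} (he : MvPowerSeries.coeff e (R₂ F) ≠ 0) {q : Idx m}
    (hq : 1 ≤ e (vz q)) :
    (q.1.1 : ℝ) + q.1.2 + (σ₀ F - 1) * (q.1.2 - e (vx m)) - m
      ≤ (s₀ F - 1) * ((tzDeg e : ℝ) - 1) := by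
  have hdeg : 2 ≤ tzDeg e := by
    by_contra hcon
    rw [coeff_R₂, if_neg hcon] at he
    exact he rfl
  have hs : 0 ≤ s₀ F - 1 := sub_nonneg.2 one_le_s₀
  have hσ : 0 ≤ σ₀ F - 1 := sub_nonneg.2 one_le_σ₀
  have hdegR : (2 : ℝ) ≤ tzDeg e := by exact_mod_cast hdeg
  have hjα : (q.1.1 : ℝ) + q.1.2 ≤ m := by exact_mod_cast (mem_idxSet.1 q.2).1
  by_cases hμ : e (vx m) < m
  · have h1 := Lval_le he rfl hq
    set ℓ := Lval F (e (vx m)) q with hℓ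
    have htop : ℓ ≠ ⊤ := ne_top_of_le_ne_top (ENat.natCast_ne_top _) h1
    have h0 : ℓ.toNat ≠ 0 := by
      rw [Ne, ENat.toNat_eq_zero, not_or]
      exact ⟨Lval_ne_zero _ _, htop⟩
    have h2 : ℓ.toNat ≤ tzDeg e - 1 := ENat.toNat_le_of_le_natCast h1
    have h0R : (0 : ℝ) < ℓ.toNat := by exact_mod_cast Nat.pos_of_ne_zero h0
    have h2R : (ℓ.toNat : ℝ) ≤ (tzDeg e : ℝ) - 1 := by
      rw [le_sub_iff_add_le]
      exact_mod_cast (by omega : ℓ.toNat + 1 ≤ tzDeg e)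
    have h3 : s₀Quot F (e (vx m)) q ≤ s₀ F - 1 := by
      rw [s₀, add_sub_cancel_left]
      exact (Finset.le_fold_max _).2 (Or.inr ⟨(e (vx m), q), by simpa using hμ, le_rfl⟩)
    rw [s₀Quot, ← hℓ, if_neg htop, div_le_iff₀ h0R] at h3
    have h4 := mul_le_mul_of_nonneg_left h2R hs
    linarith
  · have h1 : (q.1.2 : ℝ) - e (vx m) ≤ 0 := by
      rw [sub_nonpos]
      have := (mem_idxSet.1 q.2).1
      exact_mod_cast (by omega : q.1.2 ≤ e (vx m))
    have h2 := mul_nonpos_of_nonneg_of_nonpos hσ h1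
    have h3 : 0 ≤ (s₀ F - 1) * ((tzDeg e : ℝ) - 1) := mul_nonneg hs (by linarith)
    linarith

end Indices

end Maillet

end

/-! ### The main theorem. -/

theorem theorem2p5 (m : ℕ) (hm : 1 ≤ m) (F : (Maillet.Var m → ℂ) → ℂ)
    (r : Maillet.Var m → ℝ) (hr : ∀ v, 0 < r v)
    (hA1 : Maillet.A1 F r) (hA2 : Maillet.A2 F r) (hA3 : Maillet.A3 F)
    (hN : Maillet.NonResonance F) (hGP : Maillet.GenPoincare F) :
    ∃ u : Maillet.FPS,
      (Maillet.IsFormalSolution F u ∧ ∀ v, Maillet.IsFormalSolution F v → v = u) ∧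
      (Maillet.σ₀ F = 1 → Maillet.IsConvergent u) ∧
      (1 < Maillet.σ₀ F →
        ∀ s σ : ℝ, Maillet.s₀ F ≤ s → Maillet.σ₀ F ≤ σ → u ∈ Maillet.Gevrey s σ) := by
  have h0 := Maillet.coeff_taylor_vx hr hA1 hA2
  obtain ⟨C, a, hC, ha, hF⟩ := Maillet.taylor_bound hr hA1
  obtain ⟨δ, hδ, hL⟩ := Maillet.exists_lower_bound hN hGP
  obtain ⟨u, hu, huniq⟩ := Maillet.exists_unique_formalSolution h0 hA3 hN
  obtain ⟨hu0, heq⟩ := (Maillet.isFormalSolution_iff h0 hA3 u).1 hu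
  have key : ∀ τ ς : ℝ, 0 ≤ τ → 0 ≤ ς →
      (∀ e : Maillet.Var m →₀ ℕ, MvPowerSeries.coeff e (Maillet.R₂ F) ≠ 0 →
        ∀ q : Maillet.Idx m, 1 ≤ e (Maillet.vz q) →
        (q.1.1 : ℝ) + q.1.2 + τ * (q.1.2 - e (Maillet.vx m)) - m
          ≤ ς * ((Maillet.tzDeg e : ℝ) - 1)) →
      (∀ q ∈ Maillet.Λ₁ F, Maillet.d F q ≤ τ * Maillet.p F q) →
      ∃ a b : ℝ, 0 < a ∧ 0 < b ∧ ∀ k l,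
        ‖Maillet.co u k l‖ ≤ a ^ k * b ^ l * ((k ! : ℝ) ^ ς * (l ! : ℝ) ^ τ) := by
    intro τ ς hτ hς hR hσ
    obtain ⟨A, B, hA, hB, hW⟩ :=
      Maillet.exists_solWeight_bound hτ hς hC ha hF hR hσ hδ hL hu0 heq
    refine ⟨A ^ 2 * ((2 : ℝ) ^ (1 + τ)) ^ (2 * m + 1), B * (2 : ℝ) ^ (1 + τ), by positivity,
      by positivity, fun k l => ?_⟩
    rcases Nat.eq_zero_or_pos k with rfl | hk
    · rw [hu0, norm_zero]
      positivity
    · exact (hW k l hk).trans (Maillet.solWeight_le hτ hς hA hB hk l)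
  refine ⟨u, ⟨hu, huniq⟩, fun h1 => ?_, fun _ s σ hs hσ => ?_⟩
  -- For σ₀ = 1 no factorial is needed: the condition on R₂ reduces to j + α ≤ m, and that on Λ₁ to
  -- d ≤ 0.
  · obtain ⟨a, b, ha, hb, h⟩ := key 0 0 le_rfl le_rfl
      (fun e _ q _ => by
        have : (q.1.1 : ℝ) + q.1.2 ≤ m := by exact_mod_cast (Maillet.mem_idxSet.1 q.2).1
        linarith)
      (fun q hq => by simpa [h1] using Maillet.d_le_of_mem_Λ₁ hq)
    exact Maillet.isConvergent_of_norm_coeff_le ha hb fun k l => by simpa using h k l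
  · obtain ⟨a, b, ha, hb, h⟩ := key (Maillet.σ₀ F - 1) (Maillet.s₀ F - 1)
      (sub_nonneg.2 Maillet.one_le_σ₀) (sub_nonneg.2 Maillet.one_le_s₀)
      (fun e he q hq => Maillet.le_s₀_mul he hq) (fun q hq => Maillet.d_le_of_mem_Λ₁ hq)
    exact Maillet.mem_gevrey_of_norm_coeff_le ha hb (by linarith) (by linarith) h
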